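/- Let $\phi(q)=\min_{v\in S}(a_v+\langle v,q\rangle)$, with $\emptyset\ne S\subset\mathbb Z^n$ finite and $a_v\in\mathbb R$, be a tropical polynomial on $\mathbb R^n$, and let $\Delta^{\mathbb Z}_\phi\subset S$ be the set of exponents $v$ for which $\phi$ equals $a_v+\langle v,\cdot\rangle$ on a non-empty open set. Identify $(\mathbb C^*)^n$ with $T^*\mathbb R^n/T^*_{\mathbb Z}\mathbb R^n$ through $z_j=e^{q_j+2\pi i y_j}$, with symplectic form $\sum_j dq_j\wedge dy_j$. For $\varepsilon>0$ let $\rho\ge 0$ be a smooth even function with support the closed ball of radius $\varepsilon$ about $0$ and integral $1$; put $\tilde\phi=\rho*\phi$, and for $v\in\Delta^{\mathbb Z}_\phi$ put $U_v=\{d\tilde\phi=v\}$ and $f_v=a_v+\langle v,\cdot\rangle-\tilde\phi$. Let $c>0$ be such that, for all $v\in\Delta^{\mathbb Z}_\phi$, $f_v(q)<2c$ implies that $q$ is at distance less than $\varepsilon$ from $U_v$. Let $r,s$ be surgery profiles: functions on $[c,\infty)$, smooth on $(c,\infty)$, with $r$ convex, $s$ concave, $r(t)=t$ and $s(t)=0$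 for $t\ge 2c$, $r'(c)=s'(c)=\tfrac12$, such that the graphs of $r'$ and $s'$ over $[c,\infty)$ together form a smooth plane curve. The tropical Lagrangian $L(\phi)$ is the surgery $\sigma_0\#_{\{U_v\}}\sigma_{-\phi}$ of the zero section $\sigma_0$ and the section $\sigma_{-\phi}=d(-\tilde\phi)$ at the regions $U_v$, $v\in\Delta^{\mathbb Z}_\phi$: over the region where $f_v\ge 2c$ for all $v$ it consists of both sections, and over $\{f_v<2c\}$ it consists of the graphs of $d(r\circ f_v)=r'(f_v)\,df_v$ and $d(s\circ f_v)=s'(f_v)\,df_v$ over $\{c\le f_v<2c\}$, glued along $\{f_v=c\}$. It is a manifold $L$ together with a map $\iota:L\to(\mathbb C^*)^n$, which may fail to be injective. Then there is $\varepsilon_0>0$, depending only on $\phi$, such that for every $0<\varepsilon<\varepsilon_0$ and all such choices of $\rho,c,r,s$ the following hold. The tangent planes of $L$ are $n$-dimensional and Lagrangian. The Maslov class of $L(\phi)$, the pull-back of the generator of $H^1(S^1,\mathbb Z)$ under the squared phase map $L\to S^1$ of its tangent planes with respect to $d\log z_1\wedge\dots\wedge d\log z_n$, is well defined and equals $0$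 in $H^1(L,\mathbb Z)$. Consequently every continuous (in particular every holomorphic) disk $u:(D^2,\partial D^2)\to((\mathbb C^*)^n,L(\phi))$ has Maslov index $0$; here the boundary loop of $u$ is required to lift continuously to $L$, and such a lift always exists if $\iota$ is injective. -/

import Mathlib

open scoped ContDiff Convolution Topology

/-! ### Singular cohomology in degree one and the generator of the circle -/

/-- Integral singular `k`-cochains of a space. -/
abbrev SingularCochain (X : Type*) [TopologicalSpace X] (k : ℕ) : Type _ :=
  C(stdSimplex ℝ (Fin (k + 1)), X) → ℤ

/-- The inclusion of the `i`-th face of the standard simplex. -/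
noncomputable def simplexFace (k : ℕ) (i : Fin (k + 2)) :
    C(stdSimplex ℝ (Fin (k + 1)), stdSimplex ℝ (Fin (k + 2))) :=
  ⟨stdSimplex.map i.succAbove, stdSimplex.continuous_map _⟩

/-- The singular coboundary. -/
noncomputable def singularCoboundary (X : Type*) [TopologicalSpace X] (k : ℕ) :
    SingularCochain X k →+ SingularCochain X (k + 1) where
  toFun c := fun σ => ∑ i : Fin (k + 2), (-1) ^ (i : ℕ) * c (σ.comp (simplexFace k i))
  map_zero' := by ext; simp
  map_add' c d := by ext; simp [mul_add, Finset.sum_add_distrib]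

/-- The first integral singular cohomology group `H¹(X; ℤ)`: cocycles modulo coboundaries. -/
abbrev SingularH1 (X : Type*) [TopologicalSpace X] : Type _ :=
  (singularCoboundary X 1).ker ⧸
    (singularCoboundary X 0).range.addSubgroupOf (singularCoboundary X 1).ker

/-- Pull-back of singular cochains along a continuous map. -/
def singularPullback {X Y : Type*} [TopologicalSpace X] [TopologicalSpace Y] (f : C(X, Y))
    (k : ℕ) : SingularCochain Y k →+ SingularCochain X k where
  toFun c := fun σ => c (f.comp σ)
  map_zero' := rfl
  map_add' _ _ := rfl

theorem singularPullback_coboundary {X Y : Type*} [TopologicalSpace X] [TopologicalSpace Y]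
    (f : C(X, Y)) (k : ℕ) (c : SingularCochain Y k) :
    singularCoboundary X k (singularPullback f k c) =
      singularPullback f (k + 1) (singularCoboundary Y k c) := rfl

/-- The angle lift of a singular simplex of the circle exists and is unique once its value at
one vertex is chosen. -/
theorem exists_circle_lift {k : ℕ} (σ : C(stdSimplex ℝ (Fin (k + 1)), Circle)) :
    ∃! F : C(stdSimplex ℝ (Fin (k + 1)), ℝ),
      F (stdSimplex.vertex 0) = Complex.arg (σ (stdSimplex.vertex 0) : ℂ) ∧
        Circle.exp ∘ F = σ := by
  have : ContractibleSpace (stdSimplex ℝ (Fin (k + 1))) :=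
    (convex_stdSimplex ℝ (Fin (k + 1))).contractibleSpace
      ⟨_, (stdSimplex.vertex (S := ℝ) (0 : Fin (k + 1))).2⟩
  have : LocallyPathConnectedSpace (stdSimplex ℝ (Fin (k + 1))) :=
    (convex_stdSimplex ℝ (Fin (k + 1))).locallyPathConnectedSpace
  exact Circle.isCoveringMap_exp.existsUnique_continuousMap_lifts σ _ _ (Circle.exp_arg _)

/-- A cochain representing the generator of `H¹(S¹; ℤ)`: lift a path `σ` to an angle function
`F` which starts at the principal argument of `σ 0`; its value on `σ` is the number of full turns
between the principal argument of `σ 1` and the end point of `F`. -/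
noncomputable def circleCochain : SingularCochain Circle 1 := fun σ =>
  round (((exists_circle_lift σ).choose (stdSimplex.vertex 1) -
    Complex.arg (σ (stdSimplex.vertex 1) : ℂ)) / (2 * Real.pi))

theorem circleCochain_eq (σ : C(stdSimplex ℝ (Fin 2), Circle)) (θ : C(stdSimplex ℝ (Fin 2), ℝ))
    (hθ : ∀ x, Circle.exp (θ x) = σ x) :
    (circleCochain σ : ℝ) * (2 * Real.pi) =
      (θ (stdSimplex.vertex 1) - Complex.arg (σ (stdSimplex.vertex 1) : ℂ)) -
        (θ (stdSimplex.vertex 0) - Complex.arg (σ (stdSimplex.vertex 0) : ℂ)) := by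
  have hex := exists_circle_lift σ
  obtain ⟨⟨h0, h1⟩, h2⟩ := hex.choose_spec
  set F := hex.choose with hF
  set e0 : stdSimplex ℝ (Fin 2) := stdSimplex.vertex 0
  set e1 : stdSimplex ℝ (Fin 2) := stdSimplex.vertex 1
  have hθF : θ + ContinuousMap.const _ (F e0 - θ e0) = F := by
    apply h2
    refine ⟨by simpa using h0, ?_⟩
    funext x
    have hc : Circle.exp (F e0 - θ e0) = 1 := by
      rw [Circle.exp_sub, hθ, show Circle.exp (F e0) = σ e0 from congrFun h1 e0, div_self']
    simp [Circle.exp_add, hc, hθ]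
  have hF1 : F e1 = θ e1 + (F e0 - θ e0) := by rw [← hθF]; simp
  have hex1 : Circle.exp (F e1) = Circle.exp (Complex.arg (σ e1 : ℂ)) := by
    rw [Circle.exp_arg]; exact congrFun h1 e1
  obtain ⟨m, hm⟩ := Circle.exp_eq_exp.1 hex1
  have hpi : (2 * Real.pi) ≠ 0 := by positivity
  have hround : circleCochain σ = m := by
    have : (F e1 - Complex.arg (σ e1 : ℂ)) / (2 * Real.pi) = m := by
      rw [hm]; field_simp; ring
    change round ((F e1 - Complex.arg (σ e1 : ℂ)) / (2 * Real.pi)) = m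
    rw [this, round_intCast]
  rw [hround]
  linarith [h0]

theorem circleCochain_mem : circleCochain ∈ (singularCoboundary Circle 1).ker := by
  rw [AddMonoidHom.mem_ker]
  funext τ
  obtain ⟨θ, ⟨-, hθ⟩, -⟩ := exists_circle_lift τ
  have key : ∀ i : Fin 3, _ := fun i =>
    circleCochain_eq (τ.comp (simplexFace 1 i)) (θ.comp (simplexFace 1 i))
      (fun x => congrFun hθ (simplexFace 1 i x))
  have k0 := key 0
  have k1 := key 1
  have k2 := key 2
  have s00 : (0 : Fin 3).succAbove (0 : Fin 2) = 1 := by decide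
  have s01 : (0 : Fin 3).succAbove (1 : Fin 2) = 2 := by decide
  have s10 : (1 : Fin 3).succAbove (0 : Fin 2) = 0 := by decide
  have s11 : (1 : Fin 3).succAbove (1 : Fin 2) = 2 := by decide
  have s20 : (2 : Fin 3).succAbove (0 : Fin 2) = 0 := by decide
  have s21 : (2 : Fin 3).succAbove (1 : Fin 2) = 1 := by decide
  have hv : ∀ (i : Fin 3) (j : Fin 2),
      simplexFace 1 i (stdSimplex.vertex j) = stdSimplex.vertex (i.succAbove j) :=
    fun i j => stdSimplex.map_vertex _ _
  simp only [ContinuousMap.comp_apply, hv, s00, s01, s10, s11, s20, s21] at k0 k1 k2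
  have hpi : (2 * Real.pi) ≠ 0 := by positivity
  have hsum : ((circleCochain (τ.comp (simplexFace 1 0)) : ℝ) -
      circleCochain (τ.comp (simplexFace 1 1)) + circleCochain (τ.comp (simplexFace 1 2))) = 0 := by
    apply mul_right_cancel₀ hpi
    linarith
  have hsum' : circleCochain (τ.comp (simplexFace 1 0)) -
      circleCochain (τ.comp (simplexFace 1 1)) + circleCochain (τ.comp (simplexFace 1 2)) = 0 := by
    exact_mod_cast hsum
  change ∑ i : Fin 3, (-1) ^ (i : ℕ) * circleCochain (τ.comp (simplexFace 1 i)) = 0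
  rw [Fin.sum_univ_three]
  simpa [sub_eq_add_neg] using hsum'

/-- The class in `H¹(X; ℤ)` obtained by pulling back the generator of `H¹(S¹; ℤ)` along a map
`X → S¹`. -/
noncomputable def circleMapClass {X : Type*} [TopologicalSpace X] (f : C(X, Circle)) :
    SingularH1 X :=
  QuotientAddGroup.mk ⟨singularPullback f 1 circleCochain, by
    rw [AddMonoidHom.mem_ker, singularPullback_coboundary,
      AddMonoidHom.mem_ker.1 circleCochain_mem, map_zero]⟩

/-- The map `g : S¹ → S¹` has degree `k`. -/
def HasCircleDegree (g : C(Circle, Circle)) (k : ℤ) : Prop :=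
  ∃ θ : C(ℝ, ℝ), (∀ t, Circle.exp (θ t) = g (Circle.exp (2 * Real.pi * t))) ∧
    θ 1 = θ 0 + 2 * Real.pi * k

/-! ### Tropical polynomials -/

/-- A tropical polynomial `⨁ a_v ⊙ x^v` in `n` variables (min-plus convention): a finite non-empty
set of exponents in `ℤⁿ` with real coefficients. -/
structure TropicalPolynomial (n : ℕ) where
  support : Finset (Fin n → ℤ)
  nonempty : support.Nonempty
  coeff : (Fin n → ℤ) → ℝ

/-- A lattice point, seen as a vector of `ℝⁿ`. -/
noncomputable def latticeVector {n : ℕ} (v : Fin n → ℤ) : EuclideanSpace ℝ (Fin n) :=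
  WithLp.toLp 2 fun i => (v i : ℝ)

namespace TropicalPolynomial

variable {n : ℕ} (φ : TropicalPolynomial n)

/-- The tropical monomial `a_v ⊙ x^v`, the affine function `q ↦ a_v + ⟨v, q⟩`. -/
noncomputable def monomial (v : Fin n → ℤ) (q : EuclideanSpace ℝ (Fin n)) : ℝ :=
  φ.coeff v + ∑ i, (v i : ℝ) * q i

/-- The piecewise linear concave function defined by a tropical polynomial. -/
noncomputable def eval (q : EuclideanSpace ℝ (Fin n)) : ℝ :=
  φ.support.inf' φ.nonempty fun v => φ.monomial v q

/-- The exponents `v` for which `φ` agrees with its monomial at `v` on a non-empty open set. -/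
def vertices : Set (Fin n → ℤ) :=
  {v | v ∈ φ.support ∧ ∃ O : Set (EuclideanSpace ℝ (Fin n)),
    IsOpen O ∧ O.Nonempty ∧ ∀ q ∈ O, φ.eval q = φ.monomial v q}

end TropicalPolynomial

/-! ### Smoothing and surgery data -/

/-- A smooth, symmetric, non-negative bump function of integral one, with support the ball of
radius `ε` around the origin. -/
structure IsSmoothingKernel {n : ℕ} (ε : ℝ) (ρ : EuclideanSpace ℝ (Fin n) → ℝ) : Prop where
  smooth : ContDiff ℝ ∞ ρ
  nonneg : ∀ x, 0 ≤ ρ x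
  symm : ∀ x, ρ (-x) = ρ x
  support_eq : tsupport ρ = Metric.closedBall 0 ε
  integral_eq : ∫ x, ρ x = 1

/-- The plane curve formed by the graphs of the derivatives of `r` and `s` over `[c, ∞)`. -/
def profileCurve (c : ℝ) (r s : ℝ → ℝ) : Set (ℝ × ℝ) :=
  {x | c ≤ x.1 ∧ (x.2 = derivWithin r (Set.Ici c) x.1 ∨ x.2 = derivWithin s (Set.Ici c) x.1)}

/-- Surgery profile functions `r` (convex) and `s` (concave) on `[c, ∞)`. Away from the point
`(c, 1/2)` the profile curve is smooth because `r` and `s` are. At this point, where the first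
coordinate attains its minimum on the curve, a smooth curve has a vertical tangent, so smoothness
means that it is the graph of a smooth function of the second coordinate there. -/
structure IsSurgeryProfile (c : ℝ) (r s : ℝ → ℝ) : Prop where
  smooth_r : ContDiffOn ℝ ∞ r (Set.Ioi c)
  smooth_s : ContDiffOn ℝ ∞ s (Set.Ioi c)
  convex_r : ConvexOn ℝ (Set.Ici c) r
  concave_s : ConcaveOn ℝ (Set.Ici c) s
  r_eq : ∀ t, 2 * c ≤ t → r t = t
  s_eq : ∀ t, 2 * c ≤ t → s t = 0
  deriv_r : HasDerivWithinAt r (1 / 2) (Set.Ici c) c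
  deriv_s : HasDerivWithinAt s (1 / 2) (Set.Ici c) c
  smooth_curve : ∃ h : ℝ → ℝ, ContDiff ℝ ∞ h ∧
    ∀ᶠ x in 𝓝 (c, (1 / 2 : ℝ)), x ∈ profileCurve c r s ↔ x.1 = h x.2

namespace TropicalPolynomial

variable {n : ℕ} (φ : TropicalPolynomial n)

/-- The smoothing of `φ` by convolution with the kernel `ρ`. -/
noncomputable def smoothing (ρ : EuclideanSpace ℝ (Fin n) → ℝ) :
    EuclideanSpace ℝ (Fin n) → ℝ :=
  ρ ⋆[ContinuousLinearMap.lsmul ℝ ℝ, MeasureTheory.volume] φ.eval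

/-- The region `U_v` where the smoothing of `φ` has differential `v`. Over it, the section
`d(-φ̃)` of `T*ℝⁿ / T*_ℤ ℝⁿ` agrees with the zero section. -/
def flatRegion (ρ : EuclideanSpace ℝ (Fin n) → ℝ) (v : Fin n → ℤ) :
    Set (EuclideanSpace ℝ (Fin n)) :=
  {q | gradient (φ.smoothing ρ) q = latticeVector v}

/-- The convex primitive near `U_v`, normalized to vanish on `U_v`, of the section `d(-φ̃)`
modulo the lattice. -/
noncomputable def neckPrimitive (ρ : EuclideanSpace ℝ (Fin n) → ℝ) (v : Fin n → ℤ)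
    (q : EuclideanSpace ℝ (Fin n)) : ℝ :=
  φ.monomial v q - φ.smoothing ρ q

/-- The surgery constant `c` is small relative to `ε`: the part of the base with primitive less
than `2c` lies within distance `ε` of `U_v`, for every neck `v`. -/
def IsSurgeryConstant (ρ : EuclideanSpace ℝ (Fin n) → ℝ) (ε c : ℝ) : Prop :=
  0 < c ∧ ∀ v ∈ φ.vertices, ∀ q, φ.neckPrimitive ρ v q < 2 * c →
    q ∈ Metric.thickening ε (φ.flatRegion ρ v)

end TropicalPolynomial

/-! ### The tropical Lagrangian -/

/-- The point of `(ℂˣ)ⁿ = T*ℝⁿ / T*_ℤ ℝⁿ` over `q` with covector `y`: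
`z_j = exp (q_j + 2πi y_j)`. -/
noncomputable def torusPoint {n : ℕ} (q y : EuclideanSpace ℝ (Fin n)) : Fin n → ℂ :=
  fun j => Complex.exp ((q j : ℂ) + 2 * Real.pi * Complex.I * (y j : ℂ))

/-- The surgery of the zero section and the section `d(-φ̃)` at all the regions `U_v` with `v` a
vertex, as an immersed Lagrangian of `(ℂˣ)ⁿ`. A point of the domain of the immersion is a pair
`(z, p)`, where `z` is the image point and the number `p` keeps the sheets apart.

With `f` the primitive at `v`, the graph of `d(r ∘ f) = r'(f) df` over `f ≥ c` consists of the
covectors `p df` with `p = r'(f)`, and similarly for `s`; the two charts are glued where `f = c`,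
`p = 1/2`. Where all the primitives are at least `2c`, what remains is the zero section (`p = 0`)
and the section `d(-φ̃)` (`p = 1`). -/
def tropicalLagrangian {n : ℕ} (φ : TropicalPolynomial n) (ρ : EuclideanSpace ℝ (Fin n) → ℝ)
    (c : ℝ) (r s : ℝ → ℝ) : Set ((Fin n → ℂ) × ℝ) :=
  {x | ∃ q : EuclideanSpace ℝ (Fin n),
    (∃ v ∈ φ.vertices, φ.neckPrimitive ρ v q < 2 * c ∧
        (φ.neckPrimitive ρ v q, x.2) ∈ profileCurve c r s ∧
        x.1 = torusPoint q (x.2 • gradient (φ.neckPrimitive ρ v) q)) ∨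
    ((∀ v ∈ φ.vertices, 2 * c ≤ φ.neckPrimitive ρ v q) ∧
      ((x.2 = 0 ∧ x.1 = torusPoint q 0) ∨
        (x.2 = 1 ∧ x.1 = torusPoint q (-gradient (φ.smoothing ρ) q))))}

/-! ### Immersed Lagrangians of `(ℂˣ)ⁿ` and their Maslov classes

In this section `L` is a submanifold of `(ℂˣ)ⁿ × ℝ` which is immersed into `(ℂˣ)ⁿ` by the first
projection. -/

/-- The tangent plane of the immersed submanifold at `x`, a subspace of `T_z (ℂˣ)ⁿ = ℂⁿ`. -/
noncomputable def tangentPlane {n : ℕ} (L : Set ((Fin n → ℂ) × ℝ)) (x : (Fin n → ℂ) × ℝ) :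
    Submodule ℝ (Fin n → ℂ) :=
  (Submodule.span ℝ (tangentConeAt ℝ L x)).map (LinearMap.fst ℝ (Fin n → ℂ) ℝ)

/-- The symplectic form `∑ dq_j ∧ dy_j` at the point `z` of `(ℂˣ)ⁿ`, where `q_j = log |z_j|` and
`2π y_j = arg z_j`. -/
noncomputable def torusSymplecticForm {n : ℕ} (z ξ η : Fin n → ℂ) : ℝ :=
  ∑ j, ((ξ j / z j).re * ((η j / z j).im / (2 * Real.pi)) -
    ((ξ j / z j).im / (2 * Real.pi)) * (η j / z j).re)

/-- `T` is a Lagrangian subspace of the tangent space at `z`. -/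
def IsLagrangianPlane {n : ℕ} (z : Fin n → ℂ) (T : Submodule ℝ (Fin n → ℂ)) : Prop :=
  Module.finrank ℝ T = n ∧ ∀ ξ ∈ T, ∀ η ∈ T, torusSymplecticForm z ξ η = 0

/-- `ζ` is the squared phase `det² / |det|²` of the subspace `T` of `ℂⁿ`, where `det` is taken of a
real basis of `T` written in the complex frame formed by the columns of `A`. -/
def IsSquaredPhase {n : ℕ} (A : Matrix (Fin n) (Fin n) ℂ) (T : Submodule ℝ (Fin n → ℂ))
    (ζ : Circle) : Prop :=
  ∃ b : Module.Basis (Fin n) ℝ T,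
    (A⁻¹ * Matrix.of fun i j => (b j : Fin n → ℂ) i).det ≠ 0 ∧
    (ζ : ℂ) = (A⁻¹ * Matrix.of fun i j => (b j : Fin n → ℂ) i).det ^ 2 /
      (‖(A⁻¹ * Matrix.of fun i j => (b j : Fin n → ℂ) i).det‖ : ℂ) ^ 2

/-- `m` is the Maslov class of `L` in `H¹(L; ℤ)`: the pull-back of the generator of `H¹(S¹; ℤ)`
under the squared phase map `L → S¹`, with respect to the global frame `z_j ∂/∂z_j` of
`T(ℂˣ)ⁿ`, equivalently the holomorphic volume form `dlog z_1 ∧ ⋯ ∧ dlog z_n`. -/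
def IsMaslovClass {n : ℕ} (L : Set ((Fin n → ℂ) × ℝ)) (m : SingularH1 L) : Prop :=
  ∃ Φ : C(L, Circle),
    (∀ x : L, IsSquaredPhase (Matrix.diagonal x.1.1) (tangentPlane L x) (Φ x)) ∧
    m = circleMapClass Φ

/-- The boundary inclusion of the circle into the closed unit disk. -/
noncomputable def circleToDisk (ζ : Circle) : Metric.closedBall (0 : ℂ) 1 :=
  ⟨ζ, by rw [mem_closedBall_zero_iff, Circle.norm_coe]⟩

/-- A continuous disk in `(ℂˣ)ⁿ` with boundary on the immersed submanifold `L`: the boundary loop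
comes with a lift to the domain of the immersion. -/
structure DiskOn {n : ℕ} (L : Set ((Fin n → ℂ) × ℝ)) where
  toFun : C(Metric.closedBall (0 : ℂ) 1, Fin n → ℂ)
  ne_zero : ∀ w j, toFun w j ≠ 0
  boundary : C(Circle, L)
  boundary_eq : ∀ ζ, (boundary ζ).1.1 = toFun (circleToDisk ζ)

/-- `k` is the Maslov index of the disk `u`: for some complex trivialization `Ψ` over the disk of the
pull-back `u*T(ℂˣ)ⁿ`, whose fibres are `ℂⁿ`, it is the degree of the squared phase of the
tangent planes of `L` along the boundary. -/
def DiskOn.IsMaslovIndex {n : ℕ} {L : Set ((Fin n → ℂ) × ℝ)} (u : DiskOn L) (k : ℤ) : Prop :=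
  ∃ (Ψ : C(Metric.closedBall (0 : ℂ) 1, Matrix (Fin n) (Fin n) ℂ)) (g : C(Circle, Circle)),
    (∀ w, IsUnit (Ψ w)) ∧
    (∀ ζ, IsSquaredPhase (Ψ (circleToDisk ζ)) (tangentPlane L (u.boundary ζ)) (g ζ)) ∧
    HasCircleDegree g k

/-! The Lagrangian is graded: its squared phase is lifted to a real function (`exists_grading`). A
circle map with a lift pulls the generator back to zero (`circleMapClass_eq_zero`). Disks then have
index zero, because `z_j ∂/∂z_j` is a global frame and any change of frame over a disk has a
determinant with continuous argument.

Write `w = df_v`, and let `p` be the sheet coordinate. On the graph of `k(f_v) df_v`, with `k = r'`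
or `k = s'`, the tangent plane in the frame `z_j ∂/∂z_j` is spanned by the columns of `1 + i(A + β w
wᵀ)`, where `A = -2πp Hess φ̃` and `β = 2π k'(f_v)`. Its determinant is `det (1 + iA) (1 + iβζ)`
with `ζ = wᵀ (1 + iA)⁻¹ w`. The first factor never vanishes on the convex space of real symmetric
matrices, so it has an argument depending continuously on `A`, and `A` is continuous on all of `L`.
For the second factor the decisive fact is `Re ζ ≥ 0`, with strict inequality for `w ≠ 0`
(`resolventForm_re`). Convexity of `r` gives `β ≥ 0`, so `1 + iβζ` lies in the closed upper half
plane without zero. Concavity of `s` gives `β ≤ 0`, so the negative of the factor lies there, and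
squaring the phase makes the sign harmless.

At the middle of a neck, `p = 1/2`, the plane is vertical in the direction of `w` and the factor
becomes `2πiζ` (`det_neck`). Nearby the profile curve is a graph `f_v = g(p)`, and the normalized
factors on both sides are positive multiples of `g'(p) + 2πiζ`. The principal argument is therefore
continuous through the neck; it runs from `π` on the zero section to `0` on the other section.

It remains that necks do not meet and that `w ≠ 0` at level `c`. The primitive `f_v` is an average
of the non-negative convex function `gap v` over a ball of radius `ε`. For small `ε` each linearity
cell contains such a ball, so `f_v` attains zero, and by convexity its critical points are zeros.
The condition on `c` then places `{f_v < 2c}` in the interior of the cell of `v`, and these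
interiors are disjoint. -/

/-! ### Continuous arguments and squared phases -/

/-- A non-vanishing complex function on a simply connected, locally path connected space has a
continuous argument. -/
theorem exists_continuous_arg {X : Type*} [TopologicalSpace X] [SimplyConnectedSpace X]
    [LocallyPathConnectedSpace X] (D : X → ℂ) (hc : Continuous D) (hD : ∀ x, D x ≠ 0) :
    ∃ θ : C(X, ℝ), ∀ x, D x = ‖D x‖ * (Circle.exp (θ x) : ℂ) := by
  have hn : ∀ x, (‖D x‖ : ℂ) ≠ 0 := fun x => by simpa using hD x
  let f : C(X, Circle) := ⟨fun x => ⟨D x / ‖D x‖, by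
      rw [Submonoid.unitSphere, ← SetLike.mem_coe]
      simp [hD x]⟩, by
    refine Continuous.subtype_mk ?_ _
    exact hc.div (by fun_prop) hn⟩
  obtain ⟨x₀⟩ : Nonempty X := inferInstance
  obtain ⟨θ, ⟨-, hθ⟩, -⟩ := Circle.isCoveringMap_exp.existsUnique_continuousMap_lifts f x₀ _
    (Circle.exp_arg (f x₀))
  refine ⟨θ, fun x => ?_⟩
  have h : Circle.exp (θ x) = f x := congrFun hθ x
  rw [h]
  change D x = ‖D x‖ * (D x / ‖D x‖)
  rw [mul_div_cancel₀ _ (hn x)]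

theorem sq_div_norm_sq_of_eq {d : ℂ} {θ : ℝ} (hd : d ≠ 0)
    (h : d = ‖d‖ * (Circle.exp θ : ℂ)) :
    d ^ 2 / (‖d‖ : ℂ) ^ 2 = (Circle.exp (2 * θ) : ℂ) := by
  have hn : (‖d‖ : ℂ) ≠ 0 := by simpa using hd
  rw [show d ^ 2 = (‖d‖ * (Circle.exp θ : ℂ)) ^ 2 by rw [← h], two_mul, Circle.exp_add,
    Circle.coe_mul]
  field_simp

/-- A real basis of a subspace of `ℂⁿ`, as a matrix. -/
noncomputable def basisMatrix {n : ℕ} {T : Submodule ℝ (Fin n → ℂ)}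
    (b : Module.Basis (Fin n) ℝ T) : Matrix (Fin n) (Fin n) ℂ :=
  Matrix.of fun i j => (b j : Fin n → ℂ) i

theorem basisMatrix_eq_mul {n : ℕ} {T : Submodule ℝ (Fin n → ℂ)}
    (b b' : Module.Basis (Fin n) ℝ T) :
    basisMatrix b' = basisMatrix b * (b.toMatrix b').map Complex.ofReal := by
  ext i j
  have h : ((b' j : T) : Fin n → ℂ) i = ∑ k, b.toMatrix b' k j * (b k : Fin n → ℂ) i := by
    have := congrArg (fun t : T => (t : Fin n → ℂ) i) (b.sum_toMatrix_smul_self b' j)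
    simpa [-Module.Basis.sum_toMatrix_smul_self] using this.symm
  simp only [basisMatrix, Matrix.of_apply, Matrix.mul_apply, Matrix.map_apply]
  rw [h]
  exact Finset.sum_congr rfl fun k _ => mul_comm _ _

/-- The squared phases of a subspace with respect to two complex frames differ by the squared
phase of the determinant of the change of frame. -/
theorem IsSquaredPhase.change_frame {n : ℕ} {A B : Matrix (Fin n) (Fin n) ℂ}
    {T : Submodule ℝ (Fin n → ℂ)} {ζ ξ : Circle} (hA : IsSquaredPhase A T ζ)
    (hB : IsSquaredPhase B T ξ) (hAu : IsUnit A) :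
    (ξ : ℂ) = ζ * ((B⁻¹ * A).det ^ 2 / (‖(B⁻¹ * A).det‖ : ℂ) ^ 2) := by
  obtain ⟨b, hb, hζ⟩ := hA
  obtain ⟨b', hb', hξ⟩ := hB
  change (A⁻¹ * basisMatrix b).det ≠ 0 at hb
  change (B⁻¹ * basisMatrix b').det ≠ 0 at hb'
  change (ζ : ℂ) = (A⁻¹ * basisMatrix b).det ^ 2 / (‖(A⁻¹ * basisMatrix b).det‖ : ℂ) ^ 2 at hζ
  change (ξ : ℂ) = (B⁻¹ * basisMatrix b').det ^ 2 / (‖(B⁻¹ * basisMatrix b').det‖ : ℂ) ^ 2 at hξ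
  set x : ℝ := (b.toMatrix b').det with hx
  have hAA : A * A⁻¹ = 1 := Matrix.mul_nonsing_inv _ ((Matrix.isUnit_iff_isUnit_det A).1 hAu)
  have key : (B⁻¹ * basisMatrix b').det =
      (B⁻¹ * A).det * (A⁻¹ * basisMatrix b).det * (x : ℂ) := by
    have hdx : ((b.toMatrix b').map Complex.ofReal).det = (x : ℂ) := by
      rw [hx]; exact (Complex.ofRealHom.map_det (b.toMatrix b')).symm
    rw [← hdx, ← Matrix.det_mul, ← Matrix.det_mul, basisMatrix_eq_mul b b']
    congr 1
    calc B⁻¹ * (basisMatrix b * (b.toMatrix b').map Complex.ofReal)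
        = B⁻¹ * (1 * basisMatrix b) * (b.toMatrix b').map Complex.ofReal := by
          rw [one_mul, Matrix.mul_assoc]
      _ = _ := by rw [← hAA]; simp only [Matrix.mul_assoc]
  rw [key] at hb' hξ
  have hx0 : (x : ℂ) ≠ 0 := right_ne_zero_of_mul hb'
  have he0 : (B⁻¹ * A).det ≠ 0 := left_ne_zero_of_mul (left_ne_zero_of_mul hb')
  rw [hξ, hζ]
  have n1 : (‖(A⁻¹ * basisMatrix b).det‖ : ℂ) ≠ 0 := by simpa using hb
  have n2 : (‖(B⁻¹ * A).det‖ : ℂ) ≠ 0 := by simpa using he0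
  -- The two real bases differ by a real matrix, whose determinant `x` may have either sign.
  -- Squaring removes it, which makes the squared phase independent of the basis.
  have hxx : ((‖(x : ℂ)‖ : ℝ) : ℂ) ^ 2 = (x : ℂ) ^ 2 := by
    rw [Complex.norm_real, ← Complex.ofReal_pow, Real.norm_eq_abs, sq_abs, Complex.ofReal_pow]
  rw [norm_mul, norm_mul, Complex.ofReal_mul, Complex.ofReal_mul, mul_pow, mul_pow, mul_pow,
    mul_pow, hxx]
  field_simp

theorem IsSquaredPhase.unique {n : ℕ} {A : Matrix (Fin n) (Fin n) ℂ}
    {T : Submodule ℝ (Fin n → ℂ)} {ζ ξ : Circle} (hA : IsSquaredPhase A T ζ)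
    (hB : IsSquaredPhase A T ξ) (hAu : IsUnit A) : ξ = ζ := by
  have h := hA.change_frame hB hAu
  rw [Matrix.nonsing_inv_mul _ ((Matrix.isUnit_iff_isUnit_det A).1 hAu)] at h
  exact Circle.coe_injective (by simpa using h)

theorem isUnit_diagonal_of_ne_zero {n : ℕ} {z : Fin n → ℂ} (hz : ∀ j, z j ≠ 0) :
    IsUnit (Matrix.diagonal z) := by
  rw [Matrix.isUnit_iff_isUnit_det, Matrix.det_diagonal, isUnit_iff_ne_zero]
  exact Finset.prod_ne_zero_iff.2 fun j _ => hz j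

/-! ### Classes and degrees of circle maps which lift to the line -/

/-- A circle valued map which lifts to the line has trivial class. -/
theorem circleMapClass_eq_zero {X : Type*} [TopologicalSpace X] (f : C(X, Circle)) (θ : C(X, ℝ))
    (hθ : ∀ x, Circle.exp (θ x) = f x) : circleMapClass f = 0 := by
  have hpi : (2 * Real.pi) ≠ 0 := by positivity
  have hm : ∀ x : X, ∃ m : ℤ, θ x = Complex.arg (f x : ℂ) + m * (2 * Real.pi) := fun x =>
    Circle.exp_eq_exp.1 (by rw [Circle.exp_arg, hθ])
  choose m hm using hm
  rw [circleMapClass, QuotientAddGroup.eq_zero_iff, AddSubgroup.mem_addSubgroupOf]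
  -- The primitive cochain counts the full turns between the lift and the principal argument at a
  -- point. It is not continuous in the point, but a singular cochain need not be.
  refine ⟨fun σ => m (σ (stdSimplex.vertex 0)), ?_⟩
  funext σ
  have h := circleCochain_eq (f.comp σ) (θ.comp σ) (fun x => hθ (σ x))
  simp only [ContinuousMap.comp_apply, hm] at h
  have h' : ((circleCochain (f.comp σ) : ℤ) : ℝ) =
      m (σ (stdSimplex.vertex 1)) - m (σ (stdSimplex.vertex 0)) := by
    apply mul_right_cancel₀ hpi
    rw [h]; ring
  have h'' : circleCochain (f.comp σ) =
      m (σ (stdSimplex.vertex 1)) - m (σ (stdSimplex.vertex 0)) := by exact_mod_cast h'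
  change ∑ i : Fin 2, (-1) ^ (i : ℕ) *
    m ((σ.comp (simplexFace 0 i)) (stdSimplex.vertex 0)) = circleCochain (f.comp σ)
  have hv : ∀ (i : Fin 2),
      simplexFace 0 i (stdSimplex.vertex 0) = stdSimplex.vertex (i.succAbove 0) :=
    fun i => stdSimplex.map_vertex _ _
  have s0 : (0 : Fin 2).succAbove (0 : Fin 1) = 1 := by decide
  have s1 : (1 : Fin 2).succAbove (0 : Fin 1) = 0 := by decide
  rw [Fin.sum_univ_two, h'']
  simp only [ContinuousMap.comp_apply, hv, s0, s1]
  simp [sub_eq_add_neg]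

/-- A self-map of the circle which lifts to the line has degree zero and no other degree. -/
theorem hasCircleDegree_iff_eq_zero {g : C(Circle, Circle)} (H : C(Circle, ℝ))
    (hH : ∀ ζ, Circle.exp (H ζ) = g ζ) {k : ℤ} : HasCircleDegree g k ↔ k = 0 := by
  let η : C(ℝ, ℝ) := ⟨fun t => H (Circle.exp (2 * Real.pi * t)), by fun_prop⟩
  have hη1 : η 1 = η 0 := by
    change H _ = H _
    congr 1
    rw [mul_one, mul_zero, Circle.exp_two_pi, Circle.exp_zero]
  constructor
  · rintro ⟨θ, hθ, hk⟩
    let δ : ℝ := θ 0 - η 0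
    have hδ : Circle.exp δ = 1 := by
      rw [Circle.exp_sub, hθ]
      change _ / Circle.exp (H _) = 1
      rw [hH, div_self']
    -- Two lifts of the same loop differ by a constant. Since `η` factors through the circle, it
    -- closes up, and so does every other lift.
    have heq : (fun t => η t + δ) = θ := by
      refine Circle.isCoveringMap_exp.eq_of_comp_eq (by fun_prop) (by fun_prop) ?_ 0
        (by simp [δ])
      funext t
      simp only [Function.comp_apply]
      rw [Circle.exp_add, hδ, mul_one, hθ]
      exact hH _
    have h0 := congrFun heq 0
    have h1 := congrFun heq 1
    have hpi := Real.pi_pos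
    have : 2 * Real.pi * (k : ℝ) = 0 := by linarith
    have : (k : ℝ) = 0 := by
      rcases mul_eq_zero.1 this with h | h
      · linarith
      · exact h
    exact_mod_cast this
  · rintro rfl
    exact ⟨η, fun t => hH _, by simp [hη1]⟩

/-! ### Graded submanifolds -/

section Graded

variable {n : ℕ} {L : Set ((Fin n → ℂ) × ℝ)}

/-- If the squared phase lifts to the line, the Maslov class is zero. -/
theorem isMaslovClass_iff_eq_zero (hz : ∀ x ∈ L, ∀ j, x.1 j ≠ 0) (θ : C(L, ℝ))
    (hθ : ∀ x : L, IsSquaredPhase (Matrix.diagonal x.1.1) (tangentPlane L x) (Circle.exp (θ x)))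
    (m : SingularH1 L) : IsMaslovClass L m ↔ m = 0 := by
  constructor
  · rintro ⟨Φ, hΦ, rfl⟩
    exact circleMapClass_eq_zero Φ θ fun x =>
      (hΦ x).unique (hθ x) (isUnit_diagonal_of_ne_zero (hz x x.2))
  · rintro rfl
    let Φ : C(L, Circle) := ⟨fun x => Circle.exp (θ x), by fun_prop⟩
    exact ⟨Φ, hθ, (circleMapClass_eq_zero Φ θ fun _ => rfl).symm⟩

/-- If the squared phase lifts to the line, all disks have Maslov index zero. -/
theorem DiskOn.isMaslovIndex_iff_eq_zero (θ : C(L, ℝ))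
    (hθ : ∀ x : L, IsSquaredPhase (Matrix.diagonal x.1.1) (tangentPlane L x) (Circle.exp (θ x)))
    (u : DiskOn L) (k : ℤ) : u.IsMaslovIndex k ↔ k = 0 := by
  have hcd : Continuous circleToDisk := Continuous.subtype_mk (by fun_prop) _
  have hud : ∀ w, IsUnit (Matrix.diagonal (u.toFun w)) := fun w =>
    isUnit_diagonal_of_ne_zero (u.ne_zero w)
  have hub : ∀ ζ, IsSquaredPhase (Matrix.diagonal (u.toFun (circleToDisk ζ)))
      (tangentPlane L (u.boundary ζ)) (Circle.exp (θ (u.boundary ζ))) := fun ζ => by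
    rw [← u.boundary_eq]; exact hθ _
  constructor
  · rintro ⟨Ψ, g, hΨ, hg, hk⟩
    have hball : Convex ℝ (Metric.closedBall (0 : ℂ) 1) := convex_closedBall _ _
    have : ContractibleSpace (Metric.closedBall (0 : ℂ) 1) :=
      hball.contractibleSpace ⟨0, by simp⟩
    have : LocallyPathConnectedSpace (Metric.closedBall (0 : ℂ) 1) :=
      hball.locallyPathConnectedSpace
    -- The determinant of the change from the given trivialization to the global frame is defined on
    -- the whole disk. It has a continuous argument there, so it contributes no winding along the
    -- boundary.
    let e : Metric.closedBall (0 : ℂ) 1 → ℂ := fun w =>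
      ((Ψ w)⁻¹ * Matrix.diagonal (u.toFun w)).det
    have hΨ' : ∀ w, (Ψ w).det ≠ 0 := fun w => ((Matrix.isUnit_iff_isUnit_det _).1 (hΨ w)).ne_zero
    have he : e = fun w => ((Ψ w).det)⁻¹ * (Matrix.diagonal (u.toFun w)).det := by
      funext w
      simp only [e]
      rw [Matrix.det_mul, Matrix.det_nonsing_inv, Ring.inverse_eq_inv']
    have hec : Continuous e := by
      rw [he]
      refine Continuous.mul (Continuous.inv₀ ?_ hΨ') ?_
      · exact Ψ.continuous.matrix_det
      · exact (Continuous.matrix_diagonal u.toFun.continuous).matrix_det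
    have he0 : ∀ w, e w ≠ 0 := fun w => by
      rw [he]
      exact mul_ne_zero (inv_ne_zero (hΨ' w))
        ((Matrix.isUnit_iff_isUnit_det _).1 (hud w)).ne_zero
    obtain ⟨η, hη⟩ := exists_continuous_arg e hec he0
    let H : C(Circle, ℝ) :=
      ⟨fun ζ => θ (u.boundary ζ) + 2 * η (circleToDisk ζ), by fun_prop⟩
    refine (hasCircleDegree_iff_eq_zero H fun ζ => ?_).1 hk
    have h := (hub ζ).change_frame (hg ζ) (hud _)
    have h2 := sq_div_norm_sq_of_eq (he0 (circleToDisk ζ)) (hη _)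
    apply Circle.coe_injective
    rw [h]
    change (Circle.exp (θ (u.boundary ζ) + 2 * η (circleToDisk ζ)) : ℂ) = _
    rw [Circle.exp_add, Circle.coe_mul, ← h2]
  · rintro rfl
    let g : C(Circle, Circle) := ⟨fun ζ => Circle.exp (θ (u.boundary ζ)), by fun_prop⟩
    exact ⟨⟨fun w => Matrix.diagonal (u.toFun w), Continuous.matrix_diagonal u.toFun.continuous⟩, g,
      hud, hub, (hasCircleDegree_iff_eq_zero (θ.comp u.boundary) fun _ => rfl).2 rfl⟩

end Graded

/-! ### Tangent planes of submanifolds given by one equation -/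

section TangentCone

variable {E F : Type*} [NormedAddCommGroup E] [NormedSpace ℝ E] [CompleteSpace E]
  [NormedAddCommGroup F] [NormedSpace ℝ F]

/-- The implicit function parametrizes the zero set near `a` by the kernel of `G'`, and its
derivative at `0` is the inclusion of the kernel. The preimage of `S` is a neighbourhood of `0`, so
its tangent cone is everything and is mapped into that of `S`. -/
theorem ker_subset_tangentConeAt {G : E → ℝ} {G' : E →L[ℝ] ℝ} {a : E}
    (hG : HasStrictFDerivAt G G' a) (hG' : G'.range = ⊤) (ha : G a = 0) {S : Set E}
    (hS : ∀ᶠ y in 𝓝 a, G y = 0 → y ∈ S) : (G'.ker : Set E) ⊆ tangentConeAt ℝ S a := by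
  intro η hη
  let γ := hG.implicitFunction G G' hG' (G a)
  have hγ : HasStrictFDerivAt γ G'.ker.subtypeL 0 := hG.to_implicitFunction hG'
  have hγ0 : γ 0 = a := hG.implicitFunction_apply_image hG'
  have h1 : ∀ᶠ k in 𝓝 (0 : G'.ker), G (γ k) = 0 := by
    have h := hG.map_implicitFunction_eq hG'
    have ht : Filter.Tendsto (fun k : G'.ker => (G a, k)) (𝓝 0) (𝓝 (G a, 0)) := by
      exact (Continuous.prodMk_right _).tendsto _
    filter_upwards [ht.eventually h] with k hk
    exact hk.trans ha
  have h2 : ∀ᶠ k in 𝓝 (0 : G'.ker), γ k ∈ S := by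
    have ht : Filter.Tendsto γ (𝓝 0) (𝓝 a) := by
      have := hγ.continuousAt.tendsto
      rwa [hγ0] at this
    filter_upwards [ht.eventually hS, h1] with k hk hk'
    exact hk hk'
  have h3 := (hγ.hasFDerivAt.hasFDerivWithinAt (s := {k | γ k ∈ S})).mapsTo_tangent_cone
  have h4 : (⟨η, hη⟩ : G'.ker) ∈ tangentConeAt ℝ {k | γ k ∈ S} 0 := by
    rw [tangentConeAt_of_mem_nhds h2]
    trivial
  have h5 := h3 h4
  rw [hγ0] at h5
  exact tangentConeAt_mono (by rintro _ ⟨k, hk, rfl⟩; exact hk) h5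

/-- The tangent cone of a set which is locally the image of the zero set of a submersion `G` under
an embedding with local left inverse `Q`. -/
theorem tangentConeAt_image_zeros {G : E → ℝ} {G' : E →L[ℝ] ℝ} {a : E}
    (hG : HasStrictFDerivAt G G' a) (hG' : G'.range = ⊤) (ha : G a = 0) {e : E → F} {e' : E →L[ℝ] F}
    (he : HasFDerivAt e e' a) {Q : F → E} {Q' : F →L[ℝ] E} (hQ : HasFDerivAt Q Q' (e a))
    (hQe : ∀ x, Q (e x) = x) {L : Set F}
    (hL : ∀ᶠ y in 𝓝 (e a), y ∈ L ↔ e (Q y) = y ∧ G (Q y) = 0) :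
    tangentConeAt ℝ L (e a) = e' '' G'.ker := by
  apply Set.Subset.antisymm
  · intro η hη
    have hmem : ∀ᶠ y in 𝓝[L] (e a), e (Q y) = y ∧ G (Q y) = 0 := by
      filter_upwards [self_mem_nhdsWithin, nhdsWithin_le_nhds hL] with y hy hy'
      exact hy'.1 hy
    have he2 : HasFDerivAt e e' (Q (e a)) := by rwa [hQe]
    have hG2 : HasFDerivAt G G' (Q (e a)) := by rw [hQe]; exact hG.hasFDerivAt
    have h1 : HasFDerivWithinAt (e ∘ Q) (e'.comp Q') L (e a) :=
      (he2.comp (e a) hQ).hasFDerivWithinAt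
    have h1' : HasFDerivWithinAt (e ∘ Q) (ContinuousLinearMap.id ℝ F) L (e a) :=
      (hasFDerivWithinAt_id _ _).congr_of_eventuallyEq
        (hmem.mono fun y hy => hy.1) (by simp [hQe])
    have h2 : HasFDerivWithinAt (G ∘ Q) (G'.comp Q') L (e a) :=
      (hG2.comp (e a) hQ).hasFDerivWithinAt
    have h2' : HasFDerivWithinAt (G ∘ Q) (0 : F →L[ℝ] ℝ) L (e a) :=
      (hasFDerivWithinAt_const (0 : ℝ) _ _).congr_of_eventuallyEq
        (hmem.mono fun y hy => hy.2) (by simp [hQe, ha])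
    -- On `L` the map `e ∘ Q` is the identity and `G ∘ Q` is zero. A derivative within `L` is
    -- determined on the tangent cone of `L`, so on `η` the two pairs of derivatives agree.
    exact ⟨Q' η, h2.unique_on h2' hη, h1.unique_on h1' hη⟩
  · rintro _ ⟨η, hη, rfl⟩
    have hS : ∀ᶠ y in 𝓝 a, G y = 0 → y ∈ e ⁻¹' L := by
      filter_upwards [he.continuousAt.tendsto.eventually hL] with y hy h0
      exact hy.2 (by simp [hQe, h0])
    have h := (he.hasFDerivWithinAt (s := e ⁻¹' L)).mapsTo_tangent_cone
      (ker_subset_tangentConeAt hG hG' ha hS hη)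
    exact tangentConeAt_mono (Set.image_preimage_subset _ _) h

end TangentCone

/-! ### The torus -/

/-- The vector of logarithms of absolute values. -/
noncomputable def logVector {n : ℕ} (z : Fin n → ℂ) : EuclideanSpace ℝ (Fin n) :=
  WithLp.toLp 2 fun j => Real.log ‖z j‖

section Torus

variable {n : ℕ}

theorem torusPoint_ne_zero (q y : EuclideanSpace ℝ (Fin n)) (j : Fin n) :
    torusPoint q y j ≠ 0 := Complex.exp_ne_zero _

@[simp]
theorem logVector_torusPoint (q y : EuclideanSpace ℝ (Fin n)) :
    logVector (torusPoint q y) = q := by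
  ext j
  simp [logVector, torusPoint, Complex.norm_exp]

theorem torusPoint_add_latticeVector (q y : EuclideanSpace ℝ (Fin n)) (v : Fin n → ℤ) :
    torusPoint q (y + latticeVector v) = torusPoint q y := by
  funext j
  simp only [torusPoint, latticeVector, PiLp.add_apply]
  rw [Complex.exp_eq_exp_iff_exists_int]
  exact ⟨v j, by push_cast; ring⟩

theorem differentiableAt_logVector {z : Fin n → ℂ} (hz : ∀ j, z j ≠ 0) :
    DifferentiableAt ℝ logVector z := by
  refine (PiLp.continuousLinearEquiv 2 ℝ fun _ : Fin n => ℝ).symm.differentiableAt.comp z ?_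
  rw [differentiableAt_pi]
  intro j
  refine DifferentiableAt.log ?_ (by simpa using hz j)
  exact DifferentiableAt.norm ℝ (by fun_prop) (hz j)

theorem continuousAt_logVector {z : Fin n → ℂ} (hz : ∀ j, z j ≠ 0) :
    ContinuousAt logVector z := (differentiableAt_logVector hz).continuousAt

theorem continuous_torusPoint :
    Continuous fun x : EuclideanSpace ℝ (Fin n) × EuclideanSpace ℝ (Fin n) =>
      torusPoint x.1 x.2 := by
  unfold torusPoint
  fun_prop

theorem hasFDerivAt_torusPoint {X : Type*} [NormedAddCommGroup X] [NormedSpace ℝ X]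
    {Q Y : X → EuclideanSpace ℝ (Fin n)} {Q' Y' : X →L[ℝ] EuclideanSpace ℝ (Fin n)} {a : X}
    (hQ : HasFDerivAt Q Q' a) (hY : HasFDerivAt Y Y' a) :
    ∃ D : X →L[ℝ] (Fin n → ℂ), HasFDerivAt (fun x => torusPoint (Q x) (Y x)) D a ∧
      ∀ x j, D x j = torusPoint (Q a) (Y a) j *
        ((Q' x j : ℂ) + 2 * Real.pi * Complex.I * (Y' x j : ℂ)) := by
  let c : Fin n → (EuclideanSpace ℝ (Fin n) →L[ℝ] ℂ) := fun j =>
    Complex.ofRealCLM.comp (EuclideanSpace.proj j)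
  let D : X →L[ℝ] (Fin n → ℂ) := ContinuousLinearMap.pi fun j =>
    torusPoint (Q a) (Y a) j • ((c j).comp Q' + (2 * Real.pi * Complex.I) • (c j).comp Y')
  refine ⟨D, ?_, fun x j => by simp [D, c, mul_add]⟩
  rw [hasFDerivAt_pi]
  intro j
  have h1 : HasFDerivAt (fun x => ((Q x j : ℝ) : ℂ)) ((c j).comp Q') a :=
    (c j).hasFDerivAt.comp a hQ
  have h2 : HasFDerivAt (fun x => ((Y x j : ℝ) : ℂ)) ((c j).comp Y') a :=
    (c j).hasFDerivAt.comp a hY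
  exact (h1.add (h2.const_mul (2 * Real.pi * Complex.I))).cexp

/-- The tangent planes of a subset of `(ℂˣ)ⁿ × ℝ` which is locally given by a covector valued
function `Y` on the zero set of a submersion `G` on `ℝⁿ × ℝ`. -/
theorem mem_tangentPlane_iff {G : EuclideanSpace ℝ (Fin n) × ℝ → ℝ}
    {G' : EuclideanSpace ℝ (Fin n) × ℝ →L[ℝ] ℝ} {q : EuclideanSpace ℝ (Fin n)} {p : ℝ}
    (hG : HasStrictFDerivAt G G' (q, p)) (hG' : G' ≠ 0) (hqp : G (q, p) = 0)
    {Y : EuclideanSpace ℝ (Fin n) × ℝ → EuclideanSpace ℝ (Fin n)}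
    {Y' : EuclideanSpace ℝ (Fin n) × ℝ →L[ℝ] EuclideanSpace ℝ (Fin n)}
    (hY : HasFDerivAt Y Y' (q, p)) {L : Set ((Fin n → ℂ) × ℝ)}
    (hL : ∀ᶠ x in 𝓝 (torusPoint q (Y (q, p)), p),
      x ∈ L ↔ x.1 = torusPoint (logVector x.1) (Y (logVector x.1, x.2)) ∧
        G (logVector x.1, x.2) = 0) (η : Fin n → ℂ) :
    η ∈ tangentPlane L (torusPoint q (Y (q, p)), p) ↔
      ∃ (ξ : EuclideanSpace ℝ (Fin n)) (τ : ℝ), G' (ξ, τ) = 0 ∧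
        η = fun j => torusPoint q (Y (q, p)) j *
          ((ξ j : ℂ) + 2 * Real.pi * Complex.I * (Y' (ξ, τ) j : ℂ)) := by
  obtain ⟨D, hD, hD'⟩ := hasFDerivAt_torusPoint (hasFDerivAt_fst (𝕜 := ℝ) (p := (q, p))) hY
  have hrange : G'.range = ⊤ := by
    refine LinearMap.range_eq_top.2 (LinearMap.surjective (f := G'.toLinearMap) fun h => hG' ?_)
    exact ContinuousLinearMap.coe_injective h
  let e : EuclideanSpace ℝ (Fin n) × ℝ → (Fin n → ℂ) × ℝ := fun x => (torusPoint x.1 (Y x), x.2)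
  have he : HasFDerivAt e (D.prod (ContinuousLinearMap.snd ℝ _ ℝ)) (q, p) :=
    hD.prodMk hasFDerivAt_snd
  let Q : (Fin n → ℂ) × ℝ → EuclideanSpace ℝ (Fin n) × ℝ := fun x => (logVector x.1, x.2)
  have hQ : DifferentiableAt ℝ Q (e (q, p)) := by
    refine DifferentiableAt.prodMk (DifferentiableAt.comp (g := logVector) _ ?_ differentiableAt_fst)
      differentiableAt_snd
    exact differentiableAt_logVector (torusPoint_ne_zero _ _)
  have hcone := tangentConeAt_image_zeros hG hrange hqp he hQ.hasFDerivAt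
    (fun x => by simp [Q, e]) (L := L) (by
      filter_upwards [hL] with x hx
      rw [hx]
      refine and_congr_left' ?_
      simp only [e, Q, Prod.ext_iff]
      exact ⟨fun h => ⟨h.symm, trivial⟩, fun h => h.1.symm⟩)
  rw [tangentPlane, show (torusPoint q (Y (q, p)), p) = e (q, p) from rfl, hcone,
    Submodule.mem_map]
  -- The tangent cone is already a linear subspace, so taking the span adds nothing.
  have hspan : Submodule.span ℝ ((D.prod (ContinuousLinearMap.snd ℝ _ ℝ)) '' (G'.ker : Set _)) =
      G'.ker.map ((D.prod (ContinuousLinearMap.snd ℝ _ ℝ)) :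
        EuclideanSpace ℝ (Fin n) × ℝ →ₗ[ℝ] (Fin n → ℂ) × ℝ) := by
    rw [← Submodule.span_eq (G'.ker.map _), Submodule.map_coe]
    rfl
  rw [hspan]
  constructor
  · rintro ⟨_, ⟨⟨ξ, τ⟩, hk, rfl⟩, rfl⟩
    exact ⟨ξ, τ, hk, by funext j; exact hD' (ξ, τ) j⟩
  · rintro ⟨ξ, τ, hk, rfl⟩
    exact ⟨_, ⟨(ξ, τ), hk, rfl⟩, by funext j; exact hD' (ξ, τ) j⟩

end Torus

/-! ### Planes of the torus given by matrices -/

section Planes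

variable {n : ℕ}

/-- The linear map which sends a real vector `x` to `N x`, seen as a tangent vector of `(ℂˣ)ⁿ` at
`z` through the frame `z_j ∂/∂z_j`. -/
noncomputable def torusPlaneMap (z : Fin n → ℂ) (N : Matrix (Fin n) (Fin n) ℂ) :
    (Fin n → ℝ) →ₗ[ℝ] (Fin n → ℂ) where
  toFun x := fun j => z j * (N.mulVec fun i => (x i : ℂ)) j
  map_add' x y := by
    funext j
    have : (fun i => ((x + y) i : ℂ)) = (fun i => (x i : ℂ)) + fun i => (y i : ℂ) := by
      funext i; simp
    rw [this, Matrix.mulVec_add]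
    simp [mul_add]
  map_smul' a x := by
    funext j
    have : (fun i => ((a • x) i : ℂ)) = (a : ℂ) • fun i => (x i : ℂ) := by
      funext i; simp
    rw [this, Matrix.mulVec_smul]
    simp
    ring

theorem torusPlaneMap_injective {z : Fin n → ℂ} (hz : ∀ j, z j ≠ 0)
    {N : Matrix (Fin n) (Fin n) ℂ} (hN : N.det ≠ 0) : Function.Injective (torusPlaneMap z N) := by
  rw [← LinearMap.ker_eq_bot, LinearMap.ker_eq_bot']
  intro x hx
  have h1 : N.mulVec (fun i => (x i : ℂ)) = 0 := by
    funext j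
    exact (mul_eq_zero.1 (congrFun hx j)).resolve_left (hz j)
  have h2 := Matrix.eq_zero_of_mulVec_eq_zero hN h1
  funext i
  simpa using congrFun h2 i

theorem isSquaredPhase_range_torusPlaneMap {z : Fin n → ℂ} (hz : ∀ j, z j ≠ 0)
    {N : Matrix (Fin n) (Fin n) ℂ} (hN : N.det ≠ 0) {θ : ℝ}
    (hθ : N.det = ‖N.det‖ * (Circle.exp θ : ℂ)) :
    IsSquaredPhase (Matrix.diagonal z) (LinearMap.range (torusPlaneMap z N))
      (Circle.exp (2 * θ)) := by
  let b := (Pi.basisFun ℝ (Fin n)).map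
    (LinearEquiv.ofInjective (torusPlaneMap z N) (torusPlaneMap_injective hz hN))
  have hb : Matrix.of (fun i j => (b j : Fin n → ℂ) i) = Matrix.diagonal z * N := by
    ext i j
    rw [Matrix.diagonal_mul]
    change z i * (N.mulVec fun k => ((Pi.basisFun ℝ (Fin n) j k : ℝ) : ℂ)) i = z i * N i j
    congr 1
    have : (fun k => ((Pi.basisFun ℝ (Fin n) j k : ℝ) : ℂ)) = Pi.single j 1 := by
      funext k
      by_cases h : k = j
      · subst h; simp
      · simp [h]
    rw [this]
    simp
  have hinv : (Matrix.diagonal z)⁻¹ * Matrix.of (fun i j => (b j : Fin n → ℂ) i) = N := by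
    rw [hb, ← Matrix.mul_assoc, Matrix.nonsing_inv_mul _
      ((Matrix.isUnit_iff_isUnit_det _).1 (isUnit_diagonal_of_ne_zero hz)), Matrix.one_mul]
  refine ⟨b, ?_, ?_⟩
  · rwa [hinv]
  · rw [hinv, sq_div_norm_sq_of_eq hN hθ]

/-- With `N = X + iY`, the symplectic form of `Nx` and `Ny` is `xᵀ(XᵀY - YᵀX)y / 2π`, which vanishes
when `XᵀY` is symmetric. The determinant condition gives dimension `n`. -/
theorem isLagrangianPlane_range_torusPlaneMap {z : Fin n → ℂ} (hz : ∀ j, z j ≠ 0)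
    {X Y : Matrix (Fin n) (Fin n) ℝ} (hXY : (X.transpose * Y).IsSymm)
    (hN : (X.map Complex.ofReal + Complex.I • Y.map Complex.ofReal).det ≠ 0) :
    IsLagrangianPlane z (LinearMap.range
      (torusPlaneMap z (X.map Complex.ofReal + Complex.I • Y.map Complex.ofReal))) := by
  refine ⟨by rw [LinearMap.finrank_range_of_inj (torusPlaneMap_injective hz hN)]; simp, ?_⟩
  rintro _ ⟨x, rfl⟩ _ ⟨y, rfl⟩
  have hval : ∀ (x : Fin n → ℝ) (j : Fin n),
      torusPlaneMap z (X.map Complex.ofReal + Complex.I • Y.map Complex.ofReal) x j / z j =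
        (X.mulVec x j : ℂ) + Complex.I * (Y.mulVec x j : ℂ) := by
    intro x j
    change z j * _ / z j = _
    rw [mul_div_cancel_left₀ _ (hz j), Matrix.add_mulVec, Matrix.smul_mulVec]
    simp [Matrix.mulVec, dotProduct]
  simp only [torusSymplecticForm, hval]
  have hs : dotProduct (X.mulVec x) (Y.mulVec y) = dotProduct (Y.mulVec x) (X.mulVec y) := by
    have h1 : dotProduct (X.mulVec x) (Y.mulVec y) =
        dotProduct x ((X.transpose * Y).mulVec y) := by
      rw [← Matrix.mulVec_mulVec, Matrix.dotProduct_mulVec x, Matrix.vecMul_transpose]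
    have h2 : dotProduct (Y.mulVec x) (X.mulVec y) =
        dotProduct x ((X.transpose * Y).mulVec y) := by
      rw [← hXY.eq, Matrix.transpose_mul, Matrix.transpose_transpose, ← Matrix.mulVec_mulVec,
        Matrix.dotProduct_mulVec x, Matrix.vecMul_transpose]
    rw [h1, h2]
  have : ∀ j, ((X.mulVec x j : ℂ) + Complex.I * (Y.mulVec x j : ℂ)).re *
        (((X.mulVec y j : ℂ) + Complex.I * (Y.mulVec y j : ℂ)).im / (2 * Real.pi)) -
      ((X.mulVec x j : ℂ) + Complex.I * (Y.mulVec x j : ℂ)).im / (2 * Real.pi) *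
        ((X.mulVec y j : ℂ) + Complex.I * (Y.mulVec y j : ℂ)).re =
      (X.mulVec x j * Y.mulVec y j - Y.mulVec x j * X.mulVec y j) / (2 * Real.pi) := by
    intro j
    simp
    ring
  simp only [this]
  rw [← Finset.sum_div, Finset.sum_sub_distrib]
  simp only [dotProduct] at hs
  rw [hs, sub_self, zero_div]

end Planes

/-! ### The determinant of `1 + iA` for a real symmetric matrix `A` and its rank one modifications -/

section Determinants

variable {n : ℕ}

/-- The complex matrix `1 + iA`. -/
noncomputable def onePlusI (A : Matrix (Fin n) (Fin n) ℝ) : Matrix (Fin n) (Fin n) ℂ :=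
  1 + Complex.I • A.map Complex.ofReal

/-- The complex number `wᵀ (1 + iA)⁻¹ w`. -/
noncomputable def resolventForm (A : Matrix (Fin n) (Fin n) ℝ) (w : Fin n → ℝ) : ℂ :=
  dotProduct (fun i => (w i : ℂ)) ((onePlusI A)⁻¹.mulVec fun i => (w i : ℂ))

/-- The number `u* A u` is real since `A` is Hermitian, so `i u* A u` contributes nothing to the
real part. In particular `1 + iA` has no kernel. -/
theorem re_dotProduct_onePlusI {A : Matrix (Fin n) (Fin n) ℝ} (hA : A.IsSymm) (u : Fin n → ℂ) :
    (dotProduct (star u) ((onePlusI A).mulVec u)).re = ∑ i, ‖u i‖ ^ 2 := by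
  have hH : (A.map Complex.ofReal).IsHermitian := by
    ext i j
    simp [hA.apply i j]
  have h1 := hH.im_star_dotProduct_mulVec_self u
  rw [onePlusI, Matrix.add_mulVec, Matrix.one_mulVec, Matrix.smul_mulVec, dotProduct_add,
    dotProduct_smul, Complex.add_re, smul_eq_mul, Complex.I_mul_re]
  have h2 : (dotProduct (star u) ((A.map Complex.ofReal).mulVec u)).im = 0 := h1
  rw [h2, dotProduct, Complex.re_sum]
  simp only [neg_zero, add_zero]
  refine Finset.sum_congr rfl fun i _ => ?_
  rw [Pi.star_apply, Complex.star_def, Complex.conj_mul', ← Complex.ofReal_pow, Complex.ofReal_re]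

theorem det_onePlusI_ne_zero {A : Matrix (Fin n) (Fin n) ℝ} (hA : A.IsSymm) :
    (onePlusI A).det ≠ 0 := by
  intro h
  obtain ⟨u, hu, hu0⟩ := Matrix.exists_mulVec_eq_zero_iff.2 h
  have h1 := re_dotProduct_onePlusI hA u
  rw [hu0, dotProduct_zero, Complex.zero_re] at h1
  apply hu
  funext i
  have h2 := (Finset.sum_eq_zero_iff_of_nonneg fun i _ => by positivity).1 h1.symm i
    (Finset.mem_univ i)
  simpa using h2

/-- Put `w = (1 + iA)u`. As `w` is real, `wᵀu` is the complex conjugate of `u* (1 + iA) u`, whose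
real part is `|u|²`. This positivity is what confines the phase to a half plane. -/
theorem resolventForm_re {A : Matrix (Fin n) (Fin n) ℝ} (hA : A.IsSymm) (w : Fin n → ℝ) :
    (resolventForm A w).re = ∑ i, ‖((onePlusI A)⁻¹.mulVec fun i => (w i : ℂ)) i‖ ^ 2 := by
  set u := (onePlusI A)⁻¹.mulVec fun i => (w i : ℂ) with hu
  have hM : (onePlusI A).mulVec u = fun i => (w i : ℂ) := by
    rw [hu, Matrix.mulVec_mulVec, Matrix.mul_nonsing_inv _ (det_onePlusI_ne_zero hA).isUnit,
      Matrix.one_mulVec]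
  rw [← re_dotProduct_onePlusI hA u, hM, resolventForm, ← hu]
  simp only [dotProduct, Complex.re_sum]
  refine Finset.sum_congr rfl fun i _ => ?_
  simp [mul_comm]

theorem resolventForm_re_nonneg {A : Matrix (Fin n) (Fin n) ℝ} (hA : A.IsSymm) (w : Fin n → ℝ) :
    0 ≤ (resolventForm A w).re := by
  rw [resolventForm_re hA]
  exact Finset.sum_nonneg fun i _ => by positivity

theorem resolventForm_zero (A : Matrix (Fin n) (Fin n) ℝ) :
    resolventForm A 0 = 0 := by
  simp [resolventForm, dotProduct]

theorem resolventForm_re_pos {A : Matrix (Fin n) (Fin n) ℝ} (hA : A.IsSymm) {w : Fin n → ℝ}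
    (hw : w ≠ 0) : 0 < (resolventForm A w).re := by
  refine lt_of_le_of_ne (resolventForm_re_nonneg hA w) fun h => hw ?_
  rw [resolventForm_re hA] at h
  have h2 := (Finset.sum_eq_zero_iff_of_nonneg fun i _ => by positivity).1 h.symm
  have h3 : ((onePlusI A)⁻¹.mulVec fun i => (w i : ℂ)) = 0 := by
    funext i
    simpa using h2 i (Finset.mem_univ i)
  have hM : (onePlusI A).mulVec ((onePlusI A)⁻¹.mulVec fun i => (w i : ℂ)) =
      fun i => (w i : ℂ) := by
    rw [Matrix.mulVec_mulVec, Matrix.mul_nonsing_inv _ (det_onePlusI_ne_zero hA).isUnit,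
      Matrix.one_mulVec]
  rw [h3, Matrix.mulVec_zero] at hM
  funext i
  simpa using (congrFun hM i).symm

theorem continuous_onePlusI : Continuous (onePlusI (n := n)) := by
  refine continuous_matrix fun i j => ?_
  simp only [onePlusI, Matrix.add_apply, Matrix.smul_apply, Matrix.map_apply, smul_eq_mul]
  fun_prop

theorem Continuous.resolventForm {X : Type*} [TopologicalSpace X]
    {A : X → Matrix (Fin n) (Fin n) ℝ} {w : X → Fin n → ℝ} (hA : Continuous A)
    (hw : Continuous w) (hs : ∀ x, (A x).IsSymm) :
    Continuous fun x => resolventForm (A x) (w x) := by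
  have hc : Continuous fun x => onePlusI (A x) := continuous_onePlusI.comp hA
  have hinv : Continuous fun x => (onePlusI (A x))⁻¹ := by
    have heq : (fun x => (onePlusI (A x))⁻¹) =
        fun x => ((onePlusI (A x)).det)⁻¹ • (onePlusI (A x)).adjugate := by
      funext x
      rw [Matrix.inv_def, Ring.inverse_eq_inv']
    rw [heq]
    exact (hc.matrix_det.inv₀ fun x => det_onePlusI_ne_zero (hs x)).smul hc.matrix_adjugate
  have hW : Continuous fun x => fun i => ((w x i : ℝ) : ℂ) := by fun_prop
  exact Continuous.dotProduct hW (hinv.matrix_mulVec hW)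

/-- The matrix determinant lemma, from the factorization `M + u wᵀ = M (1 + (M⁻¹u) wᵀ)`. -/
theorem det_add_vecMulVec {M : Matrix (Fin n) (Fin n) ℂ} (hM : M.det ≠ 0) (u w : Fin n → ℂ) :
    (M + Matrix.vecMulVec u w).det = M.det * (1 + dotProduct w (M⁻¹.mulVec u)) := by
  have h := Matrix.det_one_add_replicateCol_mul_replicateRow (ι := Unit) (M⁻¹.mulVec u) w
  have h2 : M + Matrix.vecMulVec u w = M * (1 + Matrix.vecMulVec (M⁻¹.mulVec u) w) := by
    rw [Matrix.mul_add, Matrix.mul_one, Matrix.mul_vecMulVec, Matrix.mulVec_mulVec,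
      Matrix.mul_nonsing_inv _ hM.isUnit, Matrix.one_mulVec]
  rw [h2, Matrix.det_mul, Matrix.vecMulVec_eq Unit, h]

theorem det_onePlusI_add_rank_one {A : Matrix (Fin n) (Fin n) ℝ} (hA : A.IsSymm) (w : Fin n → ℝ)
    (β : ℝ) : (onePlusI (A + β • Matrix.vecMulVec w w)).det =
      (onePlusI A).det * (1 + Complex.I * (β * resolventForm A w)) := by
  have h : onePlusI (A + β • Matrix.vecMulVec w w) =
      onePlusI A + Matrix.vecMulVec ((Complex.I * β) • fun i => (w i : ℂ)) fun i => (w i : ℂ) := by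
    ext i j
    simp [onePlusI, Matrix.vecMulVec_apply]
    ring
  rw [h, det_add_vecMulVec (det_onePlusI_ne_zero hA), Matrix.mulVec_smul, dotProduct_smul,
    resolventForm, smul_eq_mul, mul_assoc]

/-- The real part of the frame of a Lagrangian plane which is vertical in the direction of `w`. -/
noncomputable def neckReal (w : Fin n → ℝ) : Matrix (Fin n) (Fin n) ℝ :=
  1 - (dotProduct w w)⁻¹ • Matrix.vecMulVec w w

/-- The imaginary part of the frame of a Lagrangian plane which is vertical in the direction of
`w`. -/
noncomputable def neckImag (A : Matrix (Fin n) (Fin n) ℝ) (w : Fin n → ℝ) :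
    Matrix (Fin n) (Fin n) ℝ :=
  A * neckReal w + (2 * Real.pi) • Matrix.vecMulVec w w

/-- The matrix is the orthogonal projection along `w`: at the middle of a neck the tangent plane
moves the base point only orthogonally to `w`. -/
theorem neckReal_mulVec_self {w : Fin n → ℝ} (hw : w ≠ 0) : (neckReal w).mulVec w = 0 := by
  have hww : dotProduct w w ≠ 0 := by simpa using hw
  rw [neckReal, Matrix.sub_mulVec, Matrix.one_mulVec, Matrix.smul_mulVec, Matrix.vecMulVec_mulVec]
  funext i
  simp
  field_simp
  ring

theorem neckReal_isSymm (w : Fin n → ℝ) : (neckReal w).IsSymm := by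
  rw [Matrix.IsSymm, neckReal, Matrix.transpose_sub, Matrix.transpose_one, Matrix.transpose_smul,
    Matrix.transpose_vecMulVec]

theorem neck_isSymm {A : Matrix (Fin n) (Fin n) ℝ} (hA : A.IsSymm) {w : Fin n → ℝ} (hw : w ≠ 0) :
    ((neckReal w).transpose * neckImag A w).IsSymm := by
  rw [(neckReal_isSymm w).eq, neckImag, Matrix.mul_add, Matrix.mul_smul, Matrix.mul_vecMulVec,
    neckReal_mulVec_self hw, Matrix.zero_vecMulVec, smul_zero, add_zero, Matrix.IsSymm,
    Matrix.transpose_mul, Matrix.transpose_mul, (neckReal_isSymm w).eq, hA.eq, Matrix.mul_assoc]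

/-- The frame is `(1 + iA)(1 - w wᵀ/|w|²) + 2πi w wᵀ`, again a rank one modification of `1 + iA`. In
the determinant lemma the projection contributes `-1`, which cancels the leading `1` and leaves only
the term with `ζ`. -/
theorem det_neck {A : Matrix (Fin n) (Fin n) ℝ} (hA : A.IsSymm) {w : Fin n → ℝ} (hw : w ≠ 0) :
    ((neckReal w).map Complex.ofReal + Complex.I • (neckImag A w).map Complex.ofReal).det =
      (onePlusI A).det * (Complex.I * (2 * Real.pi * resolventForm A w)) := by
  have hww : dotProduct w w ≠ 0 := by simpa using hw
  set M := onePlusI A with hM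
  have hMd : M.det ≠ 0 := det_onePlusI_ne_zero hA
  set W : Fin n → ℂ := fun i => (w i : ℂ) with hW
  have hWW : dotProduct W W = ((dotProduct w w : ℝ) : ℂ) := by simp [dotProduct, hW]
  have h : (neckReal w).map Complex.ofReal + Complex.I • (neckImag A w).map Complex.ofReal =
      M + Matrix.vecMulVec ((-((dotProduct w w : ℝ) : ℂ)⁻¹) • M.mulVec W +
        (Complex.I * (2 * Real.pi)) • W) W := by
    have hX : (neckReal w).map Complex.ofReal =
        1 + (-((dotProduct w w : ℝ) : ℂ)⁻¹) • Matrix.vecMulVec W W := by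
      ext i j
      simp [neckReal, Matrix.vecMulVec_apply, Matrix.one_apply, hW]
      split_ifs <;> simp [sub_eq_add_neg]
    have hY : (neckImag A w).map Complex.ofReal = A.map Complex.ofReal *
        (neckReal w).map Complex.ofReal + ((2 * Real.pi : ℝ) : ℂ) • Matrix.vecMulVec W W := by
      ext i j
      simp [neckImag, Matrix.mul_apply, Matrix.vecMulVec_apply, hW]
    have : (neckReal w).map Complex.ofReal + Complex.I • (neckImag A w).map Complex.ofReal =
        M * (neckReal w).map Complex.ofReal +
          (Complex.I * (2 * Real.pi)) • Matrix.vecMulVec W W := by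
      rw [hY, hM, onePlusI, Matrix.add_mul, Matrix.one_mul, smul_add, Matrix.smul_mul, smul_smul]
      push_cast
      rw [add_assoc]
    rw [this, hX, Matrix.mul_add, Matrix.mul_one, Matrix.mul_smul, Matrix.mul_vecMulVec,
      Matrix.add_vecMulVec, Matrix.smul_vecMulVec, Matrix.smul_vecMulVec, add_assoc]
  rw [h, det_add_vecMulVec hMd, Matrix.mulVec_add, Matrix.mulVec_smul, Matrix.mulVec_smul,
    Matrix.mulVec_mulVec, Matrix.nonsing_inv_mul _ hMd.isUnit, Matrix.one_mulVec, dotProduct_add,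
    dotProduct_smul, dotProduct_smul, hWW, smul_eq_mul, smul_eq_mul]
  have hc : ((dotProduct w w : ℝ) : ℂ) ≠ 0 := by exact_mod_cast hww
  congr 1
  rw [neg_mul, inv_mul_cancel₀ hc, resolventForm, ← hM, ← hW]
  ring

/-- A continuous argument of `det (1 + iA)` exists on the space of real symmetric matrices. -/
theorem exists_continuous_arg_det (n : ℕ) :
    ∃ Θ : C({A : Matrix (Fin n) (Fin n) ℝ // A.IsSymm}, ℝ),
      ∀ A, (onePlusI A.1).det = ‖(onePlusI A.1).det‖ * (Circle.exp (Θ A) : ℂ) := by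
  -- Convexity makes the space of symmetric matrices contractible, so the nowhere vanishing
  -- determinant has a global argument on it.
  have hconv : Convex ℝ {A : Fin n → Fin n → ℝ | Matrix.IsSymm A} := by
    intro A hA B hB a b _ _ _
    have hA' : Matrix.IsSymm A := hA
    have hB' : Matrix.IsSymm B := hB
    exact (hA'.smul a).add (hB'.smul b)
  have h1 : ContractibleSpace {A : Fin n → Fin n → ℝ | Matrix.IsSymm A} :=
    hconv.contractibleSpace ⟨0, Matrix.isSymm_zero⟩
  have h2 : LocallyPathConnectedSpace {A : Fin n → Fin n → ℝ | Matrix.IsSymm A} :=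
    hconv.locallyPathConnectedSpace
  have h3 : ContractibleSpace {A : Matrix (Fin n) (Fin n) ℝ // A.IsSymm} := h1
  have h4 : LocallyPathConnectedSpace {A : Matrix (Fin n) (Fin n) ℝ // A.IsSymm} := h2
  exact exists_continuous_arg (fun A : {A : Matrix (Fin n) (Fin n) ℝ // A.IsSymm} =>
    (onePlusI A.1).det) ((continuous_onePlusI.comp continuous_subtype_val).matrix_det)
    fun A => det_onePlusI_ne_zero A.2

end Determinants

/-! ### Hessian matrices -/

section Hessian

variable {n : ℕ}

/-- The matrix of second derivatives of a function on `ℝⁿ`. -/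
noncomputable def hessianMatrix (f : EuclideanSpace ℝ (Fin n) → ℝ)
    (q : EuclideanSpace ℝ (Fin n)) : Matrix (Fin n) (Fin n) ℝ :=
  Matrix.of fun i j => fderiv ℝ (gradient f) q (EuclideanSpace.single j 1) i

theorem ContDiff.gradient_one {f : EuclideanSpace ℝ (Fin n) → ℝ} (hf : ContDiff ℝ 2 f) :
    ContDiff ℝ 1 (gradient f) := by
  have h : ContDiff ℝ 1 (fderiv ℝ f) := hf.fderiv_right (by norm_num)
  exact (InnerProductSpace.toDual ℝ (EuclideanSpace ℝ (Fin n))).symm.toContinuousLinearEquiv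
    |>.contDiff.comp h

theorem hessianMatrix_mulVec {f : EuclideanSpace ℝ (Fin n) → ℝ} (q ξ : EuclideanSpace ℝ (Fin n))
    (i : Fin n) :
    (hessianMatrix f q).mulVec ξ.ofLp i = fderiv ℝ (gradient f) q ξ i := by
  have hξ : ξ = ∑ j, ξ j • EuclideanSpace.single j (1 : ℝ) := by
    ext k
    simp [Finset.sum_apply, Pi.single_apply]
  conv_rhs => rw [hξ]
  simp only [map_sum, map_smul, WithLp.ofLp_sum, Finset.sum_apply, Matrix.mulVec, dotProduct,
    hessianMatrix, Matrix.of_apply, WithLp.ofLp_smul, Pi.smul_apply, smul_eq_mul]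
  exact Finset.sum_congr rfl fun j _ => mul_comm _ _

theorem hessianMatrix_isSymm {f : EuclideanSpace ℝ (Fin n) → ℝ} (hf : ContDiff ℝ 2 f)
    (q : EuclideanSpace ℝ (Fin n)) : (hessianMatrix f q).IsSymm := by
  have hs : IsSymmSndFDerivAt ℝ f q :=
    hf.contDiffAt.isSymmSndFDerivAt (by simp [minSmoothness_of_isRCLikeNormedField])
  have hd : DifferentiableAt ℝ (gradient f) q := hf.gradient_one.differentiable (by simp) q
  have key : ∀ ξ η : EuclideanSpace ℝ (Fin n),
      fderiv ℝ (fderiv ℝ f) q ξ η = inner ℝ (fderiv ℝ (gradient f) q ξ) η := by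
    intro ξ η
    have h1 : fderiv ℝ f =
        (InnerProductSpace.toDual ℝ (EuclideanSpace ℝ (Fin n))) ∘ gradient f :=
      toDual_comp_gradient.symm
    have h2 := ((InnerProductSpace.toDual ℝ (EuclideanSpace ℝ (Fin n))).toContinuousLinearEquiv
      |>.hasFDerivAt.comp q hd.hasFDerivAt).fderiv
    rw [h1]
    erw [h2]
    rfl
  ext i j
  have h := hs (EuclideanSpace.single i 1) (EuclideanSpace.single j 1)
  rw [key, key, EuclideanSpace.inner_single_right, EuclideanSpace.inner_single_right] at h
  simpa [hessianMatrix] using h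

theorem continuous_hessianMatrix {f : EuclideanSpace ℝ (Fin n) → ℝ} (hf : ContDiff ℝ 2 f) :
    Continuous (hessianMatrix f) := by
  have h : Continuous (fderiv ℝ (gradient f)) := hf.gradient_one.continuous_fderiv (by simp)
  refine continuous_matrix fun i j => ?_
  simp only [hessianMatrix, Matrix.of_apply]
  fun_prop

end Hessian

/-! ### The smoothing of a tropical polynomial -/

namespace TropicalPolynomial

variable {n : ℕ} (φ : TropicalPolynomial n)

theorem vertices_finite : φ.vertices.Finite :=
  φ.support.finite_toSet.subset fun _ hv => hv.1

theorem monomial_eq_inner (v : Fin n → ℤ) (q : EuclideanSpace ℝ (Fin n)) :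
    φ.monomial v q = φ.coeff v + inner ℝ (latticeVector v) q := by
  simp [monomial, latticeVector, PiLp.inner_apply, mul_comm]

theorem continuous_monomial (v : Fin n → ℤ) : Continuous (φ.monomial v) := by
  unfold monomial
  fun_prop

theorem continuous_eval : Continuous φ.eval :=
  Continuous.finset_inf'_apply φ.nonempty fun v _ => φ.continuous_monomial v

/-- The difference between a monomial and the tropical polynomial. -/
noncomputable def gap (v : Fin n → ℤ) (q : EuclideanSpace ℝ (Fin n)) : ℝ :=
  φ.monomial v q - φ.eval q

theorem continuous_gap (v : Fin n → ℤ) : Continuous (φ.gap v) :=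
  (φ.continuous_monomial v).sub φ.continuous_eval

theorem gap_nonneg {v : Fin n → ℤ} (hv : v ∈ φ.support) (q : EuclideanSpace ℝ (Fin n)) :
    0 ≤ φ.gap v q :=
  sub_nonneg.2 (Finset.inf'_le _ hv)

theorem monomial_combo (v : Fin n → ℤ) (x y : EuclideanSpace ℝ (Fin n)) {a b : ℝ}
    (hab : a + b = 1) :
    φ.monomial v (a • x + b • y) = a * φ.monomial v x + b * φ.monomial v y := by
  simp only [monomial_eq_inner, inner_add_right, inner_smul_right]
  linear_combination (-φ.coeff v) * hab

theorem eval_combo_ge (x y : EuclideanSpace ℝ (Fin n)) {a b : ℝ} (ha : 0 ≤ a) (hb : 0 ≤ b)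
    (hab : a + b = 1) : a * φ.eval x + b * φ.eval y ≤ φ.eval (a • x + b • y) := by
  refine Finset.le_inf' _ _ fun v hv => ?_
  rw [φ.monomial_combo v x y hab]
  exact add_le_add (mul_le_mul_of_nonneg_left (Finset.inf'_le _ hv) ha)
    (mul_le_mul_of_nonneg_left (Finset.inf'_le _ hv) hb)

theorem gap_combo_le (v : Fin n → ℤ) (x y : EuclideanSpace ℝ (Fin n)) {a b : ℝ} (ha : 0 ≤ a)
    (hb : 0 ≤ b) (hab : a + b = 1) :
    φ.gap v (a • x + b • y) ≤ a * φ.gap v x + b * φ.gap v y := by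
  have h := φ.eval_combo_ge x y ha hb hab
  simp only [gap]
  rw [φ.monomial_combo v x y hab]
  linarith

/-! ### The primitives as averages of the gap: sign, convexity, zeros and critical points. -/

variable {ε : ℝ} {ρ : EuclideanSpace ℝ (Fin n) → ℝ}

theorem _root_.IsSmoothingKernel.hasCompactSupport (hρ : IsSmoothingKernel ε ρ) :
    HasCompactSupport ρ := by
  rw [HasCompactSupport, hρ.support_eq]
  exact isCompact_closedBall _ _

theorem _root_.IsSmoothingKernel.integrable_mul (hρ : IsSmoothingKernel ε ρ)
    {g : EuclideanSpace ℝ (Fin n) → ℝ} (hg : Continuous g) :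
    MeasureTheory.Integrable fun t => ρ t * g t :=
  (hρ.smooth.continuous.mul hg).integrable_of_hasCompactSupport hρ.hasCompactSupport.mul_right

/-- The integrand is odd because the kernel is even. Hence convolution with the kernel fixes affine
functions. -/
theorem _root_.IsSmoothingKernel.integral_mul_inner (hρ : IsSmoothingKernel ε ρ)
    (v : EuclideanSpace ℝ (Fin n)) : ∫ t, ρ t * inner ℝ v t = 0 := by
  have h := MeasureTheory.integral_neg_eq_self (fun t => ρ t * inner ℝ v t)
    (MeasureTheory.volume : MeasureTheory.Measure (EuclideanSpace ℝ (Fin n)))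
  simp only [hρ.symm, inner_neg_right, mul_neg] at h
  rw [MeasureTheory.integral_neg] at h
  linarith

theorem contDiff_smoothing (hρ : IsSmoothingKernel ε ρ) : ContDiff ℝ 2 (φ.smoothing ρ) := by
  have h : ContDiff ℝ ((2 : ℕ∞) : WithTop ℕ∞) (φ.smoothing ρ) :=
    hρ.hasCompactSupport.contDiff_convolution_left _ (hρ.smooth.of_le (by exact_mod_cast le_top))
      φ.continuous_eval.locallyIntegrable
  exact h

/-- The monomial equals its own smoothing, so the primitive is the smoothing of the gap. It thereby
inherits non-negativity and convexity. -/
theorem neckPrimitive_eq_integral (hρ : IsSmoothingKernel ε ρ) (v : Fin n → ℤ)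
    (q : EuclideanSpace ℝ (Fin n)) :
    φ.neckPrimitive ρ v q = ∫ t, ρ t * φ.gap v (q - t) := by
  have h1 : MeasureTheory.Integrable fun t => ρ t * φ.monomial v (q - t) :=
    hρ.integrable_mul ((φ.continuous_monomial v).comp (continuous_const.sub continuous_id))
  have h2 : MeasureTheory.Integrable fun t => ρ t * φ.eval (q - t) :=
    hρ.integrable_mul (φ.continuous_eval.comp (continuous_const.sub continuous_id))
  have h3 : ∫ t, ρ t * φ.monomial v (q - t) = φ.monomial v q := by
    have : (fun t => ρ t * φ.monomial v (q - t)) =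
        fun t => ρ t * φ.monomial v q - ρ t * inner ℝ (latticeVector v) t := by
      funext t
      simp only [monomial_eq_inner, inner_sub_right]
      ring
    rw [this, MeasureTheory.integral_sub (hρ.integrable_mul continuous_const)
      (hρ.integrable_mul (by fun_prop)), hρ.integral_mul_inner, MeasureTheory.integral_mul_const,
      hρ.integral_eq, one_mul, sub_zero]
  have h4 : φ.smoothing ρ q = ∫ t, ρ t * φ.eval (q - t) := by
    simp [smoothing, MeasureTheory.convolution_def]
  rw [neckPrimitive, h4]
  conv_lhs => rw [← h3]
  rw [← MeasureTheory.integral_sub h1 h2]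
  simp only [gap, mul_sub]

theorem continuous_neckPrimitive (hρ : IsSmoothingKernel ε ρ) (v : Fin n → ℤ) :
    Continuous (φ.neckPrimitive ρ v) :=
  (φ.continuous_monomial v).sub (φ.contDiff_smoothing hρ).continuous

theorem neckPrimitive_nonneg (hρ : IsSmoothingKernel ε ρ) {v : Fin n → ℤ} (hv : v ∈ φ.support)
    (q : EuclideanSpace ℝ (Fin n)) : 0 ≤ φ.neckPrimitive ρ v q := by
  rw [φ.neckPrimitive_eq_integral hρ]
  exact MeasureTheory.integral_nonneg fun t => mul_nonneg (hρ.nonneg t) (φ.gap_nonneg hv _)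

theorem convexOn_neckPrimitive (hρ : IsSmoothingKernel ε ρ) (v : Fin n → ℤ) :
    ConvexOn ℝ Set.univ (φ.neckPrimitive ρ v) := by
  refine ⟨convex_univ, fun x _ y _ a b ha hb hab => ?_⟩
  have hi : ∀ z, MeasureTheory.Integrable fun t => ρ t * φ.gap v (z - t) := fun z =>
    hρ.integrable_mul ((φ.continuous_gap v).comp (continuous_const.sub continuous_id))
  simp only [φ.neckPrimitive_eq_integral hρ, smul_eq_mul]
  rw [← MeasureTheory.integral_const_mul, ← MeasureTheory.integral_const_mul,
    ← MeasureTheory.integral_add ((hi x).const_mul a) ((hi y).const_mul b)]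
  refine MeasureTheory.integral_mono (hi _) (((hi x).const_mul a).add ((hi y).const_mul b))
    fun t => ?_
  have h := φ.gap_combo_le v (x - t) (y - t) ha hb hab
  have ht : a • (x - t) + b • (y - t) = a • x + b • y - t := by
    rw [smul_sub, smul_sub, sub_add_sub_comm, ← add_smul, hab, one_smul]
  rw [ht] at h
  have := mul_le_mul_of_nonneg_left h (hρ.nonneg t)
  change _ ≤ a * (ρ t * φ.gap v (x - t)) + b * (ρ t * φ.gap v (y - t))
  linarith

theorem neckPrimitive_eq_zero_of_gap (hρ : IsSmoothingKernel ε ρ) {v : Fin n → ℤ}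
    {q : EuclideanSpace ℝ (Fin n)} (h : ∀ x ∈ Metric.closedBall q ε, φ.gap v x = 0) :
    φ.neckPrimitive ρ v q = 0 := by
  rw [φ.neckPrimitive_eq_integral hρ]
  refine MeasureTheory.integral_eq_zero_of_ae (Filter.Eventually.of_forall fun t => ?_)
  change ρ t * φ.gap v (q - t) = 0
  by_cases ht : t ∈ tsupport ρ
  · rw [hρ.support_eq] at ht
    rw [h, mul_zero]
    simpa [Metric.mem_closedBall, dist_eq_norm] using ht
  · rw [image_eq_zero_of_notMem_tsupport ht, zero_mul]

/-- A continuous non-negative integrand with integral zero vanishes identically, so the gap vanishes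
wherever the kernel does not. The support being the full closed ball, continuity gives all of it. -/
theorem gap_eq_zero_of_neckPrimitive (hρ : IsSmoothingKernel ε ρ) {v : Fin n → ℤ}
    (hv : v ∈ φ.support) {q : EuclideanSpace ℝ (Fin n)} (h : φ.neckPrimitive ρ v q = 0) :
    ∀ x ∈ Metric.closedBall q ε, φ.gap v x = 0 := by
  have hg : Continuous fun t => φ.gap v (q - t) :=
    (φ.continuous_gap v).comp (continuous_const.sub continuous_id)
  rw [φ.neckPrimitive_eq_integral hρ, MeasureTheory.integral_eq_zero_iff_of_nonneg
    (fun t => mul_nonneg (hρ.nonneg t) (φ.gap_nonneg hv _)) (hρ.integrable_mul hg)] at h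
  have h0 : (fun t => ρ t * φ.gap v (q - t)) = fun _ => 0 :=
    (hρ.smooth.continuous.mul hg).ae_eq_iff_eq MeasureTheory.volume continuous_const |>.1 h
  have hsub : tsupport ρ ⊆ {t | φ.gap v (q - t) = 0} := by
    refine closure_minimal (fun t ht => ?_) (isClosed_eq hg continuous_const)
    exact (mul_eq_zero.1 (congrFun h0 t)).resolve_left ht
  rw [hρ.support_eq] at hsub
  intro x hx
  have := hsub (show q - x ∈ Metric.closedBall 0 ε by
    rw [Metric.mem_closedBall, dist_eq_norm] at hx
    rwa [mem_closedBall_zero_iff, norm_sub_rev])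
  simpa using this

/-- A radius below which every linearity cell of `φ` contains a closed ball of that radius. -/
theorem exists_radius : ∃ ε₀ : ℝ, 0 < ε₀ ∧ ∀ v ∈ φ.vertices,
    ∃ x, ∀ y ∈ Metric.closedBall x ε₀, φ.gap v y = 0 := by
  have h : ∀ v ∈ φ.vertices, ∃ δ : ℝ, 0 < δ ∧
      ∃ x, ∀ y ∈ Metric.closedBall x δ, φ.gap v y = 0 := by
    rintro v ⟨-, O, hO, ⟨x, hx⟩, hOv⟩
    obtain ⟨δ, hδ, hδO⟩ := Metric.nhds_basis_closedBall.mem_iff.1 (hO.mem_nhds hx)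
    exact ⟨δ, hδ, x, fun y hy => sub_eq_zero.2 (hOv y (hδO hy)).symm⟩
  choose! δ hδ hx using h
  have hfin := φ.vertices_finite
  rcases φ.vertices.eq_empty_or_nonempty with he | hne
  · exact ⟨1, one_pos, by simp [he]⟩
  · obtain ⟨v₀, hv₀, hmin⟩ := Set.exists_min_image φ.vertices δ hfin hne
    refine ⟨δ v₀, hδ _ hv₀, fun v hv => ?_⟩
    obtain ⟨x, hx⟩ := hx v hv
    exact ⟨x, fun y hy => hx y (Metric.closedBall_subset_closedBall (hmin v hv) hy)⟩

theorem hasGradientAt_neckPrimitive (hρ : IsSmoothingKernel ε ρ) (v : Fin n → ℤ)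
    (q : EuclideanSpace ℝ (Fin n)) :
    HasGradientAt (φ.neckPrimitive ρ v) (latticeVector v - gradient (φ.smoothing ρ) q) q := by
  have h1 := ((φ.contDiff_smoothing hρ).differentiable (by simp) q).hasGradientAt.hasFDerivAt
  have h2 : HasFDerivAt (φ.monomial v)
      (InnerProductSpace.toDual ℝ (EuclideanSpace ℝ (Fin n)) (latticeVector v)) q := by
    have : φ.monomial v = fun q => φ.coeff v +
        InnerProductSpace.toDual ℝ (EuclideanSpace ℝ (Fin n)) (latticeVector v) q := by
      funext q
      rw [monomial_eq_inner, InnerProductSpace.toDual_apply_apply]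
    rw [this]
    exact (ContinuousLinearMap.hasFDerivAt _).const_add _
  rw [hasGradientAt_iff_hasFDerivAt, map_sub]
  exact h2.sub h1

theorem gradient_neckPrimitive (hρ : IsSmoothingKernel ε ρ) (v : Fin n → ℤ)
    (q : EuclideanSpace ℝ (Fin n)) :
    gradient (φ.neckPrimitive ρ v) q = latticeVector v - gradient (φ.smoothing ρ) q :=
  (φ.hasGradientAt_neckPrimitive hρ v q).gradient

/-- A critical point of the primitive is a minimum. -/
theorem neckPrimitive_eq_zero_of_critical (hρ : IsSmoothingKernel ε ρ) {v : Fin n → ℤ}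
    (hv : v ∈ φ.support) (hmin : ∃ x, φ.neckPrimitive ρ v x = 0) {q : EuclideanSpace ℝ (Fin n)}
    (hq : gradient (φ.smoothing ρ) q = latticeVector v) : φ.neckPrimitive ρ v q = 0 := by
  obtain ⟨x, hx⟩ := hmin
  refine le_antisymm ?_ (φ.neckPrimitive_nonneg hρ hv q)
  by_contra! hpos
  have hd : HasFDerivAt (φ.neckPrimitive ρ v) (0 : EuclideanSpace ℝ (Fin n) →L[ℝ] ℝ) q := by
    have := (φ.hasGradientAt_neckPrimitive hρ v q).hasFDerivAt
    rwa [hq, sub_self, map_zero] at this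
  have hline : HasDerivAt (fun t : ℝ => φ.neckPrimitive ρ v (q + t • (x - q))) 0 0 := by
    have hl : HasDerivAt (fun t : ℝ => q + t • (x - q)) (x - q) 0 := by
      simpa using ((hasDerivAt_id (0 : ℝ)).smul_const (x - q)).const_add q
    have hd' : HasFDerivAt (φ.neckPrimitive ρ v) (0 : EuclideanSpace ℝ (Fin n) →L[ℝ] ℝ)
        (q + (0 : ℝ) • (x - q)) := by simpa using hd
    exact hd'.comp_hasDerivAt (0 : ℝ) hl
  have hslope := (hasDerivAt_iff_tendsto_slope.1 hline).mono_left
    (nhdsWithin_mono (0 : ℝ) (s := Set.Ioi 0) fun t ht => ne_of_gt ht)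
  -- By convexity the slopes on the segment from `q` towards a zero `x` are at most `-f_v(q) < 0`,
  -- against the vanishing derivative at `q`.
  have hle : ∀ᶠ t in 𝓝[>] (0 : ℝ),
      slope (fun t : ℝ => φ.neckPrimitive ρ v (q + t • (x - q))) 0 t ≤ -φ.neckPrimitive ρ v q := by
    filter_upwards [Ioo_mem_nhdsGT (show (0 : ℝ) < 1 by norm_num)] with t ht
    have hc := (φ.convexOn_neckPrimitive hρ v).2 (Set.mem_univ q) (Set.mem_univ x)
      (sub_nonneg.2 ht.2.le) ht.1.le (by ring)
    have hpt : (1 - t) • q + t • x = q + t • (x - q) := by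
      rw [sub_smul, one_smul, smul_sub]; abel
    rw [hpt, hx, smul_zero, add_zero, smul_eq_mul] at hc
    rw [slope_def_field, sub_zero, zero_smul, add_zero, div_le_iff₀ ht.1]
    linarith
  have := le_of_tendsto hslope hle
  linarith

/-- Two affine functions which agree near a point have the same linear part; it is tested on small
steps along the coordinate axes. -/
theorem eq_of_gap_eq_zero {v v' : Fin n → ℤ} {q : EuclideanSpace ℝ (Fin n)}
    (hv : ∀ᶠ x in 𝓝 q, φ.gap v x = 0) (hv' : ∀ᶠ x in 𝓝 q, φ.gap v' x = 0) : v = v' := by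
  have h : ∀ᶠ x in 𝓝 q, φ.monomial v x = φ.monomial v' x := by
    filter_upwards [hv, hv'] with x hx hx'
    simp only [gap] at hx hx'
    linarith
  funext i
  have hlim : Filter.Tendsto (fun t : ℝ => q + t • EuclideanSpace.single i (1 : ℝ)) (𝓝[>] 0)
      (𝓝 q) := by
    have : Continuous fun t : ℝ => q + t • EuclideanSpace.single i (1 : ℝ) := by fun_prop
    have h0 := (this.tendsto 0).mono_left (nhdsWithin_le_nhds (s := Set.Ioi 0))
    simpa using h0
  obtain ⟨t, ht, ht0⟩ := ((hlim.eventually h).and self_mem_nhdsWithin).exists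
  have h0 := h.self_of_nhds
  have ht0 : (0 : ℝ) < t := ht0
  simp only [monomial_eq_inner, inner_add_right, inner_smul_right,
    EuclideanSpace.inner_single_right] at ht h0
  have h1 : t * ((latticeVector v).ofLp i - (latticeVector v').ofLp i) = 0 := by
    simp at ht
    linarith
  have h2 := (mul_eq_zero.1 h1).resolve_left ht0.ne'
  have h3 : ((v i : ℤ) : ℝ) = v' i := by
    simpa [latticeVector, sub_eq_zero] using h2
  exact_mod_cast h3

/-! ### Disjointness of the necks. -/

variable {c : ℝ}

/-- The point `q` is at distance less than `ε` from some `u` in `U_v`. There the primitive vanishes,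
so the gap vanishes on the closed `ε`-ball about `u`, and `q` is interior to this ball. -/
theorem gap_eventually_eq_zero (hρ : IsSmoothingKernel ε ρ)
    (hmin : ∀ v ∈ φ.vertices, ∃ x, φ.neckPrimitive ρ v x = 0) (hc : φ.IsSurgeryConstant ρ ε c)
    {v : Fin n → ℤ} (hv : v ∈ φ.vertices) {q : EuclideanSpace ℝ (Fin n)}
    (hq : φ.neckPrimitive ρ v q < 2 * c) : ∀ᶠ x in 𝓝 q, φ.gap v x = 0 := by
  obtain ⟨u, hu, hqu⟩ := Metric.mem_thickening_iff.1 (hc.2 v hv q hq)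
  have h0 := φ.gap_eq_zero_of_neckPrimitive hρ hv.1
    (φ.neckPrimitive_eq_zero_of_critical hρ hv.1 (hmin v hv) hu)
  filter_upwards [Metric.isOpen_ball.mem_nhds (Metric.mem_ball.2 hqu)] with x hx
  exact h0 x (Metric.ball_subset_closedBall hx)

/-- The necks at distinct vertices are disjoint, even from the closures of each other. -/
theorem eq_of_neckPrimitive_lt (hρ : IsSmoothingKernel ε ρ)
    (hmin : ∀ v ∈ φ.vertices, ∃ x, φ.neckPrimitive ρ v x = 0) (hc : φ.IsSurgeryConstant ρ ε c)
    {v v' : Fin n → ℤ} (hv : v ∈ φ.vertices) (hv' : v' ∈ φ.vertices)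
    {q : EuclideanSpace ℝ (Fin n)} (hq : φ.neckPrimitive ρ v q ≤ 2 * c)
    (hq' : φ.neckPrimitive ρ v' q < 2 * c) : v = v' := by
  -- Only the weak inequality is known at `v`. Moving slightly towards a zero `x` of this primitive
  -- makes it strict by convexity, while the strict inequality at `v'` persists.
  obtain ⟨x, hx⟩ := hmin v hv
  have hlim : Filter.Tendsto (fun t : ℝ => (1 - t) • q + t • x) (𝓝[>] 0) (𝓝 q) := by
    have : Continuous fun t : ℝ => (1 - t) • q + t • x := by fun_prop
    have h0 := (this.tendsto 0).mono_left (nhdsWithin_le_nhds (s := Set.Ioi 0))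
    simpa using h0
  have hev := hlim.eventually
    ((φ.continuous_neckPrimitive hρ v').continuousAt.eventually_lt continuousAt_const hq')
  obtain ⟨t, ht', ht⟩ := (hev.and (Ioo_mem_nhdsGT (show (0 : ℝ) < 1 by norm_num))).exists
  have hcv := (φ.convexOn_neckPrimitive hρ v).2 (Set.mem_univ q) (Set.mem_univ x)
      (sub_nonneg.2 ht.2.le) ht.1.le (by ring)
  rw [hx, smul_zero, add_zero, smul_eq_mul] at hcv
  have hlt : φ.neckPrimitive ρ v ((1 - t) • q + t • x) < 2 * c := by
    have h1 : (1 - t) * φ.neckPrimitive ρ v q ≤ (1 - t) * (2 * c) :=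
      mul_le_mul_of_nonneg_left hq (sub_nonneg.2 ht.2.le)
    have h2 : 0 < t * (2 * c) := mul_pos ht.1 (by linarith [hc.1])
    linarith
  exact φ.eq_of_gap_eq_zero (φ.gap_eventually_eq_zero hρ hmin hc hv hlt)
    (φ.gap_eventually_eq_zero hρ hmin hc hv' ht')

theorem gradient_ne_of_pos (hρ : IsSmoothingKernel ε ρ)
    (hmin : ∀ v ∈ φ.vertices, ∃ x, φ.neckPrimitive ρ v x = 0) {v : Fin n → ℤ}
    (hv : v ∈ φ.vertices) {q : EuclideanSpace ℝ (Fin n)} (hq : 0 < φ.neckPrimitive ρ v q) :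
    latticeVector v - gradient (φ.smoothing ρ) q ≠ 0 := fun h =>
  hq.ne' (φ.neckPrimitive_eq_zero_of_critical hρ hv.1 (hmin v hv) (sub_eq_zero.1 h).symm)

end TropicalPolynomial

/-! ### Surgery profiles -/

/-- The conditions on the profile function `r` alone. -/
structure IsConvexProfile (c : ℝ) (r : ℝ → ℝ) : Prop where
  smooth : ContDiffOn ℝ ∞ r (Set.Ioi c)
  convex : ConvexOn ℝ (Set.Ici c) r
  eq : ∀ t, 2 * c ≤ t → r t = t
  deriv : HasDerivWithinAt r (1 / 2) (Set.Ici c) c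

namespace IsConvexProfile

variable {c : ℝ} {r : ℝ → ℝ}

theorem derivWithin_self (h : IsConvexProfile c r) : derivWithin r (Set.Ici c) c = 1 / 2 :=
  h.deriv.derivWithin (uniqueDiffOn_Ici c c Set.self_mem_Ici)

theorem derivWithin_eventuallyEq {t : ℝ} (ht : c < t) :
    derivWithin r (Set.Ici c) =ᶠ[𝓝 t] _root_.deriv r := by
  filter_upwards [Ioi_mem_nhds ht] with u hu
  exact derivWithin_of_mem_nhds (Ici_mem_nhds hu)

theorem contDiffAt_derivWithin (h : IsConvexProfile c r) {t : ℝ} (ht : c < t) :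
    ContDiffAt ℝ ∞ (derivWithin r (Set.Ici c)) t := by
  have h1 : ContDiffOn ℝ ∞ (_root_.deriv r) (Set.Ioi c) :=
    h.smooth.deriv_of_isOpen isOpen_Ioi (by simp)
  exact (h1.contDiffAt (Ioi_mem_nhds ht)).congr_of_eventuallyEq (derivWithin_eventuallyEq ht)

theorem hasDerivAt_derivWithin (h : IsConvexProfile c r) {t : ℝ} (ht : c < t) :
    HasDerivAt (derivWithin r (Set.Ici c)) (_root_.deriv (derivWithin r (Set.Ici c)) t) t :=
  ((h.contDiffAt_derivWithin ht).differentiableAt (by simp)).hasDerivAt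

theorem continuousAt_deriv_derivWithin (h : IsConvexProfile c r) {t : ℝ} (ht : c < t) :
    ContinuousAt (_root_.deriv (derivWithin r (Set.Ici c))) t := by
  have h1 : ContDiffOn ℝ ∞ (derivWithin r (Set.Ici c)) (Set.Ioi c) := fun u hu =>
    (h.contDiffAt_derivWithin hu).contDiffWithinAt
  have h2 : ContDiffOn ℝ ∞ (_root_.deriv (derivWithin r (Set.Ici c))) (Set.Ioi c) :=
    h1.deriv_of_isOpen isOpen_Ioi (by simp)
  exact (h2.contDiffAt (Ioi_mem_nhds ht)).continuousAt

theorem differentiableOn (h : IsConvexProfile c r) : DifferentiableOn ℝ r (Set.Ici c) := by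
  intro t ht
  rcases eq_or_lt_of_le (show c ≤ t from ht) with rfl | hlt
  · exact h.deriv.differentiableWithinAt
  · exact ((h.smooth.contDiffAt (Ioi_mem_nhds hlt)).differentiableAt
      (by simp)).differentiableWithinAt

theorem monotoneOn (h : IsConvexProfile c r) :
    MonotoneOn (derivWithin r (Set.Ici c)) (Set.Ici c) :=
  h.convex.monotoneOn_derivWithin h.differentiableOn

theorem derivWithin_eq_one (h : IsConvexProfile c r) (hc : 0 < c) {t : ℝ} (ht : 2 * c ≤ t) :
    derivWithin r (Set.Ici c) t = 1 := by
  have hct : c < t := by linarith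
  have h1 : HasDerivWithinAt r (derivWithin r (Set.Ici c) t) (Set.Ici t) t :=
    (h.differentiableOn t hct.le).hasDerivWithinAt.mono (Set.Ici_subset_Ici.2 hct.le)
  have h2 : HasDerivWithinAt r 1 (Set.Ici t) t :=
    (hasDerivWithinAt_id t _).congr (fun u hu => h.eq u (ht.trans hu)) (h.eq t ht)
  exact (uniqueDiffOn_Ici t t Set.self_mem_Ici).eq_deriv _ h1 h2

theorem half_le (h : IsConvexProfile c r) {t : ℝ} (ht : c ≤ t) :
    1 / 2 ≤ derivWithin r (Set.Ici c) t := by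
  rw [← h.derivWithin_self]
  exact h.monotoneOn Set.self_mem_Ici ht ht

theorem le_one (h : IsConvexProfile c r) (hc : 0 < c) {t : ℝ} (ht : c ≤ t) :
    derivWithin r (Set.Ici c) t ≤ 1 := by
  rw [← h.derivWithin_eq_one hc (le_max_left (2 * c) t)]
  exact h.monotoneOn ht (ht.trans (le_max_right _ _)) (le_max_right _ _)

theorem deriv_derivWithin_eq_zero (h : IsConvexProfile c r) (hc : 0 < c) {t : ℝ}
    (ht : 2 * c ≤ t) : _root_.deriv (derivWithin r (Set.Ici c)) t = 0 := by
  have hct : c < t := by linarith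
  have h1 := (h.hasDerivAt_derivWithin hct).hasDerivWithinAt (s := Set.Ici t)
  have h2 : HasDerivWithinAt (derivWithin r (Set.Ici c)) 0 (Set.Ici t) t :=
    (hasDerivWithinAt_const t _ (1 : ℝ)).congr
      (fun u hu => h.derivWithin_eq_one hc (ht.trans hu)) (h.derivWithin_eq_one hc ht)
  exact (uniqueDiffOn_Ici t t Set.self_mem_Ici).eq_deriv _ h1 h2

theorem deriv_derivWithin_nonneg (h : IsConvexProfile c r) {t : ℝ} (ht : c < t) :
    0 ≤ _root_.deriv (derivWithin r (Set.Ici c)) t := by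
  rw [← derivWithin_of_mem_nhds (Ici_mem_nhds ht)]
  exact h.monotoneOn.derivWithin_nonneg

/-- Only the end point `c` is at issue. For `t > c` convexity bounds the derivative by the slope
over `[t, 2t - c]`, which is twice the slope over `[c, 2t - c]` minus the slope over `[c, t]`. This
tends to `2 · 1/2 - 1/2 = 1/2`, and `1/2` is also a lower bound. -/
theorem continuousOn (h : IsConvexProfile c r) :
    ContinuousOn (derivWithin r (Set.Ici c)) (Set.Ici c) := by
  intro t ht
  rcases eq_or_lt_of_le (show c ≤ t from ht) with rfl | hlt
  swap
  · exact (h.contDiffAt_derivWithin hlt).continuousAt.continuousWithinAt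
  rw [← continuousWithinAt_Ioi_iff_Ici, ContinuousWithinAt, h.derivWithin_self]
  have hs : Filter.Tendsto (slope r c) (𝓝[>] c) (𝓝 (1 / 2)) := by
    have := (hasDerivWithinAt_iff_tendsto_slope' Set.self_notMem_Ioi).1
      (h.deriv.mono Set.Ioi_subset_Ici_self)
    exact this
  have hdouble : Filter.Tendsto (fun t => 2 * t - c) (𝓝[>] c) (𝓝[>] c) := by
    refine tendsto_nhdsWithin_iff.2 ⟨?_, ?_⟩
    · have : Continuous fun t : ℝ => 2 * t - c := by fun_prop
      have h0 := (this.tendsto c).mono_left (nhdsWithin_le_nhds (s := Set.Ioi c))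
      convert h0 using 2
      ring
    · filter_upwards [self_mem_nhdsWithin] with t ht
      change c < 2 * t - c
      have : c < t := ht
      linarith
  have hup : Filter.Tendsto (fun t => 2 * slope r c (2 * t - c) - slope r c t) (𝓝[>] c)
      (𝓝 (1 / 2)) := by
    have := ((hs.comp hdouble).const_mul 2).sub hs
    have hhalf : (2 * (1 / 2) - 1 / 2 : ℝ) = 1 / 2 := by norm_num
    rwa [hhalf] at this
  refine tendsto_of_tendsto_of_tendsto_of_le_of_le' tendsto_const_nhds hup ?_ ?_
  · filter_upwards [self_mem_nhdsWithin] with t ht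
    exact h.half_le (le_of_lt ht)
  · filter_upwards [self_mem_nhdsWithin] with t ht
    have ht : c < t := ht
    have hle := h.convex.le_slope_of_hasDerivWithinAt ht.le
      (show c ≤ 2 * t - c by linarith) (show t < 2 * t - c by linarith)
      (h.differentiableOn t ht.le).hasDerivWithinAt
    refine hle.trans (le_of_eq ?_)
    have h1 : t - c ≠ 0 := by linarith
    simp only [slope_def_field]
    rw [show 2 * t - c - t = t - c by ring, show 2 * t - c - c = 2 * (t - c) by ring]
    field_simp
    ring

end IsConvexProfile

namespace IsSurgeryProfile

variable {c : ℝ} {r s : ℝ → ℝ}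

theorem isConvexProfile_left (h : IsSurgeryProfile c r s) : IsConvexProfile c r :=
  ⟨h.smooth_r, h.convex_r, h.r_eq, h.deriv_r⟩

/-- Passing to `t - s t` exchanges concave and convex and the limiting slopes `0` and `1`, so every
fact about `s` follows from the theory for `r`. -/
theorem isConvexProfile_right (h : IsSurgeryProfile c r s) :
    IsConvexProfile c fun t => t - s t where
  smooth := contDiffOn_id.sub h.smooth_s
  convex := (convexOn_id (convex_Ici c)).sub h.concave_s
  eq t ht := by simp [h.s_eq t ht]
  deriv := by
    have := (hasDerivWithinAt_id c (Set.Ici c)).sub h.deriv_s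
    norm_num at this
    exact this

theorem derivWithin_right (h : IsSurgeryProfile c r s) {t : ℝ} (ht : c ≤ t) :
    derivWithin s (Set.Ici c) t = 1 - derivWithin (fun t => t - s t) (Set.Ici c) t := by
  have h1 := h.isConvexProfile_right.differentiableOn t ht
  have h2 : HasDerivWithinAt s (1 - derivWithin (fun t => t - s t) (Set.Ici c) t)
      (Set.Ici c) t := by
    refine ((hasDerivWithinAt_id t (Set.Ici c)).sub h1.hasDerivWithinAt).congr
      (fun u _ => ?_) ?_ <;> simp
  exact h2.derivWithin (uniqueDiffOn_Ici c t ht)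

theorem hasDerivAt_derivWithin_right (h : IsSurgeryProfile c r s) {t : ℝ} (ht : c < t) :
    HasDerivAt (derivWithin s (Set.Ici c))
      (-deriv (derivWithin (fun t => t - s t) (Set.Ici c)) t) t := by
  refine ((h.isConvexProfile_right.hasDerivAt_derivWithin ht).const_sub 1).congr_of_eventuallyEq ?_
  filter_upwards [Ioi_mem_nhds ht] with u hu
  exact h.derivWithin_right (le_of_lt hu)

/-- Equality at some `t > c` would, by monotonicity, make `r'` equal to `1/2` on all of `[c, t]`.
The profile curve would then contain a horizontal segment at `(c, 1/2)`, where it is a graph over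
the second coordinate. -/
theorem half_lt_derivWithin_left (h : IsSurgeryProfile c r s) {t : ℝ} (ht : c < t) :
    1 / 2 < derivWithin r (Set.Ici c) t := by
  refine lt_of_le_of_ne (h.isConvexProfile_left.half_le ht.le) fun heq => ?_
  obtain ⟨g, -, hg⟩ := h.smooth_curve
  have hlim : Filter.Tendsto (fun u : ℝ => (u, (1 / 2 : ℝ))) (𝓝 c) (𝓝 (c, 1 / 2)) :=
    (Continuous.prodMk_left _).tendsto _
  have hev := hlim.eventually hg
  have hmem : ∀ u ∈ Set.Icc c t, (u, (1 / 2 : ℝ)) ∈ profileCurve c r s := fun u hu => by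
    refine ⟨hu.1, Or.inl (le_antisymm (h.isConvexProfile_left.half_le hu.1) ?_)⟩
    change derivWithin r (Set.Ici c) u ≤ 1 / 2
    rw [heq]
    exact h.isConvexProfile_left.monotoneOn hu.1 ht.le hu.2
  have h0 : c = g (1 / 2) := hev.self_of_nhds.1 (hmem c ⟨le_rfl, ht.le⟩)
  obtain ⟨u, hu, hut⟩ := ((hev.filter_mono nhdsWithin_le_nhds).and (Ioo_mem_nhdsGT ht)).exists
  have h1 : u = g (1 / 2) := hu.1 (hmem u ⟨hut.1.le, hut.2.le⟩)
  linarith [hut.1]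

theorem derivWithin_right_lt_half (h : IsSurgeryProfile c r s) {t : ℝ} (ht : c < t) :
    derivWithin s (Set.Ici c) t < 1 / 2 := by
  have hp := h.isConvexProfile_right
  have hle := hp.half_le ht.le
  refine lt_of_le_of_ne (by rw [h.derivWithin_right ht.le]; linarith) fun heq => ?_
  obtain ⟨g, -, hg⟩ := h.smooth_curve
  have hlim : Filter.Tendsto (fun u : ℝ => (u, (1 / 2 : ℝ))) (𝓝 c) (𝓝 (c, 1 / 2)) :=
    (Continuous.prodMk_left _).tendsto _
  have hev := hlim.eventually hg
  have hmem : ∀ u ∈ Set.Icc c t, (u, (1 / 2 : ℝ)) ∈ profileCurve c r s := fun u hu => by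
    refine ⟨hu.1, Or.inr ?_⟩
    change 1 / 2 = derivWithin s (Set.Ici c) u
    have h1 := hp.half_le hu.1
    have h2 := hp.monotoneOn hu.1 ht.le hu.2
    rw [h.derivWithin_right ht.le] at heq
    rw [h.derivWithin_right hu.1]
    linarith
  have h0 : c = g (1 / 2) := hev.self_of_nhds.1 (hmem c ⟨le_rfl, ht.le⟩)
  obtain ⟨u, hu, hut⟩ := ((hev.filter_mono nhdsWithin_le_nhds).and (Ioo_mem_nhdsGT ht)).exists
  have h1 : u = g (1 / 2) := hu.1 (hmem u ⟨hut.1.le, hut.2.le⟩)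
  linarith [hut.1]

theorem derivWithin_left_self (h : IsSurgeryProfile c r s) :
    derivWithin r (Set.Ici c) c = 1 / 2 := h.isConvexProfile_left.derivWithin_self

theorem derivWithin_right_self (h : IsSurgeryProfile c r s) :
    derivWithin s (Set.Ici c) c = 1 / 2 :=
  h.deriv_s.derivWithin (uniqueDiffOn_Ici c c Set.self_mem_Ici)

/-- The points of the profile curve above `1/2` are those on the graph of `r'`. -/
theorem mem_profileCurve_of_gt (h : IsSurgeryProfile c r s) {t p : ℝ} (hp : 1 / 2 < p) :
    (t, p) ∈ profileCurve c r s ↔ c < t ∧ p = derivWithin r (Set.Ici c) t := by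
  constructor
  · rintro ⟨hct, hr⟩
    simp only at hct hr
    have hlt : c < t := by
      refine lt_of_le_of_ne hct fun hc => ?_
      rw [← hc, h.derivWithin_left_self, h.derivWithin_right_self] at hr
      rcases hr with hr | hr <;> linarith
    refine ⟨hlt, hr.resolve_right fun hs => ?_⟩
    linarith [h.derivWithin_right_lt_half hlt]
  · rintro ⟨hct, hr⟩
    exact ⟨hct.le, Or.inl hr⟩

/-- The points of the profile curve below `1/2` are those on the graph of `s'`. -/
theorem mem_profileCurve_of_lt (h : IsSurgeryProfile c r s) {t p : ℝ} (hp : p < 1 / 2) :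
    (t, p) ∈ profileCurve c r s ↔ c < t ∧ p = derivWithin s (Set.Ici c) t := by
  constructor
  · rintro ⟨hct, hr⟩
    simp only at hct hr
    have hlt : c < t := by
      refine lt_of_le_of_ne hct fun hc => ?_
      rw [← hc, h.derivWithin_left_self, h.derivWithin_right_self] at hr
      rcases hr with hr | hr <;> linarith
    refine ⟨hlt, hr.resolve_left fun hs => ?_⟩
    linarith [h.half_lt_derivWithin_left hlt]
  · rintro ⟨hct, hr⟩
    exact ⟨hct.le, Or.inr hr⟩

theorem mem_profileCurve_half (h : IsSurgeryProfile c r s) {t : ℝ} :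
    (t, (1 / 2 : ℝ)) ∈ profileCurve c r s ↔ t = c := by
  constructor
  · rintro ⟨hct, hr⟩
    simp only at hct hr
    by_contra hne
    have hlt : c < t := lt_of_le_of_ne hct (Ne.symm hne)
    rcases hr with hr | hr
    · linarith [h.half_lt_derivWithin_left hlt]
    · linarith [h.derivWithin_right_lt_half hlt]
  · rintro rfl
    exact ⟨le_rfl, Or.inl h.derivWithin_left_self.symm⟩

theorem isClosed_profileCurve (h : IsSurgeryProfile c r s) : IsClosed (profileCurve c r s) := by
  have hl := h.isConvexProfile_left.continuousOn
  have hr : ContinuousOn (derivWithin s (Set.Ici c)) (Set.Ici c) :=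
    (continuousOn_const.sub h.isConvexProfile_right.continuousOn).congr
      fun t ht => h.derivWithin_right ht
  have hclosed : IsClosed (Set.Ici c ×ˢ (Set.univ : Set ℝ)) := isClosed_Ici.prod isClosed_univ
  have key : ∀ k : ℝ → ℝ, ContinuousOn k (Set.Ici c) →
      IsClosed {x : ℝ × ℝ | c ≤ x.1 ∧ x.2 = k x.1} := by
    intro k hk
    have hg : ContinuousOn (fun x : ℝ × ℝ => x.2 - k x.1) (Set.Ici c ×ˢ Set.univ) :=
      continuousOn_snd.sub (hk.comp continuousOn_fst fun x hx => hx.1)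
    have := hg.preimage_isClosed_of_isClosed hclosed (isClosed_singleton (x := (0 : ℝ)))
    convert this using 1
    ext x
    simp [sub_eq_zero]
  have : profileCurve c r s =
      {x : ℝ × ℝ | c ≤ x.1 ∧ x.2 = derivWithin r (Set.Ici c) x.1} ∪
        {x : ℝ × ℝ | c ≤ x.1 ∧ x.2 = derivWithin s (Set.Ici c) x.1} := by
    ext x
    simp only [profileCurve, Set.mem_ofPred_eq, Set.mem_union]
    tauto
  rw [this]
  exact (key _ hl).union (key _ hr)

theorem mem_Icc_of_mem_profileCurve (h : IsSurgeryProfile c r s) (hc : 0 < c) {x : ℝ × ℝ}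
    (hx : x ∈ profileCurve c r s) : x.2 ∈ Set.Icc (0 : ℝ) 1 := by
  obtain ⟨hct, hr | hs⟩ := hx
  · rw [hr]
    exact ⟨by linarith [h.isConvexProfile_left.half_le hct], h.isConvexProfile_left.le_one hc hct⟩
  · rw [hs, h.derivWithin_right hct]
    exact ⟨by linarith [h.isConvexProfile_right.le_one hc hct],
      by linarith [h.isConvexProfile_right.half_le hct]⟩

/-- Near the point `(c, 1/2)` the profile curve is the graph of a function `g` of the second
coordinate, whose derivative is the inverse of the derivatives of `r'` and `s'`. -/
theorem exists_neck_function (h : IsSurgeryProfile c r s) :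
    ∃ g : ℝ → ℝ, ContDiff ℝ ∞ g ∧ g (1 / 2) = c ∧ deriv g (1 / 2) = 0 ∧
      ∀ᶠ x in 𝓝 (c, (1 / 2 : ℝ)), (x ∈ profileCurve c r s ↔ x.1 = g x.2) ∧
        (x ∈ profileCurve c r s → 1 / 2 < x.2 →
          deriv g x.2 * deriv (derivWithin r (Set.Ici c)) x.1 = 1) ∧
        (x ∈ profileCurve c r s → x.2 < 1 / 2 →
          deriv g x.2 * deriv (derivWithin s (Set.Ici c)) x.1 = 1) := by
  obtain ⟨g, hgs, hg⟩ := h.smooth_curve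
  have hgc : g (1 / 2) = c := (hg.self_of_nhds.1 (h.mem_profileCurve_half.2 rfl)).symm
  -- The curve stays in the region where the first coordinate is at least `c` and reaches `c` at
  -- height `1/2`. Thus `g` is minimal there and the tangent is vertical.
  have hmin : IsLocalMin g (1 / 2) := by
    have hlim : Filter.Tendsto (fun p : ℝ => (g p, p)) (𝓝 (1 / 2)) (𝓝 (c, 1 / 2)) := by
      have : Continuous fun p : ℝ => (g p, p) := hgs.continuous.prodMk continuous_id
      have := this.tendsto (1 / 2)
      rwa [hgc] at this
    filter_upwards [hlim.eventually hg] with p hp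
    rw [hgc]
    exact (hp.2 rfl).1
  -- Where the graph of `k` lies on the curve, `g ∘ k` is the identity; the chain rule gives the
  -- reciprocal derivatives.
  have key : ∀ k : ℝ → ℝ, (∀ t, c < t → DifferentiableAt ℝ k t) →
      (∀ t, c < t → (t, k t) ∈ profileCurve c r s) → ∀ x : ℝ × ℝ, c < x.1 → x.2 = k x.1 →
      (∀ᶠ y in 𝓝 x, y ∈ profileCurve c r s ↔ y.1 = g y.2) → deriv g x.2 * deriv k x.1 = 1 := by
    rintro k hk hmem ⟨t, p⟩ ht hp hx
    simp only at ht hp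
    subst hp
    have hkt := (hk t ht).hasDerivAt
    have hlim : Filter.Tendsto (fun u : ℝ => (u, k u)) (𝓝 t) (𝓝 (t, k t)) :=
      Filter.Tendsto.prodMk_nhds Filter.tendsto_id hkt.continuousAt
    have heq : (fun u => g (k u)) =ᶠ[𝓝 t] id := by
      filter_upwards [hlim.eventually hx, Ioi_mem_nhds ht] with u hu hcu
      exact (hu.1 (hmem u hcu)).symm
    have hcomp := (hgs.differentiable (by simp) (k t)).hasDerivAt.comp t hkt
    exact hcomp.unique ((hasDerivAt_id t).congr_of_eventuallyEq heq)
  refine ⟨g, hgs, hgc, hmin.deriv_eq_zero, ?_⟩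
  filter_upwards [hg, hg.eventually_nhds] with x hx hx'
  refine ⟨hx, fun hm hp => ?_, fun hm hp => ?_⟩
  · obtain ⟨h1, h2⟩ := (h.mem_profileCurve_of_gt (t := x.1) hp).1 hm
    exact key _ (fun t ht => (h.isConvexProfile_left.hasDerivAt_derivWithin ht).differentiableAt)
      (fun t ht => ⟨le_of_lt ht, Or.inl rfl⟩) x h1 h2 hx'
  · obtain ⟨h1, h2⟩ := (h.mem_profileCurve_of_lt (t := x.1) hp).1 hm
    exact key _ (fun t ht => (h.hasDerivAt_derivWithin_right ht).differentiableAt)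
      (fun t ht => ⟨le_of_lt ht, Or.inr rfl⟩) x h1 h2 hx'

end IsSurgeryProfile

/-! ### The sheets of the tropical Lagrangian -/

namespace TropicalPolynomial

variable {n : ℕ} (φ : TropicalPolynomial n)

/-- The finite set of vertices. -/
noncomputable def vertexFinset : Finset (Fin n → ℤ) := φ.vertices_finite.toFinset

theorem mem_vertexFinset {v : Fin n → ℤ} : v ∈ φ.vertexFinset ↔ v ∈ φ.vertices :=
  Set.Finite.mem_toFinset _

/-- The differential of the primitive at the vertex `v`. -/
noncomputable def neckCovector (ρ : EuclideanSpace ℝ (Fin n) → ℝ) (v : Fin n → ℤ)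
    (q : EuclideanSpace ℝ (Fin n)) : EuclideanSpace ℝ (Fin n) :=
  latticeVector v - gradient (φ.smoothing ρ) q

/-- The sheet coordinate of the sheet with profile `k`, which takes the value `κ` away from the
necks. -/
noncomputable def sheetHeight (ρ : EuclideanSpace ℝ (Fin n) → ℝ) (k : ℝ → ℝ) (κ : ℤ)
    (q : EuclideanSpace ℝ (Fin n)) : ℝ :=
  κ + ∑ v ∈ φ.vertexFinset, (k (φ.neckPrimitive ρ v q) - κ)

/-- The covector, up to the lattice, of the sheet with profile `k`, which takes the value `κ` away
from the necks. -/
noncomputable def sheetCovector (ρ : EuclideanSpace ℝ (Fin n) → ℝ) (k : ℝ → ℝ) (κ : ℤ)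
    (q : EuclideanSpace ℝ (Fin n)) : EuclideanSpace ℝ (Fin n) :=
  -((κ : ℝ) • gradient (φ.smoothing ρ) q) +
    ∑ v ∈ φ.vertexFinset, (k (φ.neckPrimitive ρ v q) - κ) • φ.neckCovector ρ v q

/-- The contribution of the Hessian of the smoothing to the tangent plane at the point `x`. -/
noncomputable def phaseMatrix (ρ : EuclideanSpace ℝ (Fin n) → ℝ) (x : (Fin n → ℂ) × ℝ) :
    Matrix (Fin n) (Fin n) ℝ :=
  (-(2 * Real.pi * x.2)) • hessianMatrix (φ.smoothing ρ) (logVector x.1)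

/-- The hypotheses on the smoothing kernel and the surgery data, where every primitive attains the
value zero. -/
structure IsSurgerySetup (ε : ℝ) (ρ : EuclideanSpace ℝ (Fin n) → ℝ) (c : ℝ) (r s : ℝ → ℝ) :
    Prop where
  kernel : IsSmoothingKernel ε ρ
  exists_zero : ∀ v ∈ φ.vertices, ∃ x, φ.neckPrimitive ρ v x = 0
  const : φ.IsSurgeryConstant ρ ε c
  profile : IsSurgeryProfile c r s

namespace IsSurgerySetup

variable {φ} {ε : ℝ} {ρ : EuclideanSpace ℝ (Fin n) → ℝ} {c : ℝ} {r s : ℝ → ℝ}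

theorem phaseMatrix_isSymm (D : φ.IsSurgerySetup ε ρ c r s) (x : (Fin n → ℂ) × ℝ) :
    (φ.phaseMatrix ρ x).IsSymm :=
  (hessianMatrix_isSymm (φ.contDiff_smoothing D.kernel) _).smul _

theorem mem_iff (D : φ.IsSurgerySetup ε ρ c r s) (x : (Fin n → ℂ) × ℝ) :
    x ∈ tropicalLagrangian φ ρ c r s ↔
      (∃ v ∈ φ.vertices, φ.neckPrimitive ρ v (logVector x.1) < 2 * c ∧
        (φ.neckPrimitive ρ v (logVector x.1), x.2) ∈ profileCurve c r s ∧
        x.1 = torusPoint (logVector x.1) (x.2 • φ.neckCovector ρ v (logVector x.1))) ∨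
      ((∀ v ∈ φ.vertices, 2 * c ≤ φ.neckPrimitive ρ v (logVector x.1)) ∧
        ((x.2 = 0 ∧ x.1 = torusPoint (logVector x.1) 0) ∨
          (x.2 = 1 ∧ x.1 = torusPoint (logVector x.1)
            (-gradient (φ.smoothing ρ) (logVector x.1))))) := by
  constructor
  · rintro ⟨q, h⟩
    have hq : logVector x.1 = q := by
      rcases h with ⟨v, -, -, -, h⟩ | ⟨-, ⟨-, h⟩ | ⟨-, h⟩⟩ <;> rw [h, logVector_torusPoint]
    rw [hq]
    refine h.imp_left ?_
    rintro ⟨v, hv, h1, h2, h3⟩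
    exact ⟨v, hv, h1, h2, by rw [h3, φ.gradient_neckPrimitive D.kernel]; rfl⟩
  · intro h
    refine ⟨logVector x.1, h.imp_left ?_⟩
    rintro ⟨v, hv, h1, h2, h3⟩
    exact ⟨v, hv, h1, h2, by rw [φ.gradient_neckPrimitive D.kernel]; exact h3⟩

theorem ne_zero (D : φ.IsSurgerySetup ε ρ c r s) {x : (Fin n → ℂ) × ℝ}
    (hx : x ∈ tropicalLagrangian φ ρ c r s) (j : Fin n) : x.1 j ≠ 0 := by
  rcases (D.mem_iff x).1 hx with ⟨v, -, -, -, h⟩ | ⟨-, ⟨-, h⟩ | ⟨-, h⟩⟩ <;> rw [h] <;>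
    exact torusPoint_ne_zero _ _ _

theorem ge_of_ne (D : φ.IsSurgerySetup ε ρ c r s) {v v' : Fin n → ℤ} (hv : v ∈ φ.vertices)
    (hv' : v' ∈ φ.vertices) (hne : v' ≠ v) {q : EuclideanSpace ℝ (Fin n)}
    (hq : φ.neckPrimitive ρ v q < 2 * c) : 2 * c ≤ φ.neckPrimitive ρ v' q := by
  by_contra! h
  exact hne (φ.eq_of_neckPrimitive_lt D.kernel D.exists_zero D.const hv' hv h.le hq)

/-- A sum over the vertices of terms which vanish outside of the necks has at most one non-zero
term. -/
theorem sum_eq_single (D : φ.IsSurgerySetup ε ρ c r s) {M : Type*} [AddCommMonoid M]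
    {q : EuclideanSpace ℝ (Fin n)} {a : (Fin n → ℤ) → M}
    (ha : ∀ v ∈ φ.vertices, 2 * c ≤ φ.neckPrimitive ρ v q → a v = 0) {v : Fin n → ℤ}
    (hv : v ∈ φ.vertices) (hq : φ.neckPrimitive ρ v q < 2 * c) :
    ∑ v ∈ φ.vertexFinset, a v = a v := by
  refine Finset.sum_eq_single v (fun v' hv' hne => ?_) fun h => absurd (φ.mem_vertexFinset.2 hv) h
  exact ha v' (φ.mem_vertexFinset.1 hv') (D.ge_of_ne hv (φ.mem_vertexFinset.1 hv') hne hq)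

theorem sum_eq_zero {M : Type*} [AddCommMonoid M]
    {q : EuclideanSpace ℝ (Fin n)} {a : (Fin n → ℤ) → M}
    (ha : ∀ v ∈ φ.vertices, 2 * c ≤ φ.neckPrimitive ρ v q → a v = 0)
    (hq : ∀ v ∈ φ.vertices, 2 * c ≤ φ.neckPrimitive ρ v q) :
    ∑ v ∈ φ.vertexFinset, a v = 0 :=
  Finset.sum_eq_zero fun v hv =>
    ha v (φ.mem_vertexFinset.1 hv) (hq v (φ.mem_vertexFinset.1 hv))

/-- Inside the neck at `v` the sheet covector is `k(f_v) df_v - κ v`, and `κ v` is a lattice vector.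
Subtracting it allows one single-valued formula on the base to describe the outer section and all
necks at once. -/
theorem torusPoint_sheetCovector (D : φ.IsSurgerySetup ε ρ c r s) {k : ℝ → ℝ} {κ : ℤ}
    (hk : ∀ t, 2 * c ≤ t → k t = κ) {v : Fin n → ℤ} (hv : v ∈ φ.vertices)
    {q : EuclideanSpace ℝ (Fin n)} (hq : φ.neckPrimitive ρ v q < 2 * c) :
    torusPoint q (φ.sheetCovector ρ k κ q) =
      torusPoint q (k (φ.neckPrimitive ρ v q) • φ.neckCovector ρ v q) := by
  rw [sheetCovector, D.sum_eq_single (fun v' _ h => by rw [hk _ h, sub_self, zero_smul]) hv hq,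
    ← torusPoint_add_latticeVector q _ (κ • v)]
  congr 1
  have : latticeVector (κ • v) = (κ : ℝ) • latticeVector v := by
    ext i
    simp [latticeVector]
  rw [this, neckCovector]
  module

theorem sheetHeight_eq (D : φ.IsSurgerySetup ε ρ c r s) {k : ℝ → ℝ} {κ : ℤ}
    (hk : ∀ t, 2 * c ≤ t → k t = κ) {v : Fin n → ℤ} (hv : v ∈ φ.vertices)
    {q : EuclideanSpace ℝ (Fin n)} (hq : φ.neckPrimitive ρ v q < 2 * c) :
    φ.sheetHeight ρ k κ q = k (φ.neckPrimitive ρ v q) := by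
  rw [sheetHeight, D.sum_eq_single (fun v' _ h => by rw [hk _ h, sub_self]) hv hq]
  ring

/-- Away from the middle level of the necks, the tropical Lagrangian is a union of two sheets over
the region where all the primitives are larger than `c`. -/
theorem mem_iff_sheet (D : φ.IsSurgerySetup ε ρ c r s) {k : ℝ → ℝ} {κ : ℤ}
    (hk : ∀ t, 2 * c ≤ t → k t = κ) {x : (Fin n → ℂ) × ℝ}
    (hside : ∀ t, (t, x.2) ∈ profileCurve c r s ↔ c < t ∧ x.2 = k t)
    (hend : (κ = 0 ∧ x.2 ≠ 1) ∨ (κ = 1 ∧ x.2 ≠ 0)) :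
    x ∈ tropicalLagrangian φ ρ c r s ↔
      (∀ v ∈ φ.vertices, c < φ.neckPrimitive ρ v (logVector x.1)) ∧
        x.2 = φ.sheetHeight ρ k κ (logVector x.1) ∧
        x.1 = torusPoint (logVector x.1) (φ.sheetCovector ρ k κ (logVector x.1)) := by
  have hc := D.const.1
  rw [D.mem_iff]
  set q := logVector x.1
  by_cases hex : ∃ v ∈ φ.vertices, φ.neckPrimitive ρ v q < 2 * c
  · obtain ⟨v, hv, hq⟩ := hex
    rw [D.sheetHeight_eq hk hv hq, D.torusPoint_sheetCovector hk hv hq]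
    constructor
    · rintro (⟨v', hv', hq', hcurve, hx⟩ | ⟨h, -⟩)
      · obtain rfl : v' = v :=
          φ.eq_of_neckPrimitive_lt D.kernel D.exists_zero D.const hv' hv hq'.le hq
        obtain ⟨h1, h2⟩ := (hside _).1 hcurve
        refine ⟨fun u hu => ?_, h2, by rwa [← h2]⟩
        by_cases huv : u = v'
        · rwa [huv]
        · linarith [D.ge_of_ne hv hu huv hq]
      · exact absurd (h v hv) (not_le.2 hq)
    · rintro ⟨h1, h2, h3⟩
      exact Or.inl ⟨v, hv, hq, (hside _).2 ⟨h1 v hv, h2⟩, by rwa [h2]⟩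
  · push Not at hex
    have h1 : φ.sheetHeight ρ k κ q = κ := by
      rw [sheetHeight, sum_eq_zero (fun v' _ h => by rw [hk _ h, sub_self]) hex, add_zero]
    have h2 : φ.sheetCovector ρ k κ q = -((κ : ℝ) • gradient (φ.smoothing ρ) q) := by
      rw [sheetCovector, sum_eq_zero (fun v' _ h => by rw [hk _ h, sub_self, zero_smul]) hex,
        add_zero]
    rw [h1, h2]
    have h3 : ∀ v ∈ φ.vertices, c < φ.neckPrimitive ρ v q := fun v hv => by
      linarith [hex v hv]
    have h4 : ¬ ∃ v ∈ φ.vertices, φ.neckPrimitive ρ v q < 2 * c ∧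
        (φ.neckPrimitive ρ v q, x.2) ∈ profileCurve c r s ∧
        x.1 = torusPoint q (x.2 • φ.neckCovector ρ v q) := by
      rintro ⟨v, hv, hq, -⟩
      exact absurd (hex v hv) (not_le.2 hq)
    -- Outside the necks both sections are present; the sheet coordinate excludes the one whose
    -- value is not `κ`.
    rcases hend with ⟨rfl, hne⟩ | ⟨rfl, hne⟩
    · simp only [h4, hne, false_or, false_and, or_false]
      simp only [Int.cast_zero, zero_smul, neg_zero]
      exact ⟨fun h => ⟨h3, h.2⟩, fun h => ⟨hex, h.2⟩⟩
    · simp only [h4, hne, false_or, false_and]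
      simp only [Int.cast_one, one_smul]
      exact ⟨fun h => ⟨h3, h.2⟩, fun h => ⟨hex, h.2⟩⟩

theorem hasFDerivAt_neckPrimitive (D : φ.IsSurgerySetup ε ρ c r s) (v : Fin n → ℤ)
    (q : EuclideanSpace ℝ (Fin n)) :
    HasFDerivAt (φ.neckPrimitive ρ v)
      (InnerProductSpace.toDual ℝ (EuclideanSpace ℝ (Fin n)) (φ.neckCovector ρ v q)) q :=
  (φ.hasGradientAt_neckPrimitive D.kernel v q).hasFDerivAt

theorem contDiff_neckPrimitive (D : φ.IsSurgerySetup ε ρ c r s) (v : Fin n → ℤ) :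
    ContDiff ℝ 2 (φ.neckPrimitive ρ v) := by
  have h : ContDiff ℝ 2 (φ.monomial v) := by
    unfold monomial
    fun_prop
  exact h.sub (φ.contDiff_smoothing D.kernel)

theorem hasFDerivAt_neckCovector (D : φ.IsSurgerySetup ε ρ c r s) (v : Fin n → ℤ)
    (q : EuclideanSpace ℝ (Fin n)) :
    HasFDerivAt (φ.neckCovector ρ v) (-fderiv ℝ (gradient (φ.smoothing ρ)) q) q := by
  have h := ((φ.contDiff_smoothing D.kernel).gradient_one.differentiable (by simp) q).hasFDerivAt
  exact h.const_sub _

theorem continuous_neckCovector (D : φ.IsSurgerySetup ε ρ c r s) (v : Fin n → ℤ) :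
    Continuous (φ.neckCovector ρ v) :=
  continuous_const.sub (φ.contDiff_smoothing D.kernel).gradient_one.continuous

/-- The Hessian of the smoothing has total coefficient `-(κ + ∑ (k - κ))`, which is minus the sheet
height. On `L` this height is `p`, so `phaseMatrix` serves both sheets and the necks. -/
theorem hasFDerivAt_sheetCovector (D : φ.IsSurgerySetup ε ρ c r s) {k k' : ℝ → ℝ} {κ : ℤ}
    {q : EuclideanSpace ℝ (Fin n)}
    (hk : ∀ v ∈ φ.vertices,
      HasDerivAt k (k' (φ.neckPrimitive ρ v q)) (φ.neckPrimitive ρ v q)) :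
    ∃ C : EuclideanSpace ℝ (Fin n) →L[ℝ] EuclideanSpace ℝ (Fin n),
      HasFDerivAt (φ.sheetCovector ρ k κ) C q ∧
      ∀ ξ, C ξ = -(φ.sheetHeight ρ k κ q • fderiv ℝ (gradient (φ.smoothing ρ)) q ξ) +
        ∑ v ∈ φ.vertexFinset, (k' (φ.neckPrimitive ρ v q) * inner ℝ (φ.neckCovector ρ v q) ξ) •
          φ.neckCovector ρ v q := by
  have h0 := ((φ.contDiff_smoothing D.kernel).gradient_one.differentiable (by simp) q).hasFDerivAt
  have h1 : ∀ v ∈ φ.vertexFinset, HasFDerivAt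
      (fun q => (k (φ.neckPrimitive ρ v q) - κ) • φ.neckCovector ρ v q)
      ((k (φ.neckPrimitive ρ v q) - κ) • (-fderiv ℝ (gradient (φ.smoothing ρ)) q) +
        (k' (φ.neckPrimitive ρ v q) • InnerProductSpace.toDual ℝ (EuclideanSpace ℝ (Fin n))
          (φ.neckCovector ρ v q)).smulRight (φ.neckCovector ρ v q)) q := fun v hv => by
    have h2 := (hk v (φ.mem_vertexFinset.1 hv)).comp_hasFDerivAt q
      (D.hasFDerivAt_neckPrimitive v q)
    exact (h2.sub_const (κ : ℝ)).smul (D.hasFDerivAt_neckCovector v q)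
  refine ⟨_, ((h0.const_smul (κ : ℝ)).neg).add (HasFDerivAt.fun_sum h1), fun ξ => ?_⟩
  simp only [add_apply, neg_apply,
    smul_apply, sum_apply,
    ContinuousLinearMap.smulRight_apply, InnerProductSpace.toDual_apply_apply,
    Finset.sum_add_distrib, smul_eq_mul, sheetHeight, smul_neg, Finset.sum_neg_distrib,
    ← Finset.sum_smul]
  module

/-- The tangent planes of the sheets. -/
theorem tangentPlane_sheet (D : φ.IsSurgerySetup ε ρ c r s) {k : ℝ → ℝ} {κ : ℤ}
    (hk : ∀ t, 2 * c ≤ t → k t = κ) (hkd : ∀ t, c < t → ContDiffAt ℝ 1 k t)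
    {x : (Fin n → ℂ) × ℝ} (hx : x ∈ tropicalLagrangian φ ρ c r s)
    (hside : ∀ᶠ p in 𝓝 x.2, (∀ t, (t, p) ∈ profileCurve c r s ↔ c < t ∧ p = k t) ∧
      ((κ = 0 ∧ p ≠ 1) ∨ (κ = 1 ∧ p ≠ 0))) :
    tangentPlane (tropicalLagrangian φ ρ c r s) x = LinearMap.range (torusPlaneMap x.1
      (onePlusI (φ.phaseMatrix ρ x + ∑ v ∈ φ.vertexFinset,
        (2 * Real.pi * deriv k (φ.neckPrimitive ρ v (logVector x.1))) •
          Matrix.vecMulVec (φ.neckCovector ρ v (logVector x.1)).ofLp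
            (φ.neckCovector ρ v (logVector x.1)).ofLp))) := by
  obtain ⟨hs1, hs2⟩ := hside.self_of_nhds
  obtain ⟨hx1, hx2, hx3⟩ := (D.mem_iff_sheet hk hs1 hs2).1 hx
  have hz := D.ne_zero hx
  set q := logVector x.1 with hq
  have hkd' : ∀ v ∈ φ.vertices, HasDerivAt k (deriv k (φ.neckPrimitive ρ v q))
      (φ.neckPrimitive ρ v q) := fun v hv =>
    ((hkd _ (hx1 v hv)).differentiableAt (by simp)).hasDerivAt
  obtain ⟨C, hC, hC'⟩ := D.hasFDerivAt_sheetCovector (k' := deriv k) (κ := κ) hkd'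
  have hP : ContDiffAt ℝ 1 (φ.sheetHeight ρ k κ) q := by
    refine contDiffAt_const.add (ContDiffAt.sum fun v hv => ContDiffAt.sub ?_ contDiffAt_const)
    exact (hkd _ (hx1 v (φ.mem_vertexFinset.1 hv))).comp q
      ((D.contDiff_neckPrimitive v).contDiffAt.of_le (by norm_num))
  -- The sheet is a graph over the base: its equation solves for `p`, so a base vector is free and
  -- determines the variation of `p`.
  let G : EuclideanSpace ℝ (Fin n) × ℝ → ℝ := fun y => y.2 - φ.sheetHeight ρ k κ y.1
  have hG : HasStrictFDerivAt G (ContinuousLinearMap.snd ℝ (EuclideanSpace ℝ (Fin n)) ℝ -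
      (fderiv ℝ (φ.sheetHeight ρ k κ) q).comp (ContinuousLinearMap.fst ℝ _ ℝ)) (q, x.2) :=
    hasStrictFDerivAt_snd.sub
      (HasStrictFDerivAt.comp (g := φ.sheetHeight ρ k κ) (q, x.2)
        (hP.hasStrictFDerivAt (by simp)) hasStrictFDerivAt_fst)
  let Y : EuclideanSpace ℝ (Fin n) × ℝ → EuclideanSpace ℝ (Fin n) :=
    fun y => φ.sheetCovector ρ k κ y.1
  have hY : HasFDerivAt Y (C.comp (ContinuousLinearMap.fst ℝ _ ℝ)) (q, x.2) :=
    HasFDerivAt.comp (g := φ.sheetCovector ρ k κ) (q, x.2) hC hasFDerivAt_fst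
  have hxe : (torusPoint q (Y (q, x.2)), x.2) = x := Prod.ext hx3.symm rfl
  have hcont : ContinuousAt (fun y : (Fin n → ℂ) × ℝ => logVector y.1) x :=
    ContinuousAt.comp (g := logVector) (continuousAt_logVector hz) continuousAt_fst
  have hev : ∀ᶠ y in 𝓝 x, ∀ v ∈ φ.vertexFinset, c < φ.neckPrimitive ρ v (logVector y.1) := by
    rw [Filter.eventually_all_finset]
    intro v hv
    refine ContinuousAt.eventually_lt continuousAt_const ?_ (hx1 v (φ.mem_vertexFinset.1 hv))
    exact ContinuousAt.comp (g := φ.neckPrimitive ρ v)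
      (φ.continuous_neckPrimitive D.kernel v).continuousAt hcont
  have key := mem_tangentPlane_iff hG (by
      intro h
      have := congrArg (fun f => f ((0 : EuclideanSpace ℝ (Fin n)), (1 : ℝ))) h
      simp at this) (sub_eq_zero.2 hx2) hY (L := tropicalLagrangian φ ρ c r s) (by
      rw [hxe]
      filter_upwards [hev, continuousAt_snd.tendsto.eventually hside] with y hy1 hy2
      rw [D.mem_iff_sheet hk hy2.1 hy2.2]
      simp only [G, Y, sub_eq_zero]
      constructor
      · rintro ⟨-, h2, h3⟩
        exact ⟨h3, h2⟩
      · rintro ⟨h3, h2⟩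
        exact ⟨fun v hv => hy1 v (φ.mem_vertexFinset.2 hv), h2, h3⟩)
  rw [hxe] at key
  ext η
  rw [key, LinearMap.mem_range]
  have hxz : torusPoint q (Y (q, x.2)) = x.1 := hx3.symm
  have hval : ∀ ξ : EuclideanSpace ℝ (Fin n), (fun j => torusPoint q (Y (q, x.2)) j *
      ((ξ j : ℂ) + 2 * Real.pi * Complex.I * (C ξ j : ℂ))) = torusPlaneMap x.1
      (onePlusI (φ.phaseMatrix ρ x + ∑ v ∈ φ.vertexFinset,
        (2 * Real.pi * deriv k (φ.neckPrimitive ρ v q)) •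
          Matrix.vecMulVec (φ.neckCovector ρ v q).ofLp (φ.neckCovector ρ v q).ofLp)) ξ.ofLp := by
    intro ξ
    funext j
    rw [hxz]
    change _ = x.1 j * _
    congr 1
    have hone : ∀ (M : Matrix (Fin n) (Fin n) ℝ) (j : Fin n),
        (onePlusI M).mulVec (fun i => (ξ.ofLp i : ℂ)) j =
          (ξ j : ℂ) + Complex.I * ((M.mulVec ξ.ofLp j : ℝ) : ℂ) := by
      intro M j
      rw [onePlusI, Matrix.add_mulVec, Matrix.one_mulVec, Matrix.smul_mulVec]
      simp [Matrix.mulVec, dotProduct]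
    rw [hone]
    have hM : (φ.phaseMatrix ρ x + ∑ v ∈ φ.vertexFinset,
        (2 * Real.pi * deriv k (φ.neckPrimitive ρ v q)) •
          Matrix.vecMulVec (φ.neckCovector ρ v q).ofLp (φ.neckCovector ρ v q).ofLp).mulVec
            ξ.ofLp j = 2 * Real.pi * C ξ j := by
      rw [hC', Matrix.add_mulVec, Matrix.sum_mulVec, phaseMatrix, Matrix.smul_mulVec, ← hx2]
      simp only [Pi.add_apply, Pi.smul_apply, hessianMatrix_mulVec, Finset.sum_apply,
        Matrix.smul_mulVec, Matrix.vecMulVec_mulVec, PiLp.add_apply, PiLp.neg_apply,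
        PiLp.smul_apply, smul_eq_mul, WithLp.ofLp_sum, WithLp.ofLp_smul, MulOpposite.smul_eq_mul_unop,
        MulOpposite.unop_op]
      rw [mul_add, Finset.mul_sum]
      congr 1
      · rw [← hq]; ring
      · refine Finset.sum_congr rfl fun v _ => ?_
        have : inner ℝ (φ.neckCovector ρ v q) ξ =
            dotProduct (φ.neckCovector ρ v q).ofLp ξ.ofLp := by
          simp [PiLp.inner_apply, dotProduct, mul_comm]
        rw [this]
        ring
    rw [hM]
    push_cast
    ring
  constructor
  · rintro ⟨ξ, τ, -, rfl⟩
    exact ⟨ξ.ofLp, (hval ξ).symm⟩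
  · rintro ⟨y, rfl⟩
    refine ⟨WithLp.toLp 2 y, fderiv ℝ (φ.sheetHeight ρ k κ) q (WithLp.toLp 2 y), by simp, ?_⟩
    exact (hval (WithLp.toLp 2 y)).symm

end IsSurgerySetup

end TropicalPolynomial

/-! ### The necks of the tropical Lagrangian -/

namespace TropicalPolynomial

namespace IsSurgerySetup

variable {n : ℕ} {φ : TropicalPolynomial n} {ε : ℝ} {ρ : EuclideanSpace ℝ (Fin n) → ℝ} {c : ℝ}
  {r s : ℝ → ℝ}

theorem neckPrimitive_of_half (D : φ.IsSurgerySetup ε ρ c r s) {x : (Fin n → ℂ) × ℝ}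
    (hx : x ∈ tropicalLagrangian φ ρ c r s) (hp : x.2 = 1 / 2) :
    ∃ v ∈ φ.vertices, φ.neckPrimitive ρ v (logVector x.1) = c ∧
      x.1 = torusPoint (logVector x.1) (x.2 • φ.neckCovector ρ v (logVector x.1)) := by
  rcases (D.mem_iff x).1 hx with ⟨v, hv, -, h2, h3⟩ | ⟨-, ⟨h, -⟩ | ⟨h, -⟩⟩
  · rw [hp] at h2
    exact ⟨v, hv, D.profile.mem_profileCurve_half.1 h2, h3⟩
  · norm_num [hp] at h
  · norm_num [hp] at h

theorem continuousAt_logVector_fst (D : φ.IsSurgerySetup ε ρ c r s) {x : (Fin n → ℂ) × ℝ}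
    (hx : x ∈ tropicalLagrangian φ ρ c r s) :
    ContinuousAt (fun y : (Fin n → ℂ) × ℝ => logVector y.1) x :=
  ContinuousAt.comp (g := logVector) (continuousAt_logVector (D.ne_zero hx)) continuousAt_fst

theorem continuousAt_neckPrimitive_logVector (D : φ.IsSurgerySetup ε ρ c r s) {x : (Fin n → ℂ) × ℝ}
    (hx : x ∈ tropicalLagrangian φ ρ c r s) (v : Fin n → ℤ) :
    ContinuousAt (fun y : (Fin n → ℂ) × ℝ => φ.neckPrimitive ρ v (logVector y.1)) x :=
  ContinuousAt.comp (g := φ.neckPrimitive ρ v)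
    (φ.continuous_neckPrimitive D.kernel v).continuousAt (D.continuousAt_logVector_fst hx)

theorem mem_iff_of_neckPrimitive_lt (D : φ.IsSurgerySetup ε ρ c r s) {x : (Fin n → ℂ) × ℝ}
    {v : Fin n → ℤ} (hv : v ∈ φ.vertices)
    (hq : φ.neckPrimitive ρ v (logVector x.1) < 2 * c) :
    x ∈ tropicalLagrangian φ ρ c r s ↔
      (φ.neckPrimitive ρ v (logVector x.1), x.2) ∈ profileCurve c r s ∧
        x.1 = torusPoint (logVector x.1) (x.2 • φ.neckCovector ρ v (logVector x.1)) := by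
  rw [D.mem_iff]
  constructor
  · rintro (⟨v', hv', hq', hcurve, hx⟩ | ⟨h, -⟩)
    · obtain rfl : v' = v :=
        φ.eq_of_neckPrimitive_lt D.kernel D.exists_zero D.const hv' hv hq'.le hq
      exact ⟨hcurve, hx⟩
    · exact absurd (h v hv) (not_le.2 hq)
  · rintro ⟨h1, h2⟩
    exact Or.inl ⟨v, hv, hq, h1, h2⟩

/-- The tangent planes at the middle level of a neck. -/
theorem tangentPlane_neck (D : φ.IsSurgerySetup ε ρ c r s) {x : (Fin n → ℂ) × ℝ}
    (hx : x ∈ tropicalLagrangian φ ρ c r s) (hp : x.2 = 1 / 2) {v : Fin n → ℤ}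
    (hv : v ∈ φ.vertices) (hfc : φ.neckPrimitive ρ v (logVector x.1) = c) :
    tangentPlane (tropicalLagrangian φ ρ c r s) x = LinearMap.range (torusPlaneMap x.1
      ((neckReal (φ.neckCovector ρ v (logVector x.1)).ofLp).map Complex.ofReal +
        Complex.I • (neckImag (φ.phaseMatrix ρ x)
          (φ.neckCovector ρ v (logVector x.1)).ofLp).map Complex.ofReal)) := by
  have hc := D.const.1
  have hlt : φ.neckPrimitive ρ v (logVector x.1) < 2 * c := by rw [hfc]; linarith
  obtain ⟨-, hx3⟩ := (D.mem_iff_of_neckPrimitive_lt hv hlt).1 hx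
  obtain ⟨g, hgs, hgc, hgd, hg⟩ := D.profile.exists_neck_function
  have hfcont := D.continuousAt_neckPrimitive_logVector hx v
  set q := logVector x.1 with hq
  set w := φ.neckCovector ρ v q with hw
  have hw0 : w ≠ 0 := φ.gradient_ne_of_pos D.kernel D.exists_zero hv (by rw [hfc]; exact hc)
  have hw0' : w.ofLp ≠ 0 := fun h => hw0 (by ext i; exact congrFun h i)
  -- Here the equation is solved for the level of the primitive instead. Since `g'(1/2) = 0`, its
  -- differential is `w` alone, so the base vector is orthogonal to `w` and the variation of `p` is
  -- free.
  let G : EuclideanSpace ℝ (Fin n) × ℝ → ℝ := fun y => φ.neckPrimitive ρ v y.1 - g y.2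
  let ν := InnerProductSpace.toDual ℝ (EuclideanSpace ℝ (Fin n)) w
  have hf : HasStrictFDerivAt (φ.neckPrimitive ρ v) ν q :=
    (D.contDiff_neckPrimitive v).contDiffAt.hasStrictFDerivAt' (D.hasFDerivAt_neckPrimitive v q)
      (by simp)
  have hgder : HasStrictDerivAt g 0 x.2 := by
    rw [hp, ← hgd]
    exact hgs.contDiffAt.hasStrictDerivAt (by simp)
  have hG : HasStrictFDerivAt G (ν.comp (ContinuousLinearMap.fst ℝ _ ℝ)) (q, x.2) := by
    have h1 : HasStrictFDerivAt (fun y : EuclideanSpace ℝ (Fin n) × ℝ => φ.neckPrimitive ρ v y.1)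
        (ν.comp (ContinuousLinearMap.fst ℝ _ ℝ)) (q, x.2) :=
      HasStrictFDerivAt.comp (g := φ.neckPrimitive ρ v) (q, x.2) hf hasStrictFDerivAt_fst
    have h2 : HasStrictFDerivAt (fun y : EuclideanSpace ℝ (Fin n) × ℝ => g y.2)
        ((0 : ℝ) • ContinuousLinearMap.snd ℝ (EuclideanSpace ℝ (Fin n)) ℝ) (q, x.2) :=
      HasStrictDerivAt.comp_hasStrictFDerivAt (h₂ := g) (q, x.2) hgder hasStrictFDerivAt_snd
    have h3 := h1.sub h2
    rwa [zero_smul, sub_zero] at h3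
  let Y : EuclideanSpace ℝ (Fin n) × ℝ → EuclideanSpace ℝ (Fin n) :=
    fun y => y.2 • φ.neckCovector ρ v y.1
  have hY : HasFDerivAt Y (x.2 • (-fderiv ℝ (gradient (φ.smoothing ρ)) q).comp
      (ContinuousLinearMap.fst ℝ _ ℝ) + (ContinuousLinearMap.snd ℝ _ ℝ).smulRight w)
      (q, x.2) := by
    have h1 : HasFDerivAt (fun y : EuclideanSpace ℝ (Fin n) × ℝ => φ.neckCovector ρ v y.1)
        ((-fderiv ℝ (gradient (φ.smoothing ρ)) q).comp (ContinuousLinearMap.fst ℝ _ ℝ))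
        (q, x.2) :=
      HasFDerivAt.comp (g := φ.neckCovector ρ v) (q, x.2) (D.hasFDerivAt_neckCovector v q)
        hasFDerivAt_fst
    exact (hasFDerivAt_snd (𝕜 := ℝ) (p := (q, x.2))).smul h1
  have hxe : (torusPoint q (Y (q, x.2)), x.2) = x := Prod.ext hx3.symm rfl
  have hlim : Filter.Tendsto (fun y : (Fin n → ℂ) × ℝ =>
      (φ.neckPrimitive ρ v (logVector y.1), y.2)) (𝓝 x) (𝓝 (c, 1 / 2)) := by
    have h1 := hfcont.tendsto
    rw [← hq, hfc] at h1
    have h2 : Filter.Tendsto (fun y : (Fin n → ℂ) × ℝ => y.2) (𝓝 x) (𝓝 (1 / 2)) := by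
      rw [← hp]; exact continuousAt_snd
    exact h1.prodMk_nhds h2
  have key := mem_tangentPlane_iff hG (by
      intro h
      have := congrArg (fun f => f (w, (0 : ℝ))) h
      simp [ν] at this
      exact hw0 this) (by simp only [G]; rw [hfc, hp, hgc, sub_self]) hY
      (L := tropicalLagrangian φ ρ c r s) (by
      rw [hxe]
      filter_upwards [hlim.eventually hg, hfcont.eventually_lt continuousAt_const hlt]
        with y hy1 hy2
      rw [D.mem_iff_of_neckPrimitive_lt hv hy2, hy1.1]
      simp only [G, Y, sub_eq_zero]
      exact and_comm)
  rw [hxe] at key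
  have hxz : torusPoint q (Y (q, x.2)) = x.1 := hx3.symm
  have hmul : ∀ y : Fin n → ℝ, (neckReal w.ofLp).mulVec y =
      y - ((dotProduct w.ofLp w.ofLp)⁻¹ * dotProduct w.ofLp y) • w.ofLp := by
    intro y
    rw [neckReal, Matrix.sub_mulVec, Matrix.one_mulVec, Matrix.smul_mulVec,
      Matrix.vecMulVec_mulVec]
    funext i
    simp
    ring
  have hww : dotProduct w.ofLp w.ofLp ≠ 0 := by simpa using hw0'
  have hinner : ∀ ξ : EuclideanSpace ℝ (Fin n), inner ℝ w ξ = dotProduct w.ofLp ξ.ofLp := by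
    intro ξ
    simp [PiLp.inner_apply, dotProduct, mul_comm]
  have hval : ∀ y : Fin n → ℝ, torusPlaneMap x.1
      ((neckReal w.ofLp).map Complex.ofReal +
        Complex.I • (neckImag (φ.phaseMatrix ρ x) w.ofLp).map Complex.ofReal) y =
      fun j => x.1 j * (((neckReal w.ofLp).mulVec y j : ℝ) + 2 * Real.pi * Complex.I *
        (((-(x.2 • fderiv ℝ (gradient (φ.smoothing ρ)) q
          (WithLp.toLp 2 ((neckReal w.ofLp).mulVec y))) +
            dotProduct w.ofLp y • w : EuclideanSpace ℝ (Fin n)) j : ℝ) : ℂ)) := by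
    intro y
    funext j
    change x.1 j * _ = _
    congr 1
    have hone : ∀ (M M' : Matrix (Fin n) (Fin n) ℝ) (j : Fin n),
        (M.map Complex.ofReal + Complex.I • M'.map Complex.ofReal).mulVec (fun i => (y i : ℂ)) j =
          ((M.mulVec y j : ℝ) : ℂ) + Complex.I * ((M'.mulVec y j : ℝ) : ℂ) := by
      intro M M' j
      rw [Matrix.add_mulVec, Matrix.smul_mulVec]
      simp [Matrix.mulVec, dotProduct]
    rw [hone]
    have hM : (neckImag (φ.phaseMatrix ρ x) w.ofLp).mulVec y j = 2 * Real.pi *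
        (-(x.2 • fderiv ℝ (gradient (φ.smoothing ρ)) q
          (WithLp.toLp 2 ((neckReal w.ofLp).mulVec y))) +
            dotProduct w.ofLp y • w : EuclideanSpace ℝ (Fin n)) j := by
      rw [neckImag, Matrix.add_mulVec, ← Matrix.mulVec_mulVec, phaseMatrix, Matrix.smul_mulVec,
        Matrix.smul_mulVec, Matrix.vecMulVec_mulVec]
      have hh := hessianMatrix_mulVec (f := φ.smoothing ρ) q
        (WithLp.toLp 2 ((neckReal w.ofLp).mulVec y)) j
      simp only [Pi.add_apply, Pi.smul_apply, smul_eq_mul, PiLp.add_apply, PiLp.neg_apply,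
        PiLp.smul_apply, MulOpposite.smul_eq_mul_unop, MulOpposite.unop_op]
      rw [← hh, ← hq]
      ring
    rw [hM]
    push_cast
    ring
  ext η
  rw [key, LinearMap.mem_range]
  constructor
  · rintro ⟨ξ, τ, hk, rfl⟩
    have hk' : dotProduct w.ofLp ξ.ofLp = 0 := by
      rw [← hinner]; exact hk
    have h1 : dotProduct w.ofLp (ξ.ofLp + (τ / dotProduct w.ofLp w.ofLp) • w.ofLp) = τ := by
      rw [dotProduct_add, dotProduct_smul, hk', zero_add, smul_eq_mul, div_mul_cancel₀ _ hww]
    have h2 : (neckReal w.ofLp).mulVec (ξ.ofLp + (τ / dotProduct w.ofLp w.ofLp) • w.ofLp) =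
        ξ.ofLp := by
      rw [hmul, h1, inv_mul_eq_div, add_sub_cancel_right]
    -- The frame takes one vector `y` in place of the pair `(ξ, τ)`: its projection orthogonal to
    -- `w` is `ξ`, and its product with `w` is `τ`.
    refine ⟨ξ.ofLp + (τ / dotProduct w.ofLp w.ofLp) • w.ofLp, ?_⟩
    rw [hval, h1, h2, hxz]
    funext j
    simp
  · rintro ⟨y, rfl⟩
    refine ⟨WithLp.toLp 2 ((neckReal w.ofLp).mulVec y), dotProduct w.ofLp y, ?_, ?_⟩
    · change inner ℝ w (WithLp.toLp 2 ((neckReal w.ofLp).mulVec y)) = 0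
      rw [hinner]
      change dotProduct w.ofLp ((neckReal w.ofLp).mulVec y) = 0
      rw [hmul, dotProduct_sub, dotProduct_smul, smul_eq_mul]
      field_simp
      ring
    · rw [hval, hxz]
      funext j
      simp

end IsSurgerySetup

end TropicalPolynomial

/-! ### The phase of the tropical Lagrangian -/

/-- The branch cut of the argument is approached only from above, where the argument tends to its
value `π` on the negative axis. -/
theorem ContinuousAt.arg_of_im_nonneg {X : Type*} [TopologicalSpace X] {f : X → ℂ} {x₀ : X}
    (hf : ContinuousAt f x₀) (him : ∀ᶠ x in 𝓝 x₀, 0 ≤ (f x).im) (h0 : f x₀ ≠ 0) :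
    ContinuousAt (fun x => Complex.arg (f x)) x₀ := by
  by_cases hs : f x₀ ∈ Complex.slitPlane
  · exact ContinuousAt.comp (g := Complex.arg) (Complex.continuousAt_arg hs) hf
  · rw [Complex.mem_slitPlane_iff, not_or, not_lt, not_not] at hs
    have hre : (f x₀).re < 0 :=
      lt_of_le_of_ne hs.1 fun h => h0 (Complex.ext h hs.2)
    have h := Complex.continuousWithinAt_arg_of_re_neg_of_im_zero hre hs.2
    exact h.tendsto.comp (tendsto_nhdsWithin_iff.2 ⟨hf, him⟩)

/-- A change of sign adds `π` to the argument of the determinant, hence `2π` to that of its square.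
This permits normalizing the factor to the upper half plane. -/
theorem isSquaredPhase_of_det_eq {n : ℕ} {z : Fin n → ℂ} (hz : ∀ j, z j ≠ 0)
    {N : Matrix (Fin n) (Fin n) ℂ} {d f : ℂ} {θ : ℝ} (hd0 : d ≠ 0) (hf : f ≠ 0)
    (hd : d = ‖d‖ * (Circle.exp θ : ℂ)) (hN : N.det = d * f ∨ N.det = d * -f) :
    IsSquaredPhase (Matrix.diagonal z) (LinearMap.range (torusPlaneMap z N))
      (Circle.exp (2 * (θ + Complex.arg f))) := by
  have hff : f = ‖f‖ * (Circle.exp (Complex.arg f) : ℂ) := by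
    rw [Circle.coe_exp]
    exact (Complex.norm_mul_exp_arg_mul_I f).symm
  have hprod : d * f = (‖d‖ * ‖f‖ : ℝ) * (Circle.exp (θ + Complex.arg f) : ℂ) := by
    rw [Circle.exp_add, Circle.coe_mul]
    conv_lhs => rw [hd, hff]
    push_cast
    ring
  rcases hN with h | h
  · refine isSquaredPhase_range_torusPlaneMap hz (by rw [h]; exact mul_ne_zero hd0 hf) ?_
    rw [h, norm_mul]
    exact hprod
  · have h2 : Circle.exp (2 * (θ + Complex.arg f)) =
        Circle.exp (2 * (θ + Complex.arg f + Real.pi)) := by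
      rw [mul_add 2 (θ + Complex.arg f), Circle.exp_add, Circle.exp_two_pi, mul_one]
    rw [h2]
    refine isSquaredPhase_range_torusPlaneMap hz
      (by rw [h]; exact mul_ne_zero hd0 (neg_ne_zero.2 hf)) ?_
    rw [h, norm_mul, norm_neg, mul_neg, hprod, Circle.exp_add _ Real.pi, Circle.coe_mul]
    have hpi : (Circle.exp Real.pi : ℂ) = -1 := by
      rw [Circle.coe_exp, Complex.exp_pi_mul_I]
    rw [hpi]
    push_cast
    ring

theorem im_add_sum_resolventForm_nonneg {n : ℕ} {ι : Type*} (S : Finset ι)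
    {A : Matrix (Fin n) (Fin n) ℝ} (hA : A.IsSymm) (w : ι → Fin n → ℝ) {β : ι → ℝ}
    (hβ : ∀ v ∈ S, 0 ≤ β v) (e : ℝ) :
    0 ≤ ((e : ℂ) + Complex.I * ∑ v ∈ S, (β v : ℂ) * resolventForm A (w v)).im := by
  simp only [Complex.add_im, Complex.ofReal_im, zero_add, Complex.I_mul_im, Complex.re_sum,
    Complex.re_ofReal_mul]
  exact Finset.sum_nonneg fun v hv => mul_nonneg (hβ v hv) (resolventForm_re_nonneg hA _)

/-- The imaginary part is a sum of non-negative terms. If it vanishes, each summand vanishes as a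
complex number, because `β = 0` or `w = 0`, and only `e` remains. -/
theorem add_sum_resolventForm_ne_zero {n : ℕ} {ι : Type*} (S : Finset ι)
    {A : Matrix (Fin n) (Fin n) ℝ} (hA : A.IsSymm) (w : ι → Fin n → ℝ) {β : ι → ℝ}
    (hβ : ∀ v ∈ S, 0 ≤ β v) {e : ℝ} (he : e ≠ 0) :
    (e : ℂ) + Complex.I * ∑ v ∈ S, (β v : ℂ) * resolventForm A (w v) ≠ 0 := by
  intro h
  have him := congrArg Complex.im h
  simp only [Complex.add_im, Complex.ofReal_im, zero_add, Complex.I_mul_im, Complex.re_sum,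
    Complex.re_ofReal_mul, Complex.zero_im] at him
  rw [Finset.sum_eq_zero_iff_of_nonneg
    fun v hv => mul_nonneg (hβ v hv) (resolventForm_re_nonneg hA _)] at him
  have hsum : ∑ v ∈ S, (β v : ℂ) * resolventForm A (w v) = 0 := by
    refine Finset.sum_eq_zero fun v hv => ?_
    rcases mul_eq_zero.1 (him v hv) with h0 | h0
    · rw [h0, Complex.ofReal_zero, zero_mul]
    · by_cases hw : w v = 0
      · rw [hw, resolventForm_zero, mul_zero]
      · exact absurd h0 (resolventForm_re_pos hA hw).ne'
  rw [hsum, mul_zero, add_zero] at h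
  exact he (by exact_mod_cast h)

namespace TropicalPolynomial

variable {n : ℕ} (φ : TropicalPolynomial n)

/-- The complex number `wᵀ (1 + iA)⁻¹ w` for the differential `w` of the primitive at `v`. -/
noncomputable def vertexForm (ρ : EuclideanSpace ℝ (Fin n) → ℝ) (v : Fin n → ℤ)
    (x : (Fin n → ℂ) × ℝ) : ℂ :=
  resolventForm (φ.phaseMatrix ρ x) (φ.neckCovector ρ v (logVector x.1)).ofLp

/-- The contribution of the profile `k` to the determinant of the tangent plane. -/
noncomputable def sheetFactor (ρ : EuclideanSpace ℝ (Fin n) → ℝ) (k : ℝ → ℝ) (e : ℝ)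
    (x : (Fin n → ℂ) × ℝ) : ℂ :=
  e + Complex.I * ∑ v ∈ φ.vertexFinset,
    ((2 * Real.pi * deriv k (φ.neckPrimitive ρ v (logVector x.1)) : ℝ) : ℂ) * φ.vertexForm ρ v x

open Classical in
/-- The contribution of the necks to the determinant of the tangent plane at their middle level. -/
noncomputable def neckFactor (ρ : EuclideanSpace ℝ (Fin n) → ℝ) (c : ℝ) (x : (Fin n → ℂ) × ℝ) :
    ℂ :=
  Complex.I * ∑ v ∈ φ.vertexFinset, if φ.neckPrimitive ρ v (logVector x.1) < 2 * c then
    2 * Real.pi * φ.vertexForm ρ v x else 0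

open Classical in
/-- The contribution of the surgery to the determinant of the tangent plane, normalized to lie in the
closed upper half plane. -/
noncomputable def phaseFactor (ρ : EuclideanSpace ℝ (Fin n) → ℝ) (c : ℝ) (r s : ℝ → ℝ)
    (x : (Fin n → ℂ) × ℝ) : ℂ :=
  if 1 / 2 < x.2 then φ.sheetFactor ρ (derivWithin r (Set.Ici c)) 1 x
  else if x.2 < 1 / 2 then
    φ.sheetFactor ρ (derivWithin (fun t => t - s t) (Set.Ici c)) (-1) x
  else φ.neckFactor ρ c x

namespace IsSurgerySetup

variable {φ} {ε : ℝ} {ρ : EuclideanSpace ℝ (Fin n) → ℝ} {c : ℝ} {r s : ℝ → ℝ}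

theorem left_eq (D : φ.IsSurgerySetup ε ρ c r s) (t : ℝ) (ht : 2 * c ≤ t) :
    derivWithin r (Set.Ici c) t = (1 : ℤ) := by
  rw [D.profile.isConvexProfile_left.derivWithin_eq_one D.const.1 ht, Int.cast_one]

theorem right_eq (D : φ.IsSurgerySetup ε ρ c r s) (t : ℝ) (ht : 2 * c ≤ t) :
    derivWithin s (Set.Ici c) t = (0 : ℤ) := by
  have hc := D.const.1
  rw [D.profile.derivWithin_right (by linarith),
    D.profile.isConvexProfile_right.derivWithin_eq_one hc ht, Int.cast_zero, sub_self]

theorem upper_side (D : φ.IsSurgerySetup ε ρ c r s) {p : ℝ} (hp : 1 / 2 < p) :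
    (∀ t, (t, p) ∈ profileCurve c r s ↔ c < t ∧ p = derivWithin r (Set.Ici c) t) ∧
      (((1 : ℤ) = 0 ∧ p ≠ 1) ∨ ((1 : ℤ) = 1 ∧ p ≠ 0)) :=
  ⟨fun _ => D.profile.mem_profileCurve_of_gt hp, Or.inr ⟨rfl, by linarith⟩⟩

theorem lower_side (D : φ.IsSurgerySetup ε ρ c r s) {p : ℝ} (hp : p < 1 / 2) :
    (∀ t, (t, p) ∈ profileCurve c r s ↔ c < t ∧ p = derivWithin s (Set.Ici c) t) ∧
      (((0 : ℤ) = 0 ∧ p ≠ 1) ∨ ((0 : ℤ) = 1 ∧ p ≠ 0)) :=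
  ⟨fun _ => D.profile.mem_profileCurve_of_lt hp, Or.inl ⟨rfl, by linarith⟩⟩

theorem lt_neckPrimitive (D : φ.IsSurgerySetup ε ρ c r s) {x : (Fin n → ℂ) × ℝ}
    (hx : x ∈ tropicalLagrangian φ ρ c r s) (hp : x.2 ≠ 1 / 2) {v : Fin n → ℤ}
    (hv : v ∈ φ.vertices) : c < φ.neckPrimitive ρ v (logVector x.1) := by
  rcases lt_or_gt_of_ne hp with h | h
  · obtain ⟨h1, h2⟩ := D.lower_side h
    exact ((D.mem_iff_sheet D.right_eq h1 h2).1 hx).1 v hv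
  · obtain ⟨h1, h2⟩ := D.upper_side h
    exact ((D.mem_iff_sheet D.left_eq h1 h2).1 hx).1 v hv

theorem vertexForm_re_pos (D : φ.IsSurgerySetup ε ρ c r s) {x : (Fin n → ℂ) × ℝ} {v : Fin n → ℤ}
    (hv : v ∈ φ.vertices) (hq : 0 < φ.neckPrimitive ρ v (logVector x.1)) :
    0 < (φ.vertexForm ρ v x).re := by
  refine resolventForm_re_pos (D.phaseMatrix_isSymm x) fun h => ?_
  refine φ.gradient_ne_of_pos D.kernel D.exists_zero hv hq ?_
  ext i
  exact congrFun h i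

theorem neckFactor_eq (D : φ.IsSurgerySetup ε ρ c r s) {x : (Fin n → ℂ) × ℝ} {v : Fin n → ℤ}
    (hv : v ∈ φ.vertices) (hq : φ.neckPrimitive ρ v (logVector x.1) < 2 * c) :
    φ.neckFactor ρ c x = Complex.I * (2 * Real.pi * φ.vertexForm ρ v x) := by
  rw [neckFactor, D.sum_eq_single (fun v' _ h => if_neg (not_lt.2 h)) hv hq, if_pos hq]

/-- At most one neck lies over a given base point, so the sum of rank one matrices has at most one
non-zero term. -/
theorem det_sheet (D : φ.IsSurgerySetup ε ρ c r s) (x : (Fin n → ℂ) × ℝ) {a : ℝ → ℝ}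
    (ha : ∀ t, 2 * c ≤ t → a t = 0) :
    (onePlusI (φ.phaseMatrix ρ x + ∑ v ∈ φ.vertexFinset,
        (2 * Real.pi * a (φ.neckPrimitive ρ v (logVector x.1))) •
          Matrix.vecMulVec (φ.neckCovector ρ v (logVector x.1)).ofLp
            (φ.neckCovector ρ v (logVector x.1)).ofLp)).det =
      (onePlusI (φ.phaseMatrix ρ x)).det * (1 + Complex.I * ∑ v ∈ φ.vertexFinset,
        ((2 * Real.pi * a (φ.neckPrimitive ρ v (logVector x.1)) : ℝ) : ℂ) *
          φ.vertexForm ρ v x) := by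
  by_cases hex : ∃ v ∈ φ.vertices, φ.neckPrimitive ρ v (logVector x.1) < 2 * c
  · obtain ⟨v, hv, hq⟩ := hex
    rw [D.sum_eq_single (fun v' _ h => by rw [ha _ h, mul_zero, zero_smul]) hv hq,
      D.sum_eq_single (fun v' _ h => by rw [ha _ h, mul_zero, Complex.ofReal_zero, zero_mul]) hv hq,
      det_onePlusI_add_rank_one (D.phaseMatrix_isSymm x)]
    rfl
  · push Not at hex
    rw [sum_eq_zero (fun v' _ h => by rw [ha _ h, mul_zero, zero_smul]) hex,
      sum_eq_zero (fun v' _ h => by rw [ha _ h, mul_zero, Complex.ofReal_zero, zero_mul]) hex]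
    simp

theorem sheetMatrix_isSymm (D : φ.IsSurgerySetup ε ρ c r s) (x : (Fin n → ℂ) × ℝ)
    (a : (Fin n → ℤ) → ℝ) (w : (Fin n → ℤ) → Fin n → ℝ) :
    (φ.phaseMatrix ρ x + ∑ v ∈ φ.vertexFinset, a v • Matrix.vecMulVec (w v) (w v)).IsSymm := by
  refine (D.phaseMatrix_isSymm x).add ?_
  rw [Matrix.IsSymm, Matrix.transpose_sum]
  refine Finset.sum_congr rfl fun v _ => ?_
  rw [Matrix.transpose_smul, Matrix.transpose_vecMulVec]

theorem onePlusI_eq (A : Matrix (Fin n) (Fin n) ℝ) :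
    onePlusI A = (1 : Matrix (Fin n) (Fin n) ℝ).map Complex.ofReal +
      Complex.I • A.map Complex.ofReal := by
  rw [onePlusI, Matrix.map_one _ Complex.ofReal_zero Complex.ofReal_one]

theorem deriv_right (D : φ.IsSurgerySetup ε ρ c r s) {t : ℝ} (ht : c < t) :
    deriv (derivWithin s (Set.Ici c)) t =
      -deriv (derivWithin (fun t => t - s t) (Set.Ici c)) t :=
  (D.profile.hasDerivAt_derivWithin_right ht).deriv

/-- The factor which the surgery contributes to the determinant does not vanish. -/
theorem phaseFactor_ne_zero (D : φ.IsSurgerySetup ε ρ c r s) {x : (Fin n → ℂ) × ℝ}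
    (hx : x ∈ tropicalLagrangian φ ρ c r s) : φ.phaseFactor ρ c r s x ≠ 0 := by
  have hc := D.const.1
  unfold phaseFactor
  split_ifs with h1 h2
  · refine add_sum_resolventForm_ne_zero _ (D.phaseMatrix_isSymm x) _ (fun v hv => ?_) one_ne_zero
    exact mul_nonneg Real.two_pi_pos.le (D.profile.isConvexProfile_left.deriv_derivWithin_nonneg
      (D.lt_neckPrimitive hx h1.ne' (φ.mem_vertexFinset.1 hv)))
  · refine add_sum_resolventForm_ne_zero _ (D.phaseMatrix_isSymm x) _ (fun v hv => ?_)
      (neg_ne_zero.2 one_ne_zero)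
    exact mul_nonneg Real.two_pi_pos.le (D.profile.isConvexProfile_right.deriv_derivWithin_nonneg
      (D.lt_neckPrimitive hx h2.ne (φ.mem_vertexFinset.1 hv)))
  · obtain ⟨v, hv, hfc, -⟩ := D.neckPrimitive_of_half hx (le_antisymm (not_lt.1 h1) (not_lt.1 h2))
    rw [D.neckFactor_eq hv (by rw [hfc]; linarith)]
    have hre := D.vertexForm_re_pos (x := x) hv (by rw [hfc]; exact hc)
    have h0 : φ.vertexForm ρ v x ≠ 0 := fun h => by rw [h] at hre; simp at hre
    have hpi : (Real.pi : ℂ) ≠ 0 := by exact_mod_cast Real.pi_ne_zero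
    exact mul_ne_zero Complex.I_ne_zero (mul_ne_zero (mul_ne_zero two_ne_zero hpi) h0)

/-- The tangent planes are Lagrangian, and their determinants are, up to sign, the products of
`det (1 + iA)` and the phase factor. -/
theorem exists_frame (D : φ.IsSurgerySetup ε ρ c r s) {x : (Fin n → ℂ) × ℝ}
    (hx : x ∈ tropicalLagrangian φ ρ c r s) :
    ∃ X Y : Matrix (Fin n) (Fin n) ℝ, (X.transpose * Y).IsSymm ∧
      tangentPlane (tropicalLagrangian φ ρ c r s) x = LinearMap.range (torusPlaneMap x.1
        (X.map Complex.ofReal + Complex.I • Y.map Complex.ofReal)) ∧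
      ((X.map Complex.ofReal + Complex.I • Y.map Complex.ofReal).det =
          (onePlusI (φ.phaseMatrix ρ x)).det * φ.phaseFactor ρ c r s x ∨
        (X.map Complex.ofReal + Complex.I • Y.map Complex.ofReal).det =
          (onePlusI (φ.phaseMatrix ρ x)).det * -φ.phaseFactor ρ c r s x) := by
  have hc := D.const.1
  unfold phaseFactor
  split_ifs with h1 h2
  · have hT := D.tangentPlane_sheet (k := derivWithin r (Set.Ici c)) (κ := 1) D.left_eq
      (fun t ht => (D.profile.isConvexProfile_left.contDiffAt_derivWithin ht).of_le
        (by exact_mod_cast le_top)) hx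
      (by filter_upwards [lt_mem_nhds h1] with p hp using D.upper_side hp)
    rw [onePlusI_eq] at hT
    refine ⟨1, _, ?_, hT, Or.inl ?_⟩
    · rw [Matrix.transpose_one, Matrix.one_mul]
      exact D.sheetMatrix_isSymm x _ _
    · rw [← onePlusI_eq, D.det_sheet x
        fun t ht => D.profile.isConvexProfile_left.deriv_derivWithin_eq_zero hc ht, sheetFactor,
        Complex.ofReal_one]
  · have hlt : ∀ v ∈ φ.vertices, c < φ.neckPrimitive ρ v (logVector x.1) := fun v hv =>
      D.lt_neckPrimitive hx h2.ne hv
    have hsd : ∀ t, c < t → ContDiffAt ℝ 1 (derivWithin s (Set.Ici c)) t := fun t ht => by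
      have h3 := (contDiffAt_const (c := (1 : ℝ))).sub
        ((D.profile.isConvexProfile_right.contDiffAt_derivWithin ht).of_le
          (show (1 : WithTop ℕ∞) ≤ ∞ by exact_mod_cast le_top))
      refine h3.congr_of_eventuallyEq ?_
      filter_upwards [Ioi_mem_nhds ht] with u hu
      exact D.profile.derivWithin_right (le_of_lt hu)
    have hT := D.tangentPlane_sheet (k := derivWithin s (Set.Ici c)) (κ := 0) D.right_eq hsd hx
      (by filter_upwards [gt_mem_nhds h2] with p hp using D.lower_side hp)
    rw [onePlusI_eq] at hT
    -- On the lower sheet the determinant contains `1 + 2πi s''ζ`. The phase factor is its negative,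
    -- written with the second derivative of the convex function `t - s t`.
    refine ⟨1, _, ?_, hT, Or.inr ?_⟩
    · rw [Matrix.transpose_one, Matrix.one_mul]
      exact D.sheetMatrix_isSymm x _ _
    · rw [← onePlusI_eq, D.det_sheet x fun t ht => by
        rw [D.deriv_right (by linarith),
          D.profile.isConvexProfile_right.deriv_derivWithin_eq_zero hc ht, neg_zero]]
      congr 1
      rw [sheetFactor, neg_add, ← mul_neg, ← Finset.sum_neg_distrib]
      congr 1
      · simp
      · congr 1
        refine Finset.sum_congr rfl fun v hv => ?_
        rw [D.deriv_right (hlt v (φ.mem_vertexFinset.1 hv))]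
        push_cast
        ring
  · have hp : x.2 = 1 / 2 := le_antisymm (not_lt.1 h1) (not_lt.1 h2)
    obtain ⟨v, hv, hfc, -⟩ := D.neckPrimitive_of_half hx hp
    have hw : (φ.neckCovector ρ v (logVector x.1)).ofLp ≠ 0 := fun h => by
      refine φ.gradient_ne_of_pos D.kernel D.exists_zero hv (by rw [hfc]; exact hc) ?_
      ext i
      exact congrFun h i
    refine ⟨_, _, neck_isSymm (D.phaseMatrix_isSymm x) hw, D.tangentPlane_neck hx hp hv hfc,
      Or.inl ?_⟩
    rw [det_neck (D.phaseMatrix_isSymm x) hw, D.neckFactor_eq hv (by rw [hfc]; linarith)]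
    rfl

theorem isLagrangianPlane (D : φ.IsSurgerySetup ε ρ c r s) {x : (Fin n → ℂ) × ℝ}
    (hx : x ∈ tropicalLagrangian φ ρ c r s) :
    IsLagrangianPlane x.1 (tangentPlane (tropicalLagrangian φ ρ c r s) x) := by
  obtain ⟨X, Y, hXY, hT, hdet⟩ := D.exists_frame hx
  have hd := det_onePlusI_ne_zero (D.phaseMatrix_isSymm x)
  have hf := D.phaseFactor_ne_zero hx
  rw [hT]
  refine isLagrangianPlane_range_torusPlaneMap (D.ne_zero hx) hXY ?_
  rcases hdet with h | h <;> rw [h]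
  · exact mul_ne_zero hd hf
  · exact mul_ne_zero hd (neg_ne_zero.2 hf)

/-! ### Continuity of the phase along the tropical Lagrangian. -/

theorem continuous_logVector (D : φ.IsSurgerySetup ε ρ c r s) :
    Continuous fun x : tropicalLagrangian φ ρ c r s => logVector x.1.1 :=
  continuous_iff_continuousAt.2 fun x =>
    ContinuousAt.comp (g := fun y : (Fin n → ℂ) × ℝ => logVector y.1)
      (D.continuousAt_logVector_fst x.2) continuous_subtype_val.continuousAt

theorem continuous_neckPrimitive_logVector (D : φ.IsSurgerySetup ε ρ c r s) (v : Fin n → ℤ) :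
    Continuous fun x : tropicalLagrangian φ ρ c r s => φ.neckPrimitive ρ v (logVector x.1.1) :=
  (φ.continuous_neckPrimitive D.kernel v).comp D.continuous_logVector

theorem continuous_phaseMatrix (D : φ.IsSurgerySetup ε ρ c r s) :
    Continuous fun x : tropicalLagrangian φ ρ c r s => φ.phaseMatrix ρ x.1 := by
  have h1 : Continuous fun x : tropicalLagrangian φ ρ c r s => -(2 * Real.pi * x.1.2) := by
    fun_prop
  exact h1.smul
    ((continuous_hessianMatrix (φ.contDiff_smoothing D.kernel)).comp D.continuous_logVector)

theorem continuous_vertexForm (D : φ.IsSurgerySetup ε ρ c r s) (v : Fin n → ℤ) :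
    Continuous fun x : tropicalLagrangian φ ρ c r s => φ.vertexForm ρ v x.1 := by
  refine D.continuous_phaseMatrix.resolventForm ?_ fun x => D.phaseMatrix_isSymm x.1
  have := (D.continuous_neckCovector v).comp D.continuous_logVector
  exact (PiLp.continuous_ofLp 2 _).comp this

theorem continuousAt_sheetFactor (D : φ.IsSurgerySetup ε ρ c r s) {k : ℝ → ℝ}
    (hk : ∀ t, c < t → ContinuousAt (deriv k) t) (e : ℝ) (x : tropicalLagrangian φ ρ c r s)
    (hp : x.1.2 ≠ 1 / 2) :
    ContinuousAt (fun x : tropicalLagrangian φ ρ c r s => φ.sheetFactor ρ k e x.1) x := by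
  unfold sheetFactor
  refine continuousAt_const.add (continuousAt_const.mul ?_)
  refine tendsto_finsetSum _ fun v hv => ?_
  refine ContinuousAt.mul ?_ (D.continuous_vertexForm v).continuousAt
  refine Complex.continuous_ofReal.continuousAt.comp (continuousAt_const.mul ?_)
  exact ContinuousAt.comp (g := deriv k)
    (hk _ (D.lt_neckPrimitive x.2 hp (φ.mem_vertexFinset.1 hv)))
    (D.continuous_neckPrimitive_logVector v).continuousAt

theorem continuousAt_arg_sheetFactor (D : φ.IsSurgerySetup ε ρ c r s) {k : ℝ → ℝ}
    (hk : ∀ t, c < t → ContinuousAt (deriv k) t) (hk' : ∀ t, c < t → 0 ≤ deriv k t) {e : ℝ}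
    (he : e ≠ 0) (x : tropicalLagrangian φ ρ c r s) (hp : x.1.2 ≠ 1 / 2) :
    ContinuousAt (fun x : tropicalLagrangian φ ρ c r s =>
      Complex.arg (φ.sheetFactor ρ k e x.1)) x := by
  have hβ : ∀ y : tropicalLagrangian φ ρ c r s, y.1.2 ≠ 1 / 2 → ∀ v ∈ φ.vertexFinset,
      0 ≤ 2 * Real.pi * deriv k (φ.neckPrimitive ρ v (logVector y.1.1)) := fun y hy v hv =>
    mul_nonneg Real.two_pi_pos.le (hk' _ (D.lt_neckPrimitive y.2 hy (φ.mem_vertexFinset.1 hv)))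
  refine (D.continuousAt_sheetFactor hk e x hp).arg_of_im_nonneg ?_
    (add_sum_resolventForm_ne_zero _ (D.phaseMatrix_isSymm x.1) _ (hβ x hp) he)
  have hev : ∀ᶠ y : tropicalLagrangian φ ρ c r s in 𝓝 x, y.1.2 ≠ 1 / 2 :=
    (continuous_snd.comp continuous_subtype_val).continuousAt.eventually_ne hp
  filter_upwards [hev] with y hy
  exact im_add_sum_resolventForm_nonneg _ (D.phaseMatrix_isSymm y.1) _ (hβ y hy) e

theorem sheetFactor_eq (D : φ.IsSurgerySetup ε ρ c r s) {k : ℝ → ℝ}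
    (hk : ∀ t, 2 * c ≤ t → deriv k t = 0) (e : ℝ) {x : (Fin n → ℂ) × ℝ} {v : Fin n → ℤ}
    (hv : v ∈ φ.vertices) (hq : φ.neckPrimitive ρ v (logVector x.1) < 2 * c) :
    φ.sheetFactor ρ k e x = e + Complex.I *
      (((2 * Real.pi * deriv k (φ.neckPrimitive ρ v (logVector x.1)) : ℝ) : ℂ) *
        φ.vertexForm ρ v x) := by
  rw [sheetFactor, D.sum_eq_single
    (fun v' _ h => by rw [hk _ h, mul_zero, Complex.ofReal_zero, zero_mul]) hv hq]

theorem continuousAt_arg_phaseFactor_neck (D : φ.IsSurgerySetup ε ρ c r s)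
    (x : tropicalLagrangian φ ρ c r s) (hp : x.1.2 = 1 / 2) :
    ContinuousAt (fun x : tropicalLagrangian φ ρ c r s =>
      Complex.arg (φ.phaseFactor ρ c r s x.1)) x := by
  have hc := D.const.1
  obtain ⟨v, hv, hfc, -⟩ := D.neckPrimitive_of_half x.2 hp
  obtain ⟨g, hgs, hgc, hgd, hg⟩ := D.profile.exists_neck_function
  have hf := D.continuous_neckPrimitive_logVector v
  have hsnd : Continuous fun y : tropicalLagrangian φ ρ c r s => y.1.2 :=
    continuous_snd.comp continuous_subtype_val
  have hlim : Filter.Tendsto (fun y : tropicalLagrangian φ ρ c r s =>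
      (φ.neckPrimitive ρ v (logVector y.1.1), y.1.2)) (𝓝 x) (𝓝 (c, 1 / 2)) := by
    have := (hf.prodMk hsnd).tendsto x
    rwa [hfc, hp] at this
  have hlt : ∀ᶠ y : tropicalLagrangian φ ρ c r s in 𝓝 x,
      φ.neckPrimitive ρ v (logVector y.1.1) < 2 * c :=
    hf.continuousAt.eventually_lt continuousAt_const (by rw [hfc]; linarith)
  have hpos : ∀ᶠ y : tropicalLagrangian φ ρ c r s in 𝓝 x,
      0 < φ.neckPrimitive ρ v (logVector y.1.1) :=
    continuousAt_const.eventually_lt hf.continuousAt (by rw [hfc]; exact hc)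
  -- This is the phase factor rescaled by a positive number: by `g' = 1/r'' > 0` above `1/2`, by
  -- `-g' = -1/s'' > 0` below, and by `1` at `1/2`, where `g' = 0`. The second derivatives of the
  -- profiles have been divided out, so it is continuous through the middle level.
  let F : tropicalLagrangian φ ρ c r s → ℂ := fun y =>
    ((deriv g y.1.2 : ℝ) : ℂ) + Complex.I * (2 * Real.pi * φ.vertexForm ρ v y.1)
  have hFim : ∀ y, (F y).im = 2 * Real.pi * (φ.vertexForm ρ v y.1).re := fun y => by
    simp [F]
  have hFc : ContinuousAt F x := by
    have h1 : Continuous (deriv g) := hgs.continuous_deriv (by simp)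
    have h2 := D.continuous_vertexForm v
    have h3 : Continuous F := by
      refine (Complex.continuous_ofReal.comp (h1.comp hsnd)).add (continuous_const.mul ?_)
      exact continuous_const.mul h2
    exact h3.continuousAt
  have hFpos : ∀ᶠ y in 𝓝 x, 0 < (F y).im := by
    filter_upwards [hpos] with y hy
    rw [hFim]
    exact mul_pos Real.two_pi_pos (D.vertexForm_re_pos hv hy)
  have hF : ContinuousAt (fun y => Complex.arg (F y)) x :=
    hFc.arg_of_im_nonneg (hFpos.mono fun y hy => hy.le) fun h => by
      have := hFpos.self_of_nhds
      rw [h] at this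
      simp at this
  refine hF.congr ?_
  filter_upwards [hlim.eventually hg, hlt] with y hy hyq
  obtain ⟨-, hup, hlow⟩ := hy
  have hmem := ((D.mem_iff_of_neckPrimitive_lt hv hyq).1 y.2).1
  simp only [F, phaseFactor]
  split_ifs with h1 h2
  · have hgr := hup hmem h1
    have hcF := D.lt_neckPrimitive y.2 h1.ne' hv
    have hr := D.profile.isConvexProfile_left.deriv_derivWithin_nonneg hcF
    rw [D.sheetFactor_eq
      (fun t ht => D.profile.isConvexProfile_left.deriv_derivWithin_eq_zero hc ht) 1 hv hyq]
    set a := deriv g y.1.2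
    set b := deriv (derivWithin r (Set.Ici c)) (φ.neckPrimitive ρ v (logVector y.1.1))
    have ha : 0 < a := by
      by_contra! hneg
      have := mul_nonpos_of_nonpos_of_nonneg hneg hr
      linarith
    symm
    rw [← Complex.arg_real_mul _ ha]
    congr 1
    have habc : (a : ℂ) * b = 1 := by exact_mod_cast hgr
    push_cast
    linear_combination (Complex.I * (2 * Real.pi * φ.vertexForm ρ v y.1)) * habc
  · have hgr := hlow hmem h2
    have hcF := D.lt_neckPrimitive y.2 h2.ne hv
    have hr := D.profile.isConvexProfile_right.deriv_derivWithin_nonneg hcF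
    rw [D.deriv_right hcF] at hgr
    rw [D.sheetFactor_eq
      (fun t ht => D.profile.isConvexProfile_right.deriv_derivWithin_eq_zero hc ht) (-1) hv hyq]
    set a := deriv g y.1.2
    set b := deriv (derivWithin (fun t => t - s t) (Set.Ici c))
      (φ.neckPrimitive ρ v (logVector y.1.1))
    have ha : 0 < -a := by
      by_contra! hneg
      have := mul_nonpos_of_nonpos_of_nonneg hneg hr
      linarith
    symm
    rw [← Complex.arg_real_mul _ ha]
    congr 1
    have habc : (a : ℂ) * -b = 1 := by exact_mod_cast hgr
    push_cast
    linear_combination (Complex.I * (2 * Real.pi * φ.vertexForm ρ v y.1)) * habc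
  · have hyp : y.1.2 = 1 / 2 := le_antisymm (not_lt.1 h1) (not_lt.1 h2)
    rw [D.neckFactor_eq hv hyq, hyp, hgd, Complex.ofReal_zero, zero_add]

theorem continuous_arg_phaseFactor (D : φ.IsSurgerySetup ε ρ c r s) :
    Continuous fun x : tropicalLagrangian φ ρ c r s =>
      Complex.arg (φ.phaseFactor ρ c r s x.1) := by
  rw [continuous_iff_continuousAt]
  intro x
  have hsnd : Continuous fun y : tropicalLagrangian φ ρ c r s => y.1.2 :=
    continuous_snd.comp continuous_subtype_val
  rcases lt_trichotomy x.1.2 (1 / 2) with h | h | h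
  · refine (D.continuousAt_arg_sheetFactor
      (k := derivWithin (fun t => t - s t) (Set.Ici c)) (e := -1)
      (fun t ht => D.profile.isConvexProfile_right.continuousAt_deriv_derivWithin ht)
      (fun t ht => D.profile.isConvexProfile_right.deriv_derivWithin_nonneg ht)
      (by norm_num) x h.ne).congr ?_
    filter_upwards [hsnd.continuousAt.eventually_lt continuousAt_const h] with y hy
    rw [phaseFactor, if_neg (not_lt.2 hy.le), if_pos hy]
  · exact D.continuousAt_arg_phaseFactor_neck x h
  · refine (D.continuousAt_arg_sheetFactor (k := derivWithin r (Set.Ici c)) (e := 1)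
      (fun t ht => D.profile.isConvexProfile_left.continuousAt_deriv_derivWithin ht)
      (fun t ht => D.profile.isConvexProfile_left.deriv_derivWithin_nonneg ht)
      one_ne_zero x h.ne').congr ?_
    filter_upwards [continuousAt_const.eventually_lt hsnd.continuousAt h] with y hy
    rw [phaseFactor, if_pos hy]

/-- The squared phase of the tropical Lagrangian lifts to the line. -/
theorem exists_grading (D : φ.IsSurgerySetup ε ρ c r s) :
    ∃ θ : C(tropicalLagrangian φ ρ c r s, ℝ), ∀ x : tropicalLagrangian φ ρ c r s,
      IsSquaredPhase (Matrix.diagonal x.1.1) (tangentPlane (tropicalLagrangian φ ρ c r s) x)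
        (Circle.exp (θ x)) := by
  obtain ⟨Θ, hΘ⟩ := exists_continuous_arg_det n
  let A : tropicalLagrangian φ ρ c r s → {A : Matrix (Fin n) (Fin n) ℝ // A.IsSymm} := fun x =>
    ⟨φ.phaseMatrix ρ x.1, D.phaseMatrix_isSymm x.1⟩
  have hA : Continuous A := D.continuous_phaseMatrix.subtype_mk _
  refine ⟨⟨fun x => 2 * (Θ (A x) + Complex.arg (φ.phaseFactor ρ c r s x.1)),
    continuous_const.mul ((Θ.continuous.comp hA).add D.continuous_arg_phaseFactor)⟩, fun x => ?_⟩
  obtain ⟨X, Y, -, hT, hdet⟩ := D.exists_frame x.2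
  rw [hT]
  exact isSquaredPhase_of_det_eq (D.ne_zero x.2) (det_onePlusI_ne_zero (D.phaseMatrix_isSymm x.1))
    (D.phaseFactor_ne_zero x.2) (hΘ (A x)) hdet

end IsSurgerySetup

end TropicalPolynomial

/-! ### Lifting loops to the tropical Lagrangian -/

namespace TropicalPolynomial

namespace IsSurgerySetup

variable {n : ℕ} {φ : TropicalPolynomial n} {ε : ℝ} {ρ : EuclideanSpace ℝ (Fin n) → ℝ} {c : ℝ}
  {r s : ℝ → ℝ}

/-- The description of the tropical Lagrangian by closed conditions. -/
theorem mem_iff_le (D : φ.IsSurgerySetup ε ρ c r s) (x : (Fin n → ℂ) × ℝ) :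
    x ∈ tropicalLagrangian φ ρ c r s ↔
      (∃ v ∈ φ.vertices, φ.neckPrimitive ρ v (logVector x.1) ≤ 2 * c ∧
        (φ.neckPrimitive ρ v (logVector x.1), x.2) ∈ profileCurve c r s ∧
        x.1 = torusPoint (logVector x.1) (x.2 • φ.neckCovector ρ v (logVector x.1))) ∨
      ((∀ v ∈ φ.vertices, 2 * c ≤ φ.neckPrimitive ρ v (logVector x.1)) ∧
        ((x.2 = 0 ∧ x.1 = torusPoint (logVector x.1) 0) ∨
          (x.2 = 1 ∧ x.1 = torusPoint (logVector x.1)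
            (-gradient (φ.smoothing ρ) (logVector x.1))))) := by
  rw [D.mem_iff]
  constructor
  · refine Or.imp_left ?_
    rintro ⟨v, hv, h1, h2⟩
    exact ⟨v, hv, h1.le, h2⟩
  · rintro (⟨v, hv, h1, h2, h3⟩ | h)
    · rcases h1.lt_or_eq with hlt | heq
      -- In the remaining case the level is exactly `2c`: there `p` is `1` or `0`, and the neck
      -- formula gives one of the two sections, `df_v` and `-∇φ̃` differing by the lattice vector of
      -- `v`.
      · exact Or.inl ⟨v, hv, hlt, h2, h3⟩
      · refine Or.inr ⟨fun v' hv' => ?_, ?_⟩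
        · by_contra! hlt
          have := φ.eq_of_neckPrimitive_lt D.kernel D.exists_zero D.const hv hv' h1 hlt
          rw [← this, heq] at hlt
          exact lt_irrefl _ hlt
        · rw [heq] at h2
          rcases h2.2 with hr | hs
          · have hp : x.2 = 1 := by
              have := D.left_eq (2 * c) le_rfl
              rw [Int.cast_one] at this
              exact hr.trans this
            refine Or.inr ⟨hp, ?_⟩
            rw [hp, one_smul, neckCovector, sub_eq_neg_add, torusPoint_add_latticeVector] at h3
            exact h3
          · have hp : x.2 = 0 := by
              have := D.right_eq (2 * c) le_rfl
              rw [Int.cast_zero] at this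
              exact hs.trans this
            refine Or.inl ⟨hp, ?_⟩
            rw [hp, zero_smul] at h3
            exact h3
    · exact Or.inr h

theorem snd_mem_Icc (D : φ.IsSurgerySetup ε ρ c r s) {x : (Fin n → ℂ) × ℝ}
    (hx : x ∈ tropicalLagrangian φ ρ c r s) : x.2 ∈ Set.Icc (0 : ℝ) 1 := by
  rcases (D.mem_iff x).1 hx with ⟨v, -, -, h, -⟩ | ⟨-, ⟨h, -⟩ | ⟨h, -⟩⟩
  · exact D.profile.mem_Icc_of_mem_profileCurve D.const.1 h
  · rw [h]; norm_num
  · rw [h]; norm_num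

/-- The tropical Lagrangian is closed in `(ℂˣ)ⁿ × ℝ`. -/
theorem isClosed_preimage (D : φ.IsSurgerySetup ε ρ c r s) {X : Type*} [TopologicalSpace X]
    {f : X → (Fin n → ℂ) × ℝ} (hf : Continuous f) (hf0 : ∀ x j, (f x).1 j ≠ 0) :
    IsClosed (f ⁻¹' tropicalLagrangian φ ρ c r s) := by
  have hz : Continuous fun x => (f x).1 := continuous_fst.comp hf
  have hp : Continuous fun x => (f x).2 := continuous_snd.comp hf
  have hq : Continuous fun x => logVector (f x).1 := continuous_iff_continuousAt.2 fun x =>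
    ContinuousAt.comp (g := logVector) (continuousAt_logVector (hf0 x)) hz.continuousAt
  have hF : ∀ v, Continuous fun x => φ.neckPrimitive ρ v (logVector (f x).1) := fun v =>
    (φ.continuous_neckPrimitive D.kernel v).comp hq
  have hw : ∀ v, Continuous fun x => φ.neckCovector ρ v (logVector (f x).1) := fun v =>
    (D.continuous_neckCovector v).comp hq
  have hg : Continuous fun x => gradient (φ.smoothing ρ) (logVector (f x).1) :=
    (φ.contDiff_smoothing D.kernel).gradient_one.continuous.comp hq
  have htorus : ∀ Y : X → EuclideanSpace ℝ (Fin n), Continuous Y →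
      IsClosed {x | (f x).1 = torusPoint (logVector (f x).1) (Y x)} := fun Y hY =>
    isClosed_eq hz (continuous_torusPoint.comp (hq.prodMk hY))
  have hset : f ⁻¹' tropicalLagrangian φ ρ c r s =
      (⋃ v ∈ φ.vertices, {x | φ.neckPrimitive ρ v (logVector (f x).1) ≤ 2 * c} ∩
        ((fun x => (φ.neckPrimitive ρ v (logVector (f x).1), (f x).2)) ⁻¹' profileCurve c r s ∩
        {x | (f x).1 = torusPoint (logVector (f x).1)
          ((f x).2 • φ.neckCovector ρ v (logVector (f x).1))})) ∪
      ((⋂ v ∈ φ.vertices, {x | 2 * c ≤ φ.neckPrimitive ρ v (logVector (f x).1)}) ∩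
        (({x | (f x).2 = 0} ∩ {x | (f x).1 = torusPoint (logVector (f x).1) 0}) ∪
          ({x | (f x).2 = 1} ∩ {x | (f x).1 = torusPoint (logVector (f x).1)
            (-gradient (φ.smoothing ρ) (logVector (f x).1))}))) := by
    ext x
    rw [Set.mem_preimage, D.mem_iff_le]
    simp only [Set.mem_union, Set.mem_iUnion, Set.mem_inter_iff, Set.mem_iInter, Set.mem_preimage,
      Set.mem_ofPred_eq, exists_prop]
  rw [hset]
  refine IsClosed.union ?_ (IsClosed.inter ?_ (IsClosed.union ?_ ?_))
  · refine φ.vertices_finite.isClosed_biUnion fun v _ => ?_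
    exact (isClosed_le (hF v) continuous_const).inter
      ((D.profile.isClosed_profileCurve.preimage ((hF v).prodMk hp)).inter
        (htorus _ (hp.smul (hw v))))
  · exact isClosed_biInter fun v _ => isClosed_le continuous_const (hF v)
  · exact (isClosed_eq hp continuous_const).inter (htorus _ continuous_const)
  · exact (isClosed_eq hp continuous_const).inter (htorus _ hg.neg)

/-- If the immersion is injective, loops in its image lift. -/
theorem exists_lift (D : φ.IsSurgerySetup ε ρ c r s)
    (hinj : Set.InjOn Prod.fst (tropicalLagrangian φ ρ c r s)) {X : Type*} [TopologicalSpace X]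
    [CompactSpace X] [T2Space X] {z : X → Fin n → ℂ} (hz : Continuous z)
    (hmem : ∀ x, z x ∈ Prod.fst '' tropicalLagrangian φ ρ c r s) :
    ∃ b : C(X, tropicalLagrangian φ ρ c r s), ∀ x, (b x).1.1 = z x := by
  have hex : ∀ x, ∃ p : ℝ, (z x, p) ∈ tropicalLagrangian φ ρ c r s := fun x => by
    obtain ⟨⟨z', p⟩, h, heq⟩ := hmem x
    exact ⟨p, by rw [← heq]; exact h⟩
  choose p hp using hex
  have hz0 : ∀ x j, z x j ≠ 0 := fun x => D.ne_zero (hp x)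
  have hcl : IsClosed {y : X × ℝ | (z y.1, y.2) ∈ tropicalLagrangian φ ρ c r s} :=
    D.isClosed_preimage (f := fun y : X × ℝ => (z y.1, y.2)) (by fun_prop) fun y => hz0 y.1
  -- By injectivity the height `p` is the only one over each point, so its graph is the closed set
  -- above. The heights lie in the compact interval `[0, 1]`, so preimages of closed sets are
  -- projections of compact sets.
  have hpc : Continuous p := by
    refine continuous_iff_isClosed.2 fun C hC => ?_
    have hpre : p ⁻¹' C = Prod.fst ''
        ({y : X × ℝ | (z y.1, y.2) ∈ tropicalLagrangian φ ρ c r s} ∩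
          (Set.univ ×ˢ C) ∩ (Set.univ ×ˢ Set.Icc (0 : ℝ) 1)) := by
      ext x
      constructor
      · intro hx
        exact ⟨(x, p x), ⟨⟨hp x, trivial, hx⟩, trivial, D.snd_mem_Icc (hp x)⟩, rfl⟩
      · rintro ⟨⟨x', t⟩, ⟨⟨h1, -, h2⟩, -⟩, rfl⟩
        have h3 : (z x', p x') = (z x', t) := hinj (hp x') h1 rfl
        have h4 : p x' = t := congrArg Prod.snd h3
        change p x' ∈ C
        rw [h4]
        exact h2
    rw [hpre]
    refine IsCompact.isClosed (IsCompact.image ?_ continuous_fst)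
    exact (isCompact_univ.prod isCompact_Icc).inter_left (hcl.inter (isClosed_univ.prod hC))
  exact ⟨⟨fun x => ⟨(z x, p x), hp x⟩, (hz.prodMk hpc).subtype_mk _⟩, fun x => rfl⟩

end IsSurgerySetup

end TropicalPolynomial

theorem mainTheorem5 {n : ℕ} (φ : TropicalPolynomial n) :
    ∃ ε₀ : ℝ, 0 < ε₀ ∧ ∀ ε : ℝ, 0 < ε → ε < ε₀ →
      ∀ ρ : EuclideanSpace ℝ (Fin n) → ℝ, IsSmoothingKernel ε ρ →
      ∀ c : ℝ, φ.IsSurgeryConstant ρ ε c →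
      ∀ r s : ℝ → ℝ, IsSurgeryProfile c r s →
      ∀ L : Set ((Fin n → ℂ) × ℝ), L = tropicalLagrangian φ ρ c r s →
        (∀ x ∈ L, IsLagrangianPlane x.1 (tangentPlane L x)) ∧
        (∀ m : SingularH1 L, IsMaslovClass L m ↔ m = 0) ∧
        (∀ u : DiskOn L, ∀ k : ℤ, u.IsMaslovIndex k ↔ k = 0) ∧
        (Set.InjOn Prod.fst L →
          ∀ u : C(Metric.closedBall (0 : ℂ) 1, Fin n → ℂ), (∀ w j, u w j ≠ 0) →
            (∀ ζ : Circle, u (circleToDisk ζ) ∈ Prod.fst '' L) →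
            ∃ d : DiskOn L, d.toFun = u ∧ ∀ k : ℤ, d.IsMaslovIndex k ↔ k = 0) := by
  obtain ⟨ε₀, hε₀, hcell⟩ := φ.exists_radius
  refine ⟨ε₀, hε₀, fun ε _ hεε₀ ρ hρ c hc r s hrs L hL => ?_⟩
  subst hL
  have D : φ.IsSurgerySetup ε ρ c r s := by
    -- This is the only use of the bound on `ε`: at the centre of a ball of radius `ε₀` in the cell
    -- of `v`, the average over radius `ε` sees only points with zero gap, so the primitive vanishes
    -- there.
    refine ⟨hρ, fun v hv => ?_, hc, hrs⟩
    obtain ⟨x, hx⟩ := hcell v hv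
    exact ⟨x, φ.neckPrimitive_eq_zero_of_gap hρ fun y hy =>
      hx y (Metric.closedBall_subset_closedBall hεε₀.le hy)⟩
  obtain ⟨θ, hθ⟩ := D.exists_grading
  have hdisk := DiskOn.isMaslovIndex_iff_eq_zero θ hθ
  refine ⟨fun x hx => D.isLagrangianPlane hx,
    isMaslovClass_iff_eq_zero (fun x hx => D.ne_zero hx) θ hθ, hdisk,
    fun hinj u hu hmem => ?_⟩
  have hcd : Continuous circleToDisk := Continuous.subtype_mk (by fun_prop) _
  obtain ⟨b, hb⟩ := D.exists_lift hinj (u.continuous.comp hcd) hmem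
  exact ⟨⟨u, hu, b, hb⟩, rfl, hdisk _⟩
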